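/- Let $\Gamma$ be a (small) Picard groupoid, that is, a symmetric monoidal groupoid in which every object has an inverse up to isomorphism. A $\Gamma$-graded abelian group is a functor $M_\star\colon \Gamma^{\mathrm{op}}\to \mathrm{Ab}$, $\gamma\mapsto M_\gamma$; these form a symmetric monoidal category under Day convolution. For $\gamma\in\Gamma$ let $\Sigma^{-\gamma}M_\star$ denote the shift $\delta\mapsto M_{\gamma\otimes\delta}$. Let $R_\star$ be a $\Gamma$-graded commutative ring (a commutative monoid in this category), let $\otimes_{R_\star}$ and $F_{R_\star}(-,-)$ be the tensor product and the internal function object of graded $R_\star$-modules, and let an $R_\star$-algebra be a monoid in $R_\star$-modules. An $R_\star$-algebra $A_\star$ is Azumaya if (i) its underlying $R_\star$-module is a graded generator, i.e. all of its shifts are compact projective and together they form a set of generators of the category of graded $R_\star$-modules; and (ii) the map $A_\star\otimes_{R_\star}A_\star^{\mathrm{op}}\to F_{R_\star}(A_\star,A_\star)$ induced by $x\otimes y\mapsto(a\mapsto xay)$ (with the symmetry isomorphism that interchanges $y$ and $a$) is an isomorphism. By an $A_\star$-bimodule we mean an $A_\star$-bimodule in the category of graded $R_\star$-modules (the two induced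 actions of $R_\star$ agree). Put $HH^s_{R_\star}(A_\star,M_\star)=\mathrm{Ext}^s(A_\star,M_\star)$, where $\mathrm{Ext}$ is taken in the abelian category of $A_\star$-bimodules. Let $\mathrm{Der}_{R_\star}(A_\star,M_\star)$ be the group of $R_\star$-linear derivations $A_\star\to M_\star$, and let $\mathrm{Der}^s_{R_\star}(A_\star,M_\star)$ be its Quillen (nonabelian) derived functors: the cohomology groups $H^s(\mathrm{Der}_{R_\star}(P_\bullet,M_\star))$, where $P_\bullet\to A_\star$ is the standard simplicial resolution of $A_\star$ by free $R_\star$-algebras and $M_\star$ is regarded as a $P_n$-bimodule along $P_n\to A_\star$. All these groups are $\Gamma$-graded, the degree $\gamma$ part being obtained by replacing $M_\star$ by $\Sigma^{-\gamma}M_\star$. **Proposition.** Let $A_\star$ be an Azumaya $R_\star$-algebra and let $M_\star$ be an $A_\star$-bimodule. Then for every $\gamma\in\Gamma$ the sequence $$0\to HH^0_{R_\star}(A_\star,\Sigma^{-\gamma}M_\star)\to M_\gamma\to \mathrm{Der}_{R_\star}(A_\star,\Sigma^{-\gamma}M_\star)\to 0$$ is exact, that is, $$0\to HH^0(A_\star,M_\star)\to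 M_\star\to\mathrm{Der}(A_\star,M_\star)\to 0$$ is a short exact sequence of graded groups. Here the first map sends a bimodule map $f$ to $f(1)$ and the second sends $m$ to the inner derivation $a\mapsto am-ma$ (with the symmetry of $\Gamma$ understood). Moreover $HH^s_{R_\star}(A_\star,M_\star)=0$ and $\mathrm{Der}^s_{R_\star}(A_\star,M_\star)=0$ for all $s>0$. -/

import Mathlib

open CategoryTheory MonoidalCategory Opposite
universe u
namespace PicGraded

/-- A symmetric monoidal groupoid is a Picard groupoid if every object has an inverse for the tensor
product, up to isomorphism. -/
class IsPicard (Γ : Type u) [Groupoid.{u} Γ] [MonoidalCategory Γ] : Prop where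
  exists_inverse : ∀ γ : Γ, ∃ δ : Γ, Nonempty (γ ⊗ δ ≅ 𝟙_ Γ)

/-- `Γ`-graded abelian groups: contravariant functors from `Γ` to abelian groups. -/
abbrev GrAb (Γ : Type u) [Category.{u} Γ] := Γᵒᵖ ⥤ AddCommGrpCat.{u}

section basic
variable {Γ : Type u} [Category.{u} Γ]

/-- The degree `γ` part of a graded abelian group. -/
abbrev deg (M : GrAb Γ) (γ : Γ) : Type u := M.obj (op γ)

/-- The map `M_β → M_α` induced by a morphism `α ⟶ β`. -/
def res (M : GrAb Γ) {α β : Γ} (f : α ⟶ β) : deg M β →+ deg M α := (M.map f.op).hom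

/-- A map of graded abelian groups, applied to elements of degree `γ`. -/
def ap {M N : GrAb Γ} (φ : M ⟶ N) {γ : Γ} : deg M γ →+ deg N γ := (φ.app (op γ)).hom

theorem res_id (M : GrAb Γ) {α : Γ} (m : deg M α) : res M (𝟙 α) m = m := by
  simp [res]

theorem res_comp (M : GrAb Γ) {α β γ : Γ} (f : α ⟶ β) (g : β ⟶ γ) (m : deg M γ) :
    res M (f ≫ g) m = res M f (res M g m) := by
  simp [res]

theorem ap_res {M N : GrAb Γ} (φ : M ⟶ N) {α β : Γ} (f : α ⟶ β) (m : deg M β) :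
    ap φ (res M f m) = res N f (ap φ m) := by
  have := φ.naturality f.op
  exact congrArg (fun t => t.hom m) this

theorem ap_id {M : GrAb Γ} {α : Γ} (m : deg M α) : ap (𝟙 M) m = m := rfl
theorem ap_comp {M N P : GrAb Γ} (φ : M ⟶ N) (ψ : N ⟶ P) {α : Γ} (m : deg M α) :
   ap (φ ≫ ψ) m = ap ψ (ap φ m) := rfl
theorem ap_add {M N : GrAb Γ} (φ ψ : M ⟶ N) {α : Γ} (m : deg M α) :
   ap (φ + ψ) m = ap φ m + ap ψ m := rfl
theorem ap_neg {M N : GrAb Γ} (φ : M ⟶ N) {α : Γ} (m : deg M α) :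
   ap (-φ) m = - ap φ m := rfl
theorem ap_sub {M N : GrAb Γ} (φ ψ : M ⟶ N) {α : Γ} (m : deg M α) :
   ap (φ - ψ) m = ap φ m - ap ψ m := rfl
theorem ap_zero {M N : GrAb Γ} {α : Γ} (m : deg M α) :
   ap (0 : M ⟶ N) m = 0 := rfl
theorem hom_ext {M N : GrAb Γ} {φ ψ : M ⟶ N} (h : ∀ (γ : Γ) (m : deg M γ), ap φ m = ap ψ m) : φ = ψ := by
  ext γ m
  exact h γ.unop m

/-- A natural family of additive maps, as a map of graded abelian groups. -/
def mkHom {M N : GrAb Γ} (f : ∀ γ : Γ, deg M γ →+ deg N γ)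
    (hf : ∀ {α β : Γ} (g : α ⟶ β) (m : deg M β), f α (res M g m) = res N g (f β m)) : M ⟶ N where
  app γ := AddCommGrpCat.ofHom (f γ.unop)
  naturality α β g := by
    ext m
    exact hf g.unop m
theorem ap_mkHom {M N : GrAb Γ} (f : ∀ γ : Γ, deg M γ →+ deg N γ)
    (hf : ∀ {α β : Γ} (g : α ⟶ β) (m : deg M β), f α (res M g m) = res N g (f β m))
    {γ : Γ} (m : deg M γ) : ap (mkHom f hf) m = f γ m := rfl

end basic

section
variable {Γ : Type u} [Category.{u} Γ] [MonoidalCategory Γ] [SymmetricCategory Γ]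

/-- The symmetry moving `γ` past `α`. -/
def swap (γ α δ : Γ) : γ ⊗ α ⊗ δ ⟶ α ⊗ γ ⊗ δ :=
  (α_ γ α δ).inv ≫ (β_ γ α).hom ▷ δ ≫ (α_ α γ δ).hom

theorem swap_naturality {γ α α' δ δ' : Γ} (f : α ⟶ α') (g : δ ⟶ δ') :
   (γ ◁ (f ⊗ₘ g)) ≫ swap γ α' δ' = swap γ α δ ≫ (f ⊗ₘ (γ ◁ g)) := by
  have h : γ ◁ f ≫ (β_ γ α').hom = (β_ γ α).hom ≫ f ▷ γ := BraidedCategory.braiding_naturality_right γ f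
  have h' := congrArg (fun t => t ▷ δ) h
  simp only [comp_whiskerRight] at h'
  simp only [swap, MonoidalCategory.tensorHom_def, Category.assoc, whiskerLeft_comp]
  rw [associator_inv_naturality_right_assoc, associator_inv_naturality_middle_assoc,
    whisker_exchange_assoc, reassoc_of% h']
  simp

theorem swap_unit (γ δ : Γ) : swap γ (𝟙_ Γ) δ ≫ (λ_ (γ ⊗ δ)).hom = γ ◁ (λ_ δ).hom := by
  simp [swap]

theorem swap_tensor (γ α β δ : Γ) :
   swap γ (α ⊗ β) δ ≫ (α_ α β (γ ⊗ δ)).hom =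
    γ ◁ (α_ α β δ).hom ≫ swap γ α (β ⊗ δ) ≫ α ◁ swap γ β δ := by
  simp [swap]

theorem swap_right (γ α δ ε : Γ) :
   γ ◁ (α_ α δ ε).hom ≫ swap γ α (δ ⊗ ε) ≫ α ◁ (α_ γ δ ε).inv =
    (α_ γ (α ⊗ δ) ε).inv ≫ (swap γ α δ) ▷ ε ≫ (α_ α (γ ⊗ δ) ε).hom := by
  simp [swap]

theorem swap_braid (γ α δ : Γ) :
   swap γ α δ ≫ (β_ α (γ ⊗ δ)).hom = γ ◁ (β_ α δ).hom ≫ (α_ γ δ α).inv := by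
  simp [swap, ← comp_whiskerRight_assoc]

/-- A natural family of biadditive maps `M_α × N_β → P_{α ⊗ β}`; by the universal property of Day
convolution this is the same thing as a map `M ⊗ N ⟶ P` out of the Day convolution. -/
structure Pairing (M N P : GrAb Γ) where
  app : ∀ {α β : Γ}, deg M α →+ deg N β →+ deg P (α ⊗ β)
  app_res : ∀ {α α' β β' : Γ} (f : α' ⟶ α) (g : β' ⟶ β) (m : deg M α) (n : deg N β),
    app (res M f m) (res N g n) = res P (f ⊗ₘ g) (app m n)

variable (Γ) in
/-- A `Γ`-graded ring: a monoid for Day convolution on graded abelian groups. -/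
structure GrRing where
  obj : GrAb Γ
  mul : Pairing obj obj obj
  one : deg obj (𝟙_ Γ)
  one_mul : ∀ {α : Γ} (x : deg obj α), mul.app one x = res obj (λ_ α).hom x
  mul_one : ∀ {α : Γ} (x : deg obj α), mul.app x one = res obj (ρ_ α).hom x
  mul_assoc : ∀ {α β γ : Γ} (x : deg obj α) (y : deg obj β) (z : deg obj γ),
    mul.app (mul.app x y) z = res obj (α_ α β γ).hom (mul.app x (mul.app y z))

variable (Γ) in
/-- A `Γ`-graded commutative ring: a commutative monoid for Day convolution. -/
structure GrCommRing extends GrRing Γ where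
  mul_comm : ∀ {α β : Γ} (x : deg obj α) (y : deg obj β),
    mul.app x y = res obj (β_ α β).hom (mul.app y x)

/-- An algebra over the graded commutative ring `R`: a monoid in graded `R`-modules, equivalently
a graded ring with a central ring map from `R`. -/
structure GrAlg (R : GrCommRing Γ) extends GrRing Γ where
  unit : R.obj ⟶ obj
  unit_one : ap unit R.one = one
  unit_mul : ∀ {α β : Γ} (r : deg R.obj α) (s : deg R.obj β),
    ap unit (R.mul.app r s) = mul.app (ap unit r) (ap unit s)
  unit_comm : ∀ {α β : Γ} (r : deg R.obj α) (x : deg obj β),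
    mul.app (ap unit r) x = res obj (β_ α β).hom (mul.app x (ap unit r))

variable {R : GrCommRing Γ}

namespace GrAlg
/-- Maps of `R`-algebras. -/
@[ext]
structure Hom (A B : GrAlg R) where
  hom : A.obj ⟶ B.obj
  map_one : ap hom A.one = B.one
  map_mul : ∀ {α β : Γ} (x : deg A.obj α) (y : deg A.obj β),
    ap hom (A.mul.app x y) = B.mul.app (ap hom x) (ap hom y)
  map_unit : ∀ {α : Γ} (r : deg R.obj α), ap hom (ap A.unit r) = ap B.unit r

instance : Category (GrAlg R) where
  Hom := Hom
  id A := ⟨𝟙 _, by simp [ap_id], by simp [ap_id], by simp [ap_id]⟩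
  comp f g := ⟨f.hom ≫ g.hom, by simp [ap_comp, f.map_one, g.map_one],
    by simp [ap_comp, f.map_mul, g.map_mul], by simp [ap_comp, f.map_unit, g.map_unit]⟩

end GrAlg

variable (R) in
/-- Modules over the graded commutative ring `R`. -/
structure GrMod where
  obj : GrAb Γ
  smul : Pairing R.obj obj obj
  one_smul : ∀ {α : Γ} (m : deg obj α), smul.app R.one m = res obj (λ_ α).hom m
  mul_smul : ∀ {α β γ : Γ} (r : deg R.obj α) (s : deg R.obj β) (m : deg obj γ),
    smul.app (R.mul.app r s) m = res obj (α_ α β γ).hom (smul.app r (smul.app s m))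

namespace GrMod
/-- Maps of graded `R`-modules. -/
@[ext]
structure Hom (M N : GrMod R) where
  hom : M.obj ⟶ N.obj
  map_smul : ∀ {α β : Γ} (r : deg R.obj α) (m : deg M.obj β),
    ap hom (M.smul.app r m) = N.smul.app r (ap hom m)

instance : Category (GrMod R) where
  Hom := Hom
  id A := ⟨𝟙 _, by simp [ap_id]⟩
  comp f g := ⟨f.hom ≫ g.hom, by simp [ap_comp, f.map_smul, g.map_smul]⟩

theorem hom_ext {M N : GrMod R} {f g : M ⟶ N}
   (h : ∀ (γ : Γ) (m : deg M.obj γ), ap f.hom m = ap g.hom m) : f = g :=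
  Hom.ext (PicGraded.hom_ext h)

end GrMod

/-- The graded abelian group `δ ↦ M_{γ ⊗ δ}`. If `γ⁻¹` is an inverse of `γ`, this is the
suspension `Σ^{γ⁻¹} M`. -/
abbrev shiftAb (γ : Γ) (M : GrAb Γ) : GrAb Γ := (tensorLeft γ).op ⋙ M

theorem res_shiftAb (γ : Γ) (M : GrAb Γ) {α β : Γ} (f : α ⟶ β) (m : deg M (γ ⊗ β)) :
   res (shiftAb γ M) f m = res M (γ ◁ f) m := rfl

/-- The pairing `M_α × N_{γ ⊗ δ} → P_{γ ⊗ (α ⊗ δ)}` induced by a pairing, using the symmetry. -/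
def Pairing.shift (γ : Γ) {M N P : GrAb Γ} (p : Pairing M N P) :
   Pairing M (shiftAb γ N) (shiftAb γ P) where
  app {α δ} := AddMonoidHom.compr₂ p.app (res P (swap γ α δ))
  app_res f g m n := by
    change res P _ (p.app (res M f m) (res N (γ ◁ g) n)) = res P _ (res P _ (p.app m n))
    rw [p.app_res, ← res_comp, ← res_comp]
    exact congrArg (fun k => res P k (p.app m n)) (swap_naturality f g).symm

/-- The pairing `M_{γ ⊗ α} × N_δ → P_{γ ⊗ (α ⊗ δ)}` induced by a pairing. -/
def Pairing.shiftR (γ : Γ) {M N P : GrAb Γ} (p : Pairing M N P) :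
   Pairing (shiftAb γ M) N (shiftAb γ P) where
  app {α δ} := AddMonoidHom.compr₂ p.app (res P (α_ γ α δ).inv)
  app_res f g m n := by
    change res P _ (p.app (res M (γ ◁ f) m) (res N g n)) = res P _ (res P _ (p.app m n))
    rw [p.app_res, ← res_comp, ← res_comp]
    refine congrArg (fun k => res P k (p.app m n)) ?_
    change _ = (γ ◁ (f ⊗ₘ g)) ≫ (α_ γ _ _).inv
    rw [← id_tensorHom, ← id_tensorHom, associator_inv_naturality]

theorem Pairing.res_left {M N P : GrAb Γ} (p : Pairing M N P) {α α' β : Γ} (f : α' ⟶ α)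
   (m : deg M α) (n : deg N β) : p.app (res M f m) n = res P (f ▷ β) (p.app m n) := by
  have := p.app_res f (𝟙 β) m n
  rwa [res_id, tensorHom_id] at this

theorem Pairing.res_right {M N P : GrAb Γ} (p : Pairing M N P) {α β β' : Γ} (f : β' ⟶ β)
   (m : deg M α) (n : deg N β) : p.app m (res N f n) = res P (α ◁ f) (p.app m n) := by
  have := p.app_res (𝟙 α) f m n
  rwa [res_id, id_tensorHom] at this

/-- The shifted module `δ ↦ M_{γ ⊗ δ}`. -/
def GrMod.shift (M : GrMod R) (γ : Γ) : GrMod R where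
  obj := shiftAb γ M.obj
  smul := M.smul.shift γ
  one_smul {α} m := by
    change res M.obj (swap γ _ _) (M.smul.app R.one m) = res M.obj (γ ◁ _) m
    rw [M.one_smul, ← res_comp, swap_unit]
    rfl
  mul_smul {α β δ} r s m := by
    change res M.obj (swap γ _ _) (M.smul.app (R.mul.app r s) m) =
      res M.obj (γ ◁ _) (res M.obj (swap γ _ _) (M.smul.app r (res M.obj (swap γ _ _) (M.smul.app s m))))
    rw [M.mul_smul, M.smul.res_right, ← res_comp, ← res_comp, ← res_comp, swap_tensor,
      Category.assoc]
    rfl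


/-- The underlying `R`-module of an `R`-algebra. -/
@[reducible] def GrAlg.toMod (A : GrAlg R) : GrMod R where
  obj := A.obj
  smul :=
    { app := A.mul.app.comp (ap A.unit)
      app_res := fun f g r a => by
        change A.mul.app (ap A.unit (res R.obj f r)) _ = res _ _ (A.mul.app (ap A.unit r) a)
        rw [ap_res, A.mul.app_res] }
  one_smul a := by
    change A.mul.app (ap A.unit R.one) a = _
    rw [A.unit_one, A.one_mul]
  mul_smul r s a := by
    change A.mul.app (ap A.unit (R.mul.app r s)) a = res _ _ (A.mul.app _ (A.mul.app _ a))
    rw [A.unit_mul, A.mul_assoc]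

theorem GrAlg.toMod_smul (A : GrAlg R) {α β : Γ} (r : deg R.obj α) (a : deg A.obj β) :
    A.toMod.smul.app r a = A.mul.app (ap A.unit r) a := rfl

theorem hom_injective {M N : GrMod R} :
    Function.Injective (fun f : M ⟶ N => f.hom) := fun _ _ h => GrMod.Hom.ext h

section
variable {M N : GrMod R}
instance : Zero (M ⟶ N) := ⟨⟨0, fun r m => by simp [ap_zero]⟩⟩
instance : Add (M ⟶ N) := ⟨fun f g => ⟨f.hom + g.hom, fun r m => by
  simp [ap_add, f.map_smul, g.map_smul]⟩⟩
instance : Neg (M ⟶ N) := ⟨fun f => ⟨-f.hom, fun r m => by simp [ap_neg, f.map_smul]⟩⟩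
instance : Sub (M ⟶ N) := ⟨fun f g => ⟨f.hom - g.hom, fun r m => by
  simp [ap_sub, f.map_smul, g.map_smul]⟩⟩
instance : AddCommGroup (M ⟶ N) :=
  { (inferInstance : Zero (M ⟶ N)), (inferInstance : Add (M ⟶ N)),
    (inferInstance : Neg (M ⟶ N)), (inferInstance : Sub (M ⟶ N)) with
    add_assoc := fun _ _ _ => hom_injective (add_assoc _ _ _)
    zero_add := fun _ => hom_injective (zero_add _)
    add_zero := fun _ => hom_injective (add_zero _)
    add_comm := fun _ _ => hom_injective (add_comm _ _)
    sub_eq_add_neg := fun _ _ => hom_injective (sub_eq_add_neg _ _)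
    neg_add_cancel := fun _ => hom_injective (neg_add_cancel _)
    nsmul := nsmulRec
    zsmul := zsmulRec }
end

/-- Generators `m ⊗ n` of the degree `γ` part of `M ⊗_R N`, one for each morphism
`γ ⟶ α ⊗ β` and elements `m ∈ M_α`, `n ∈ N_β`. -/
structure TensorGen (M N : GrMod R) (γ : Γ) : Type u where
  {left : Γ}
  {right : Γ}
  arrow : γ ⟶ left ⊗ right
  fst : deg M.obj left
  snd : deg N.obj right

/-- The relations of the tensor product: biadditivity, the coend relation of Day convolution, and
`m r ⊗ n = m ⊗ r n`, where `m r` is `r m` transported along the symmetry. -/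
inductive TensorRel (M N : GrMod R) (γ : Γ) : FreeAbelianGroup (TensorGen M N γ) → Prop
  | add_left {α β : Γ} (f : γ ⟶ α ⊗ β) (m m' : deg M.obj α) (n : deg N.obj β) :
      TensorRel M N γ (.of ⟨f, m + m', n⟩ - .of ⟨f, m, n⟩ - .of ⟨f, m', n⟩)
  | add_right {α β : Γ} (f : γ ⟶ α ⊗ β) (m : deg M.obj α) (n n' : deg N.obj β) :
      TensorRel M N γ (.of ⟨f, m, n + n'⟩ - .of ⟨f, m, n⟩ - .of ⟨f, m, n'⟩)
  | res {α α' β β' : Γ} (f : γ ⟶ α' ⊗ β') (g : α' ⟶ α) (h : β' ⟶ β)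
      (m : deg M.obj α) (n : deg N.obj β) :
      TensorRel M N γ (.of ⟨f ≫ (g ⊗ₘ h), m, n⟩ - .of ⟨f, res M.obj g m, res N.obj h n⟩)
  | balanced {α β δ : Γ} (f : γ ⟶ (α ⊗ β) ⊗ δ) (m : deg M.obj α) (r : deg R.obj β)
      (n : deg N.obj δ) :
      TensorRel M N γ (.of ⟨f, res M.obj (β_ α β).hom (M.smul.app r m), n⟩ -
        .of ⟨f ≫ (α_ α β δ).hom, m, N.smul.app r n⟩)

/-- The degree `γ` part of `M ⊗_R N`: the coequalizer of the two maps
`M ⊗ R ⊗ N ⇉ M ⊗ N` of Day convolutions. -/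
abbrev Tensor (M N : GrMod R) (γ : Γ) : Type u :=
  FreeAbelianGroup (TensorGen M N γ) ⧸ AddSubgroup.closure {t | TensorRel M N γ t}

/-- The degree `γ` part of the internal function module `F_R(M, N)`, that is, `R`-module maps that
raise the degree by `γ`. -/
abbrev InternalHom (M N : GrMod R) (γ : Γ) : Type u := M ⟶ N.shift γ

/-- The symmetry moving `β` past `δ`. -/
def rot (α β δ : Γ) : (α ⊗ β) ⊗ δ ⟶ α ⊗ δ ⊗ β := (α_ α β δ).hom ≫ α ◁ (β_ β δ).hom

theorem GrAlg.mul_unit (A : GrAlg R) {α β : Γ} (x : deg A.obj α) (r : deg R.obj β) :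
    A.mul.app x (ap A.unit r) = res A.obj (β_ α β).hom (A.mul.app (ap A.unit r) x) := by
  rw [A.unit_comm, ← res_comp, SymmetricCategory.symmetry, res_id]

theorem GrAlg.mul_assoc' (A : GrAlg R) {α β γ : Γ} (x : deg A.obj α) (y : deg A.obj β)
    (z : deg A.obj γ) : A.mul.app x (A.mul.app y z) =
      res A.obj (α_ α β γ).inv (A.mul.app (A.mul.app x y) z) := by
  rw [A.mul_assoc, ← res_comp, Iso.inv_hom_id, res_id]

section
variable (A : GrAlg R) {γ α β : Γ} (f : γ ⟶ α ⊗ β) (x : deg A.obj α) (y : deg A.obj β)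

/-- The map `a ↦ x a y`, with values transported along the symmetry and along `f : γ ⟶ α ⊗ β`. -/
def sandwichFun (δ : Γ) : deg A.obj δ →+ deg A.obj (γ ⊗ δ) :=
  (res A.obj (f ▷ δ ≫ rot α β δ)).comp ((A.mul.app x).comp (A.mul.app.flip y))

theorem sandwichFun_apply {δ : Γ} (a : deg A.obj δ) : sandwichFun A f x y δ a =
  res A.obj (f ▷ δ ≫ rot α β δ) (A.mul.app x (A.mul.app a y)) := rfl

theorem sandwichFun_res {δ δ' : Γ} (g : δ' ⟶ δ) (a : deg A.obj δ) :
    sandwichFun A f x y δ' (res A.obj g a) = res A.obj (γ ◁ g) (sandwichFun A f x y δ a) := by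
  rw [sandwichFun_apply, sandwichFun_apply, A.mul.res_left, A.mul.res_right, ← res_comp,
    ← res_comp]
  congr 2
  simp [rot, whisker_exchange_assoc, ← MonoidalCategory.whiskerLeft_comp]

theorem rot_swap (ε δ : Γ) :
    (swap γ ε δ ≫ ε ◁ (f ▷ δ ≫ rot α β δ)) =
      γ ◁ 𝟙 (ε ⊗ δ) ≫ f ▷ (ε ⊗ δ) ≫ rot α β (ε ⊗ δ) ≫ α ◁ (α_ ε δ β).hom ≫
      (α_ α ε (δ ⊗ β)).inv ≫ (β_ α ε).hom ▷ (δ ⊗ β) ≫ (α_ ε α (δ ⊗ β)).hom := by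
  have h := congrArg (fun t => t ▷ δ) (BraidedCategory.braiding_naturality_left f ε)
  simp only [comp_whiskerRight] at h
  have h2 : (β_ γ ε).hom ▷ δ ≫ (α_ ε γ δ).hom ≫ ε ◁ f ▷ δ =
     f ▷ ε ▷ δ ≫ (β_ (α ⊗ β) ε).hom ▷ δ ≫ (α_ ε (α ⊗ β) δ).hom := by
    rw [← associator_naturality_middle, reassoc_of% h]
  simp only [swap, rot, MonoidalCategory.whiskerLeft_comp, Category.assoc, reassoc_of% h2]
  have h3 : (β_ α ε).hom ▷ (β ⊗ δ) ≫ (ε ⊗ α) ◁ (β_ β δ).hom =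
      (α ⊗ ε) ◁ (β_ β δ).hom ≫ (β_ α ε).hom ▷ (δ ⊗ β) := (whisker_exchange _ _).symm
  calc _ = (α_ γ ε δ).inv ≫ f ▷ ε ▷ δ ≫ (α_ α β ε).hom ▷ δ ⊗≫ α ◁ (β_ β ε).hom ▷ δ ⊗≫
        ((β_ α ε).hom ▷ (β ⊗ δ) ≫ (ε ⊗ α) ◁ (β_ β δ).hom) ≫ (α_ ε α (δ ⊗ β)).hom := by
        simp [monoidalComp]
    _ = _ := by
        rw [h3]
        simp [monoidalComp]

theorem sandwichFun_smul {δ ε : Γ} (r : deg R.obj ε) (a : deg A.obj δ) :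
    sandwichFun A f x y (ε ⊗ δ) (A.mul.app (ap A.unit r) a) =
      res A.obj (swap γ ε δ) (A.mul.app (ap A.unit r) (sandwichFun A f x y δ a)) := by
  rw [sandwichFun_apply, sandwichFun_apply, A.mul_assoc, A.mul.res_right, A.mul_assoc',
    A.mul_unit, A.mul.res_left, A.mul_assoc, A.mul.res_right]
  simp only [← res_comp]
  refine congrArg (fun k => res A.obj k _) ?_
  rw [rot_swap]
  simp only [Category.assoc, MonoidalCategory.whiskerLeft_id, Category.id_comp]

end

/-- The `R`-linear endomorphism `a ↦ x a y` of degree `γ` attached to a generator `x ⊗ y`. -/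
def sandwich (A : GrAlg R) {γ : Γ} (t : TensorGen A.toMod A.toMod γ) :
    InternalHom A.toMod A.toMod γ where
  hom := mkHom (N := shiftAb γ A.obj) (sandwichFun A t.arrow t.fst t.snd)
    (sandwichFun_res A t.arrow t.fst t.snd)
  map_smul r a := sandwichFun_smul A t.arrow t.fst t.snd r a


theorem rot_naturality {α α' β β' δ : Γ} (g : α' ⟶ α) (h : β' ⟶ β) :
    (g ⊗ₘ h) ▷ δ ≫ rot α β δ = rot α' β' δ ≫ (g ⊗ₘ (δ ◁ h)) := by
  have h1 : h ▷ δ ≫ (β_ β δ).hom = (β_ β' δ).hom ≫ δ ◁ h := by simp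
  rw [rot, rot, ← tensorHom_id, associator_naturality_assoc, Category.assoc,
    ← id_tensorHom, tensorHom_comp_tensorHom, ← id_tensorHom, tensorHom_comp_tensorHom,
    tensorHom_id, Category.comp_id, Category.id_comp, h1]

theorem sandwichFun_tensorHom (A : GrAlg R) {γ α α' β β' δ : Γ} (f : γ ⟶ α' ⊗ β') (g : α' ⟶ α)
    (h : β' ⟶ β) (x : deg A.obj α) (y : deg A.obj β) (a : deg A.obj δ) :
    sandwichFun A (f ≫ (g ⊗ₘ h)) x y δ a =
      sandwichFun A f (res A.obj g x) (res A.obj h y) δ a := by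
  rw [sandwichFun_apply, sandwichFun_apply, A.mul.res_left, A.mul.res_right, A.mul.res_right]
  simp only [← res_comp]
  refine congrArg (fun k => res A.obj k _) ?_
  rw [comp_whiskerRight, Category.assoc, Category.assoc, rot_naturality,
    MonoidalCategory.tensorHom_def]

theorem sandwichFun_balanced (A : GrAlg R) {γ α β δ ε : Γ} (f : γ ⟶ (α ⊗ β) ⊗ δ)
    (x : deg A.obj α) (r : deg R.obj β) (y : deg A.obj δ) (a : deg A.obj ε) :
    sandwichFun A f (res A.obj (β_ α β).hom (A.mul.app (ap A.unit r) x)) y ε a =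
      sandwichFun A (f ≫ (α_ α β δ).hom) x (A.mul.app (ap A.unit r) y) ε a := by
  rw [← A.mul_unit, sandwichFun_apply, sandwichFun_apply, A.mul_assoc' a, A.mul_unit a,
    A.mul.res_left, A.mul_assoc, A.mul_assoc]
  simp only [A.mul.res_right, ← res_comp]
  refine congrArg (fun k => res A.obj k _) ?_
  have h : α ◁ (β_ β ε).hom ▷ δ ≫ α ◁ (β_ ε β).hom ▷ δ = 𝟙 _ := by
    simp [← MonoidalCategory.whiskerLeft_comp, ← comp_whiskerRight]
  simp [rot, reassoc_of% h]

theorem sandwich_apply (A : GrAlg R) {γ α β δ : Γ} (f : γ ⟶ α ⊗ β) (x : deg A.obj α)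
    (y : deg A.obj β) (a : deg A.obj δ) :
    ap (sandwich A ⟨f, x, y⟩).hom a = sandwichFun A f x y δ a := rfl

theorem lift_sandwich_eq_zero (A : GrAlg R) {γ : Γ}
    (t : FreeAbelianGroup (TensorGen A.toMod A.toMod γ)) (ht : TensorRel A.toMod A.toMod γ t) :
    FreeAbelianGroup.lift (sandwich A) t = 0 := by
  cases ht with
  | add_left f m m' n =>
    rw [map_sub, map_sub, FreeAbelianGroup.lift_apply_of, FreeAbelianGroup.lift_apply_of,
      FreeAbelianGroup.lift_apply_of, sub_sub, sub_eq_zero]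
    refine GrMod.hom_ext fun δ a => ?_
    change sandwichFun A f (m + m') n δ a = sandwichFun A f m n δ a + sandwichFun A f m' n δ a
    simp [sandwichFun_apply]
  | add_right f m n n' =>
    rw [map_sub, map_sub, FreeAbelianGroup.lift_apply_of, FreeAbelianGroup.lift_apply_of,
      FreeAbelianGroup.lift_apply_of, sub_sub, sub_eq_zero]
    refine GrMod.hom_ext fun δ a => ?_
    change sandwichFun A f m (n + n') δ a = sandwichFun A f m n δ a + sandwichFun A f m n' δ a
    simp [sandwichFun_apply]
  | res f g h m n =>
    rw [map_sub, FreeAbelianGroup.lift_apply_of, FreeAbelianGroup.lift_apply_of, sub_eq_zero]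
    exact GrMod.hom_ext fun δ a => sandwichFun_tensorHom A f g h m n a
  | balanced f m r n =>
    rw [map_sub, FreeAbelianGroup.lift_apply_of, FreeAbelianGroup.lift_apply_of, sub_eq_zero]
    exact GrMod.hom_ext fun δ a => sandwichFun_balanced A f m r n a

/-- The degree `γ` part of the canonical map `A ⊗_R A^op → End_R(A)`, `x ⊗ y ↦ (a ↦ x a y)`. The
opposite algebra has the same underlying module as `A`. -/
def sandwichMap (A : GrAlg R) (γ : Γ) :
    Tensor A.toMod A.toMod γ →+ InternalHom A.toMod A.toMod γ :=
  QuotientAddGroup.lift _ (FreeAbelianGroup.lift (sandwich A))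
    ((AddSubgroup.closure_le _).2 fun t ht => lift_sandwich_eq_zero A t ht)

/-- `P` is a graded generator: the shifts of `P` are compact projective and form a set of
generators of the category of graded `R`-modules. Over a Picard groupoid the family of all
`P.shift γ` is the family of all suspensions of `P`. -/
structure IsGradedGenerator (P : GrMod R) : Prop where
  projective : ∀ γ : Γ, Projective (P.shift γ)
  compact : ∀ γ : Γ, IsFinitelyPresentable.{u} (P.shift γ)
  separating : (ObjectProperty.ofObj fun γ : Γ => P.shift γ).IsSeparating

/-- Azumaya algebras: the underlying module is a graded generator and
`A ⊗_R A^op → End_R(A)` is an isomorphism. -/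
structure IsAzumaya (A : GrAlg R) : Prop where
  isGradedGenerator : IsGradedGenerator A.toMod
  bijective : ∀ γ : Γ, Function.Bijective (sandwichMap A γ)


/-- Bimodules over the algebra `A` in the category of graded `R`-modules: the two actions of `A`
commute, and induce the same action of `R`. -/
structure GrBimod (A : GrAlg R) where
  obj : GrAb Γ
  left : Pairing A.obj obj obj
  right : Pairing obj A.obj obj
  one_left : ∀ {α : Γ} (m : deg obj α), left.app A.one m = res obj (λ_ α).hom m
  mul_left : ∀ {α β γ : Γ} (a : deg A.obj α) (b : deg A.obj β) (m : deg obj γ),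
    left.app (A.mul.app a b) m = res obj (α_ α β γ).hom (left.app a (left.app b m))
  right_one : ∀ {α : Γ} (m : deg obj α), right.app m A.one = res obj (ρ_ α).hom m
  right_mul : ∀ {α β γ : Γ} (m : deg obj α) (a : deg A.obj β) (b : deg A.obj γ),
    right.app (right.app m a) b = res obj (α_ α β γ).hom (right.app m (A.mul.app a b))
  left_right : ∀ {α β γ : Γ} (a : deg A.obj α) (m : deg obj β) (b : deg A.obj γ),
    right.app (left.app a m) b = res obj (α_ α β γ).hom (left.app a (right.app m b))
  unit_central : ∀ {α β : Γ} (r : deg R.obj α) (m : deg obj β),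
    left.app (ap A.unit r) m = res obj (β_ α β).hom (right.app m (ap A.unit r))

namespace GrBimod

variable {A : GrAlg R}

variable (A) in
/-- `A` as a bimodule over itself. -/
def regular : GrBimod A where
  obj := A.obj
  left := A.mul
  right := A.mul
  one_left := A.one_mul
  mul_left := A.mul_assoc
  right_one := A.mul_one
  right_mul := A.mul_assoc
  left_right := A.mul_assoc
  unit_central := A.unit_comm

/-- The shifted bimodule `δ ↦ M_{γ ⊗ δ}`. Its degree `𝟙_ Γ` part is `M_γ`, so the degree `γ` part
of a functor of bimodules such as Hochschild cohomology is the functor applied to the shift. -/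
def shift (M : GrBimod A) (γ : Γ) : GrBimod A where
  obj := shiftAb γ M.obj
  left := M.left.shift γ
  right := M.right.shiftR γ
  one_left m := by
    change res M.obj (swap γ _ _) (M.left.app A.one m) = res M.obj (γ ◁ _) m
    rw [M.one_left, ← res_comp, swap_unit]
    rfl
  mul_left a b m := by
    change res M.obj (swap γ _ _) (M.left.app (A.mul.app a b) m) =
      res M.obj (γ ◁ _) (res M.obj (swap γ _ _)
        (M.left.app a (res M.obj (swap γ _ _) (M.left.app b m))))
    rw [M.mul_left, M.left.res_right, ← res_comp, ← res_comp, ← res_comp, swap_tensor,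
      Category.assoc]
    rfl
  right_one {α} m := by
    change res M.obj (α_ γ _ _).inv (M.right.app m A.one) = res M.obj (γ ◁ (ρ_ α).hom) m
    rw [M.right_one, ← res_comp]
    refine congrArg (fun k => res M.obj k m) ?_
    change (α_ γ α (𝟙_ Γ)).inv ≫ (ρ_ (γ ⊗ α)).hom = _
    simp
  right_mul {α β δ} m a b := by
    change res M.obj (α_ γ (α ⊗ β) δ).inv
        (M.right.app (res M.obj (α_ γ α β).inv (M.right.app m a)) b) =
      res M.obj (γ ◁ (α_ α β δ).hom)
        (res M.obj (α_ γ α (β ⊗ δ)).inv (M.right.app m (A.mul.app a b)))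
    rw [M.right.res_left, M.right_mul, ← res_comp, ← res_comp, ← res_comp]
    refine congrArg (fun k => res M.obj k _) ?_
    change ((α_ γ (α ⊗ β) δ).inv ≫ (α_ γ α β).inv ▷ δ) ≫ (α_ (γ ⊗ α) β δ).hom = _
    simp
  left_right {α β δ} a m b := by
    change res M.obj (α_ γ (α ⊗ β) δ).inv
        (M.right.app (res M.obj (swap γ α β) (M.left.app a m)) b) =
      res M.obj (γ ◁ (α_ α β δ).hom) (res M.obj (swap γ α (β ⊗ δ))
        (M.left.app a (res M.obj (α_ γ β δ).inv (M.right.app m b))))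
    rw [M.right.res_left, M.left.res_right, M.left_right, ← res_comp, ← res_comp, ← res_comp,
      ← res_comp]
    refine congrArg (fun k => res M.obj k _) ?_
    change ((α_ γ (α ⊗ β) δ).inv ≫ swap γ α β ▷ δ) ≫ (α_ α (γ ⊗ β) δ).hom =
      (γ ◁ (α_ α β δ).hom ≫ swap γ α (β ⊗ δ)) ≫ α ◁ (α_ γ β δ).inv
    rw [Category.assoc, Category.assoc, swap_right]
  unit_central {α β} r m := by
    change res M.obj (swap γ α β) (M.left.app (ap A.unit r) m) =
      res M.obj (γ ◁ (β_ α β).hom) (res M.obj (α_ γ β α).inv (M.right.app m (ap A.unit r)))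
    rw [M.unit_central, ← res_comp, ← res_comp]
    exact congrArg (fun k => res M.obj k _) (swap_braid γ α β)


/-- Maps of bimodules. -/
@[ext]
structure Hom (M N : GrBimod A) where
  hom : M.obj ⟶ N.obj
  map_left : ∀ {α β : Γ} (a : deg A.obj α) (m : deg M.obj β),
    ap hom (M.left.app a m) = N.left.app a (ap hom m)
  map_right : ∀ {α β : Γ} (m : deg M.obj α) (a : deg A.obj β),
    ap hom (M.right.app m a) = N.right.app (ap hom m) a

instance : Category (GrBimod A) where
  Hom := Hom
  id M := ⟨𝟙 _, by simp [ap_id], by simp [ap_id]⟩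
  comp f g := ⟨f.hom ≫ g.hom, by simp [ap_comp, f.map_left, g.map_left],
    by simp [ap_comp, f.map_right, g.map_right]⟩

section
variable {M N K : GrBimod A}

theorem hom_ext {f g : M ⟶ N}
    (h : ∀ (γ : Γ) (m : deg M.obj γ), ap f.hom m = ap g.hom m) : f = g :=
  Hom.ext (PicGraded.hom_ext h)

theorem comp_apply (f : M ⟶ N) (g : N ⟶ K) {γ : Γ} (m : deg M.obj γ) :
    ap (f ≫ g).hom m = ap g.hom (ap f.hom m) := rfl

theorem id_apply {γ : Γ} (m : deg M.obj γ) : ap (Hom.hom (𝟙 M)) m = m := rfl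

theorem hom_injective : Function.Injective (fun f : M ⟶ N => f.hom) := fun _ _ h => Hom.ext h

instance : Zero (M ⟶ N) := ⟨⟨0, by simp [ap_zero], by simp [ap_zero]⟩⟩
instance : Add (M ⟶ N) := ⟨fun f g => ⟨f.hom + g.hom, by simp [ap_add, f.map_left, g.map_left],
  by simp [ap_add, f.map_right, g.map_right]⟩⟩
instance : Neg (M ⟶ N) := ⟨fun f => ⟨-f.hom, by simp [ap_neg, f.map_left],
  by simp [ap_neg, f.map_right]⟩⟩
instance : Sub (M ⟶ N) := ⟨fun f g => ⟨f.hom - g.hom, by simp [ap_sub, f.map_left, g.map_left],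
  by simp [ap_sub, f.map_right, g.map_right]⟩⟩
instance : AddCommGroup (M ⟶ N) :=
  { (inferInstance : Zero (M ⟶ N)), (inferInstance : Add (M ⟶ N)),
    (inferInstance : Neg (M ⟶ N)), (inferInstance : Sub (M ⟶ N)) with
    add_assoc := fun _ _ _ => hom_injective (add_assoc _ _ _)
    zero_add := fun _ => hom_injective (zero_add _)
    add_zero := fun _ => hom_injective (add_zero _)
    add_comm := fun _ _ => hom_injective (add_comm _ _)
    sub_eq_add_neg := fun _ _ => hom_injective (sub_eq_add_neg _ _)
    neg_add_cancel := fun _ => hom_injective (neg_add_cancel _)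
    nsmul := nsmulRec
    zsmul := zsmulRec }

theorem add_apply (f g : M ⟶ N) {γ : Γ} (m : deg M.obj γ) :
    ap (f + g).hom m = ap f.hom m + ap g.hom m := rfl

theorem zero_apply {γ : Γ} (m : deg M.obj γ) : ap (Hom.hom (0 : M ⟶ N)) m = 0 := rfl
end

instance : Preadditive (GrBimod A) where
  add_comp _ _ _ f g h := hom_ext fun γ m => by
    rw [comp_apply, add_apply, add_apply, map_add]; rfl
  comp_add _ _ _ f g h := hom_ext fun γ m => rfl


/-- Sub-bimodules. -/
structure Sub (M : GrBimod A) where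
  carrier : ∀ γ : Γ, AddSubgroup (deg M.obj γ)
  res_mem : ∀ {α β : Γ} (f : α ⟶ β) {m : deg M.obj β}, m ∈ carrier β →
    res M.obj f m ∈ carrier α
  left_mem : ∀ {α β : Γ} (a : deg A.obj α) {m : deg M.obj β}, m ∈ carrier β →
    M.left.app a m ∈ carrier (α ⊗ β)
  right_mem : ∀ {α β : Γ} {m : deg M.obj α} (a : deg A.obj β), m ∈ carrier α →
    M.right.app m a ∈ carrier (α ⊗ β)

namespace Sub
variable {M : GrBimod A} (S : Sub M)

def toGrAb : GrAb Γ where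
  obj γ := AddCommGrpCat.of (S.carrier γ.unop)
  map f := AddCommGrpCat.ofHom
    (((res M.obj f.unop).comp (S.carrier _).subtype).codRestrict (S.carrier _)
      fun m => S.res_mem f.unop m.2)
  map_id γ := by
    ext m
    exact res_id M.obj m.1
  map_comp f g := by
    ext m
    exact res_comp M.obj g.unop f.unop m.1

/-- A sub-bimodule as a bimodule. -/
def toBimod : GrBimod A where
  obj := S.toGrAb
  left :=
    { app := fun {α β} => AddMonoidHom.mk' (fun a : deg A.obj α =>
        (((M.left.app a).comp (S.carrier β).subtype).codRestrict (S.carrier (α ⊗ β))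
          fun m => S.left_mem a m.2)) fun a b => AddMonoidHom.ext fun m => Subtype.ext
            (DFunLike.congr_fun (M.left.app.map_add a b) m.1)
      app_res := fun f g a m => Subtype.ext (M.left.app_res f g a m.1) }
  right :=
    { app := fun {α β} => AddMonoidHom.mk' (fun m : S.carrier α =>
        ((M.right.app m.1).codRestrict (S.carrier (α ⊗ β)) fun a => S.right_mem a m.2))
          fun m n => AddMonoidHom.ext fun a => Subtype.ext
            (DFunLike.congr_fun (M.right.app.map_add m.1 n.1) a)
      app_res := fun f g m a => Subtype.ext (M.right.app_res f g m.1 a) }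
  one_left m := Subtype.ext (M.one_left m.1)
  mul_left a b m := Subtype.ext (M.mul_left a b m.1)
  right_one m := Subtype.ext (M.right_one m.1)
  right_mul m a b := Subtype.ext (M.right_mul m.1 a b)
  left_right a m b := Subtype.ext (M.left_right a m.1 b)
  unit_central r m := Subtype.ext (M.unit_central r m.1)

def incl : S.toBimod ⟶ M where
  hom := mkHom (M := S.toGrAb) (fun γ => (S.carrier γ).subtype) fun _ _ => rfl
  map_left _ _ := rfl
  map_right _ _ := rfl

theorem incl_apply {γ : Γ} (m : S.carrier γ) :
    ap S.incl.hom (γ := γ) (show deg S.toGrAb γ from m) = m.1 := rfl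

def lift {K : GrBimod A} (f : K ⟶ M)
    (hf : ∀ (γ : Γ) (k : deg K.obj γ), ap f.hom k ∈ S.carrier γ) : K ⟶ S.toBimod where
  hom := mkHom (N := S.toGrAb) (fun γ => (ap f.hom).codRestrict (S.carrier γ) (hf γ))
    fun g k => Subtype.ext (ap_res f.hom g k)
  map_left a m := Subtype.ext (f.map_left a m)
  map_right m a := Subtype.ext (f.map_right m a)

theorem lift_incl {K : GrBimod A} (f : K ⟶ M)
    (hf : ∀ (γ : Γ) (k : deg K.obj γ), ap f.hom k ∈ S.carrier γ) : S.lift f hf ≫ S.incl = f :=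
  rfl

def quotGrAb : GrAb Γ where
  obj γ := AddCommGrpCat.of (deg M.obj γ.unop ⧸ S.carrier γ.unop)
  map f := AddCommGrpCat.ofHom
    (QuotientAddGroup.map _ _ (res M.obj f.unop) fun _ hm => S.res_mem f.unop hm)
  map_id γ := by
    ext m
    exact congrArg (QuotientAddGroup.mk) (res_id M.obj m)
  map_comp f g := by
    ext m
    exact congrArg (QuotientAddGroup.mk) (res_comp M.obj g.unop f.unop m)

theorem quot_ind {γ : Γ} {p : deg S.quotGrAb γ → Prop}
    (h : ∀ m : deg M.obj γ, p (QuotientAddGroup.mk (s := S.carrier γ) m))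
    (x : deg S.quotGrAb γ) : p x := QuotientAddGroup.induction_on x h

/-- The quotient by a sub-bimodule. -/
def quotient : GrBimod A where
  obj := S.quotGrAb
  left :=
    { app := fun {α β} => AddMonoidHom.mk' (fun a : deg A.obj α =>
        QuotientAddGroup.map (S.carrier β) (S.carrier (α ⊗ β)) (M.left.app a)
          fun m hm => S.left_mem a hm) fun a b =>
            AddMonoidHom.ext (S.quot_ind fun m =>
              congrArg QuotientAddGroup.mk (DFunLike.congr_fun (M.left.app.map_add a b) m))
      app_res := fun f g a => S.quot_ind fun m =>
        congrArg QuotientAddGroup.mk (M.left.app_res f g a m) }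
  right :=
    { app := fun {α β} => (AddMonoidHom.mk' (fun a : deg A.obj β =>
        QuotientAddGroup.map (S.carrier α) (S.carrier (α ⊗ β)) (M.right.app.flip a)
          fun m hm => S.right_mem a hm) fun a b =>
            AddMonoidHom.ext (S.quot_ind fun m =>
              congrArg QuotientAddGroup.mk ((M.right.app m).map_add a b))).flip
      app_res := fun f g m a => by
        revert m
        exact S.quot_ind fun m => congrArg QuotientAddGroup.mk (M.right.app_res f g m a) }
  one_left := S.quot_ind fun m => congrArg QuotientAddGroup.mk (M.one_left m)
  mul_left a b := S.quot_ind fun m => congrArg QuotientAddGroup.mk (M.mul_left a b m)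
  right_one := S.quot_ind fun m => congrArg QuotientAddGroup.mk (M.right_one m)
  right_mul m a b := by
    revert m
    exact S.quot_ind fun m => congrArg QuotientAddGroup.mk (M.right_mul m a b)
  left_right a m b := by
    revert m
    exact S.quot_ind fun m => congrArg QuotientAddGroup.mk (M.left_right a m b)
  unit_central r := S.quot_ind fun m => congrArg QuotientAddGroup.mk (M.unit_central r m)

def proj : M ⟶ S.quotient where
  hom := mkHom (N := S.quotGrAb) (fun γ => QuotientAddGroup.mk' (S.carrier γ)) fun _ _ => rfl
  map_left _ _ := rfl
  map_right _ _ := rfl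

theorem proj_eq_zero_iff {γ : Γ} (m : deg M.obj γ) :
    ap S.proj.hom m = 0 ↔ m ∈ S.carrier γ := QuotientAddGroup.eq_zero_iff m

def desc {K : GrBimod A} (f : M ⟶ K)
    (hf : ∀ (γ : Γ) (m : deg M.obj γ), m ∈ S.carrier γ → ap f.hom m = 0) : S.quotient ⟶ K where
  hom := mkHom (M := S.quotGrAb) (fun γ => QuotientAddGroup.lift (S.carrier γ) (ap f.hom) (hf γ))
    fun g => S.quot_ind fun m => ap_res f.hom g m
  map_left a := S.quot_ind fun m => f.map_left a m
  map_right m a := by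
    revert m
    exact S.quot_ind fun m => f.map_right m a

theorem proj_desc {K : GrBimod A} (f : M ⟶ K)
    (hf : ∀ (γ : Γ) (m : deg M.obj γ), m ∈ S.carrier γ → ap f.hom m = 0) :
    S.proj ≫ S.desc f hf = f := rfl

end Sub


section abelian
open Limits
variable {M N : GrBimod A}

/-- The kernel of a map of bimodules. -/
def ker (f : M ⟶ N) : Sub M where
  carrier γ := (ap f.hom (γ := γ)).ker
  res_mem g m hm := by
    rw [AddMonoidHom.mem_ker] at hm ⊢
    rw [ap_res, hm, map_zero]
  left_mem a m hm := by
    rw [AddMonoidHom.mem_ker] at hm ⊢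
    rw [f.map_left, hm, map_zero]
  right_mem a hm := by
    rw [AddMonoidHom.mem_ker] at hm ⊢
    rw [f.map_right, hm, map_zero, AddMonoidHom.zero_apply]

/-- The image of a map of bimodules. -/
def range (f : M ⟶ N) : Sub N where
  carrier γ := (ap f.hom (γ := γ)).range
  res_mem g m hm := by
    obtain ⟨m, rfl⟩ := hm
    exact ⟨_, ap_res f.hom g m⟩
  left_mem a m hm := by
    obtain ⟨m, rfl⟩ := hm
    exact ⟨_, f.map_left a m⟩
  right_mem a hm := by
    obtain ⟨m, rfl⟩ := hm
    exact ⟨_, f.map_right m a⟩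

theorem ap_injective_of_mono (f : M ⟶ N) [Mono f] (γ : Γ) :
    Function.Injective (ap f.hom (γ := γ)) := by
  rw [injective_iff_map_eq_zero]
  intro m hm
  have h : (ker f).incl = 0 := by
    rw [← cancel_mono f, zero_comp]
    exact hom_ext fun _ x => x.2
  exact congrArg (fun g : (ker f).toBimod ⟶ M => ap g.hom (γ := γ)
    (show (ker f).carrier γ from ⟨m, hm⟩)) h

theorem ap_surjective_of_epi (f : M ⟶ N) [Epi f] (γ : Γ) :
    Function.Surjective (ap f.hom (γ := γ)) := by
  intro n
  have h : (range f).proj = 0 := by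
    rw [← cancel_epi f, comp_zero]
    exact hom_ext fun _ x => ((range f).proj_eq_zero_iff _).2 ⟨x, rfl⟩
  exact ((range f).proj_eq_zero_iff n).1 (congrArg (fun g => ap (Hom.hom g) n) h)

theorem ap_eq_zero_of_comp {K : GrBimod A} {f : M ⟶ N} {g : N ⟶ K} (h : f ≫ g = 0) {γ : Γ}
    (m : deg M.obj γ) : ap g.hom (ap f.hom m) = 0 :=
  congrArg (fun k => ap (Hom.hom k) m) h

instance : HasKernels (GrBimod A) where
  has_limit f := HasLimit.mk
    { cone := KernelFork.ofι (ker f).incl (hom_ext fun _ m => m.2)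
      isLimit := KernelFork.IsLimit.ofι _ _
        (fun g hg => (ker f).lift g fun _ k => ap_eq_zero_of_comp hg k)
        (fun _ _ => rfl)
        (fun _ _ _ hm => hom_ext fun _ k => Subtype.ext
          (congrArg (fun t => ap (Hom.hom t) k) hm)) }

instance : HasCokernels (GrBimod A) where
  has_colimit f := HasColimit.mk
    { cocone := CokernelCofork.ofπ (range f).proj
        (hom_ext fun _ m => ((range f).proj_eq_zero_iff _).2 ⟨m, rfl⟩)
      isColimit := CokernelCofork.IsColimit.ofπ _ _
        (fun g hg => (range f).desc g fun _ n hn => by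
          obtain ⟨m, rfl⟩ := hn
          exact ap_eq_zero_of_comp hg m)
        (fun _ _ => rfl)
        (fun _ _ _ hm => hom_ext fun _ => (range f).quot_ind fun n =>
          congrArg (fun t => ap (Hom.hom t) n) hm) }

variable (A) in
def zero : GrBimod A where
  obj := (Functor.const _).obj (AddCommGrpCat.of PUnit)
  left := { app := 0, app_res := fun _ _ _ _ => rfl }
  right := { app := 0, app_res := fun _ _ _ _ => rfl }
  one_left _ := rfl
  mul_left _ _ _ := rfl
  right_one _ := rfl
  right_mul _ _ _ := rfl
  left_right _ _ _ := rfl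
  unit_central _ _ := rfl

instance : HasZeroObject (GrBimod A) where
  zero := ⟨zero A, by
    rw [IsZero.iff_id_eq_zero]
    exact hom_ext fun γ m => rfl⟩

variable (M N) in
def prodGrAb : GrAb Γ where
  obj γ := AddCommGrpCat.of (deg M.obj γ.unop × deg N.obj γ.unop)
  map f := AddCommGrpCat.ofHom ((res M.obj f.unop).prodMap (res N.obj f.unop))
  map_id γ := AddCommGrpCat.hom_ext <| AddMonoidHom.ext fun m =>
    Prod.ext (res_id M.obj m.1) (res_id N.obj m.2)
  map_comp f g := AddCommGrpCat.hom_ext <| AddMonoidHom.ext fun m =>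
    Prod.ext (res_comp M.obj g.unop f.unop m.1) (res_comp N.obj g.unop f.unop m.2)

variable (M N) in
/-- The direct sum of two bimodules. -/
def prod : GrBimod A where
  obj := prodGrAb M N
  left :=
    { app := AddMonoidHom.mk' (fun a => (M.left.app a).prodMap (N.left.app a)) fun a b =>
        AddMonoidHom.ext fun m => Prod.ext
          (DFunLike.congr_fun (M.left.app.map_add a b) m.1)
          (DFunLike.congr_fun (N.left.app.map_add a b) m.2)
      app_res := fun f g a m => Prod.ext (M.left.app_res f g a m.1) (N.left.app_res f g a m.2) }
  right :=
    { app := AddMonoidHom.mk' (fun m => (M.right.app m.1).prod (N.right.app m.2)) fun m n =>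
        AddMonoidHom.ext fun a => Prod.ext
          (DFunLike.congr_fun (M.right.app.map_add m.1 n.1) a)
          (DFunLike.congr_fun (N.right.app.map_add m.2 n.2) a)
      app_res := fun f g m a => Prod.ext (M.right.app_res f g m.1 a) (N.right.app_res f g m.2 a) }
  one_left m := Prod.ext (M.one_left m.1) (N.one_left m.2)
  mul_left a b m := Prod.ext (M.mul_left a b m.1) (N.mul_left a b m.2)
  right_one m := Prod.ext (M.right_one m.1) (N.right_one m.2)
  right_mul m a b := Prod.ext (M.right_mul m.1 a b) (N.right_mul m.2 a b)
  left_right a m b := Prod.ext (M.left_right a m.1 b) (N.left_right a m.2 b)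
  unit_central r m := Prod.ext (M.unit_central r m.1) (N.unit_central r m.2)

instance : HasBinaryBiproducts (GrBimod A) where
  has_binary_biproduct M N := hasBinaryBiproduct_of_total
    { pt := prod M N
      fst :=
        { hom := mkHom (M := prodGrAb M N) (fun γ => AddMonoidHom.fst _ _) fun _ _ => rfl
          map_left := fun _ _ => rfl
          map_right := fun _ _ => rfl }
      snd :=
        { hom := mkHom (M := prodGrAb M N) (fun γ => AddMonoidHom.snd _ _) fun _ _ => rfl
          map_left := fun _ _ => rfl
          map_right := fun _ _ => rfl }
      inl :=
        { hom := mkHom (N := prodGrAb M N) (fun γ => AddMonoidHom.inl _ _)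
            fun g m => Prod.ext rfl (map_zero (res N.obj g)).symm
          map_left := fun a m => Prod.ext rfl (map_zero (N.left.app a)).symm
          map_right := fun m a => Prod.ext rfl
            (DFunLike.congr_fun (map_zero N.right.app) a).symm }
      inr :=
        { hom := mkHom (N := prodGrAb M N) (fun γ => AddMonoidHom.inr _ _)
            fun g m => Prod.ext (map_zero (res M.obj g)).symm rfl
          map_left := fun a m => Prod.ext (map_zero (M.left.app a)).symm rfl
          map_right := fun m a => Prod.ext
            (DFunLike.congr_fun (map_zero M.right.app) a).symm rfl } }
    (hom_ext fun γ m => Prod.ext (add_zero m.1) (zero_add m.2))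

theorem exists_lift_of_mono {K : GrBimod A} (f : M ⟶ N) [Mono f] (g : K ⟶ N)
    (hg : g ≫ (range f).proj = 0) : ∃ l : K ⟶ M, l ≫ f = g := by
  have H : ∀ (γ : Γ) (k : deg K.obj γ), ∃ m : deg M.obj γ, ap f.hom m = ap g.hom k := fun γ k =>
    ((range f).proj_eq_zero_iff _).1 (ap_eq_zero_of_comp hg k)
  choose t ht using H
  have I := ap_injective_of_mono f
  refine ⟨⟨mkHom (fun γ => AddMonoidHom.mk' (t γ) fun x y => I γ (by
      rw [map_add, ht, ht, ht, map_add])) fun {α β} s m => I _ ?_, fun a m => I _ ?_,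
      fun m a => I _ ?_⟩, hom_ext fun γ k => ht γ k⟩
  · change ap f.hom (t _ _) = ap f.hom (res _ _ (t _ _))
    rw [ap_res, ht, ht, ap_res]
  · change ap f.hom (t _ _) = ap f.hom (M.left.app a (t _ _))
    rw [f.map_left, ht, ht, g.map_left]
  · change ap f.hom (t _ _) = ap f.hom (M.right.app (t _ _) a)
    rw [f.map_right, ht, ht, g.map_right]

theorem exists_desc_of_epi {K : GrBimod A} (f : M ⟶ N) [Epi f] (g : M ⟶ K)
    (hg : (ker f).incl ≫ g = 0) : ∃ l : N ⟶ K, f ≫ l = g := by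
  have I : ∀ (γ : Γ) (x y : deg M.obj γ), ap f.hom x = ap f.hom y →
      ap g.hom x = ap g.hom y := fun γ x y h => by
    rw [← sub_eq_zero, ← map_sub] at h ⊢
    exact ap_eq_zero_of_comp hg (γ := γ) (show (ker f).carrier γ from ⟨x - y, h⟩)
  choose t ht using ap_surjective_of_epi f
  refine ⟨⟨mkHom (fun γ => AddMonoidHom.mk' (fun n => ap g.hom (t γ n)) fun x y => ?_)
      fun {α β} s n => ?_, fun a n => ?_, fun n a => ?_⟩, hom_ext fun γ m => ?_⟩
  · rw [← map_add]
    exact I _ _ _ (by rw [map_add, ht, ht, ht])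
  · change ap g.hom (t _ _) = res K.obj s (ap g.hom (t _ _))
    rw [← ap_res]
    exact I _ _ _ (by rw [ap_res, ht, ht])
  · change ap g.hom (t _ _) = K.left.app a (ap g.hom (t _ _))
    rw [← g.map_left]
    exact I _ _ _ (by rw [f.map_left, ht, ht])
  · change ap g.hom (t _ _) = K.right.app (ap g.hom (t _ _)) a
    rw [← g.map_right]
    exact I _ _ _ (by rw [f.map_right, ht, ht])
  · change ap g.hom (t _ _) = ap g.hom m
    exact I _ _ _ (ht _ _)

instance : IsNormalMonoCategory (GrBimod A) where
  normalMonoOfMono f _ := ⟨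
    { Z := (range f).quotient
      g := (range f).proj
      w := hom_ext fun _ m => ((range f).proj_eq_zero_iff _).2 ⟨m, rfl⟩
      isLimit := KernelFork.IsLimit.ofι _ _
        (fun g hg => (exists_lift_of_mono f g hg).choose)
        (fun g hg => (exists_lift_of_mono f g hg).choose_spec)
        (fun g hg m hm => by
          rw [← cancel_mono f, hm, (exists_lift_of_mono f g hg).choose_spec]) }⟩

instance : IsNormalEpiCategory (GrBimod A) where
  normalEpiOfEpi f _ := ⟨
    { W := (ker f).toBimod
      g := (ker f).incl
      w := hom_ext fun _ m => m.2
      isColimit := CokernelCofork.IsColimit.ofπ _ _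
        (fun g hg => (exists_desc_of_epi f g hg).choose)
        (fun g hg => (exists_desc_of_epi f g hg).choose_spec)
        (fun g hg m hm => by
          rw [← cancel_epi f, hm, (exists_desc_of_epi f g hg).choose_spec]) }⟩

instance : Abelian (GrBimod A) where
  has_finite_products := hasFiniteProducts_of_has_binary_and_terminal

instance : HasExt.{u + 1} (GrBimod A) := HasExt.standard (GrBimod A)

end abelian

end GrBimod

/-- Hochschild cohomology `HH^s_R(A, M)`: the right derived functors of
`Hom_{A-bimodules}(-, M)`, evaluated at `A`. -/
abbrev HH {A : GrAlg R} (s : ℕ) (M : GrBimod A) : Type (u + 1) :=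
  Abelian.Ext (GrBimod.regular A) M s


/-- `R`-linear derivations over `f : B ⟶ A` with values in the `A`-bimodule `N`; for `f = 𝟙 A` these
are the derivations `Der_R(A, N)`. -/
def Der {A B : GrAlg R} (f : B ⟶ A) (N : GrBimod A) : AddSubgroup (B.obj ⟶ N.obj) where
  carrier := {D |
    (∀ {α β : Γ} (r : deg R.obj α) (x : deg B.obj β),
      ap D (B.mul.app (ap B.unit r) x) = N.left.app (ap A.unit r) (ap D x)) ∧
    (∀ {α β : Γ} (x : deg B.obj α) (y : deg B.obj β),
      ap D (B.mul.app x y) = N.left.app (ap f.hom x) (ap D y) + N.right.app (ap D x) (ap f.hom y))}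
  zero_mem' := by
    constructor
    · intros
      simp [ap_zero]
    · intros
      simp [ap_zero]
  add_mem' := by
    rintro D E ⟨h1, h2⟩ ⟨h3, h4⟩
    constructor
    · intros
      simp [ap_add, h1, h3]
    · intros
      simp only [ap_add, h2, h4, map_add, AddMonoidHom.add_apply]
      abel
  neg_mem' := by
    rintro D ⟨h1, h2⟩
    constructor
    · intros
      simp [ap_neg, h1]
    · intros
      simp only [ap_neg, h2, map_neg, AddMonoidHom.neg_apply, neg_add]

namespace Der

/-- Precomposition of a derivation with a map of algebras over `A`. -/
def pullback {A B C : GrAlg R} (g : C ⟶ B) {f : B ⟶ A} {f' : C ⟶ A} (h : g ≫ f = f')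
    (N : GrBimod A) : Der f N →+ Der f' N :=
  AddMonoidHom.mk' (fun D => ⟨g.hom ≫ D.1, by
    subst h
    constructor
    · intro α β r x
      rw [ap_comp, g.map_mul, g.map_unit, D.2.1]
      rfl
    · intro α β x y
      rw [ap_comp, g.map_mul, D.2.2]
      rfl⟩) fun D E => Subtype.ext (Preadditive.comp_add _ _ _ g.hom D.1 E.1)

section inner
variable {A : GrAlg R} (N : GrBimod A)

/-- `a ↦ a n - n a`, for `n` of degree `𝟙_ Γ`. -/
def commutator (n : deg N.obj (𝟙_ Γ)) (α : Γ) : deg A.obj α →+ deg N.obj α :=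
  (res N.obj (ρ_ α).inv).comp (N.left.app.flip n) - (res N.obj (λ_ α).inv).comp (N.right.app n)

theorem commutator_apply (n : deg N.obj (𝟙_ Γ)) {α : Γ} (a : deg A.obj α) :
    commutator N n α a =
      res N.obj (ρ_ α).inv (N.left.app a n) - res N.obj (λ_ α).inv (N.right.app n a) := rfl

theorem commutator_res (n : deg N.obj (𝟙_ Γ)) {α β : Γ} (g : α ⟶ β) (a : deg A.obj β) :
    commutator N n α (res A.obj g a) = res N.obj g (commutator N n β a) := by
  simp only [commutator_apply, map_sub, N.left.res_left, N.right.res_right, ← res_comp]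
  simp

theorem right_mul' {α β γ : Γ} (n : deg N.obj α) (a : deg A.obj β) (b : deg A.obj γ) :
    N.right.app n (A.mul.app a b) =
      res N.obj (α_ α β γ).inv (N.right.app (N.right.app n a) b) := by
  rw [N.right_mul, ← res_comp, Iso.inv_hom_id, res_id]

theorem commutator_mul (n : deg N.obj (𝟙_ Γ)) {α β : Γ} (a : deg A.obj α) (b : deg A.obj β) :
    commutator N n _ (A.mul.app a b) =
      N.left.app a (commutator N n _ b) + N.right.app (commutator N n _ a) b := by
  simp only [commutator_apply, map_sub, AddMonoidHom.sub_apply, N.left.res_right,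
    N.right.res_left, N.left_right, N.mul_left, right_mul', ← res_comp]
  simp

theorem right_unit {α β : Γ} (r : deg R.obj α) (n : deg N.obj β) :
    N.right.app n (ap A.unit r) = res N.obj (β_ β α).hom (N.left.app (ap A.unit r) n) := by
  rw [N.unit_central, ← res_comp, SymmetricCategory.symmetry, res_id]

theorem commutator_unit (n : deg N.obj (𝟙_ Γ)) {α : Γ} (r : deg R.obj α) :
    commutator N n _ (ap A.unit r) = 0 := by
  rw [commutator_apply, right_unit, ← res_comp, sub_eq_zero]
  simp

/-- The map sending `n` to the inner derivation `a ↦ a n - n a`. -/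
def inner : deg N.obj (𝟙_ Γ) →+ Der (𝟙 A) N :=
  AddMonoidHom.mk' (fun n => ⟨mkHom (commutator N n) (commutator_res N n), by
    refine ⟨fun {α β} r x => ?_, fun {α β} x y => commutator_mul N n x y⟩
    refine (commutator_mul N n _ _).trans ?_
    rw [commutator_unit, map_zero, AddMonoidHom.zero_apply, add_zero]
    rfl⟩) fun m n => Subtype.ext <| hom_ext fun γ a => by
      change commutator N (m + n) γ a = commutator N m γ a + commutator N n γ a
      simp only [commutator_apply, map_add, AddMonoidHom.add_apply]
      abel

end inner

end Der


namespace FreeAlg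

/-- Formal expressions in generators `X` and scalars in `R`. -/
inductive Term (R : GrCommRing Γ) (X : Γ → Type u) : Γ → Type u
  | of {γ : Γ} (x : X γ) : Term R X γ
  | scalar {γ : Γ} (r : deg R.obj γ) : Term R X γ
  | zero {γ : Γ} : Term R X γ
  | add {γ : Γ} (s t : Term R X γ) : Term R X γ
  | neg {γ : Γ} (t : Term R X γ) : Term R X γ
  | mul {α β : Γ} (s : Term R X α) (t : Term R X β) : Term R X (α ⊗ β)
  | restrict {α β : Γ} (f : α ⟶ β) (t : Term R X β) : Term R X α

open Term

/-- The congruence on expressions generated by the axioms of an `R`-algebra. -/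
inductive Rel (R : GrCommRing Γ) (X : Γ → Type u) : ∀ {γ : Γ}, Term R X γ → Term R X γ → Prop
  | refl {γ : Γ} (s : Term R X γ) : Rel R X s s
  | symm {γ : Γ} {s t : Term R X γ} : Rel R X s t → Rel R X t s
  | trans {γ : Γ} {s t u : Term R X γ} : Rel R X s t → Rel R X t u → Rel R X s u
  | add_congr {γ : Γ} {s s' t t' : Term R X γ} :
      Rel R X s s' → Rel R X t t' → Rel R X (add s t) (add s' t')
  | neg_congr {γ : Γ} {s s' : Term R X γ} : Rel R X s s' → Rel R X (neg s) (neg s')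
  | mul_congr {α β : Γ} {s s' : Term R X α} {t t' : Term R X β} :
      Rel R X s s' → Rel R X t t' → Rel R X (mul s t) (mul s' t')
  | res_congr {α β : Γ} (f : α ⟶ β) {s s' : Term R X β} :
      Rel R X s s' → Rel R X (restrict f s) (restrict f s')
  | add_assoc {γ : Γ} (s t u : Term R X γ) : Rel R X (add (add s t) u) (add s (add t u))
  | add_comm {γ : Γ} (s t : Term R X γ) : Rel R X (add s t) (add t s)
  | zero_add {γ : Γ} (s : Term R X γ) : Rel R X (add zero s) s
  | neg_add {γ : Γ} (s : Term R X γ) : Rel R X (add (neg s) s) zero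
  | res_id {γ : Γ} (s : Term R X γ) : Rel R X (restrict (𝟙 γ) s) s
  | res_comp {α β γ : Γ} (f : α ⟶ β) (g : β ⟶ γ) (s : Term R X γ) :
      Rel R X (restrict (f ≫ g) s) (restrict f (restrict g s))
  | res_add {α β : Γ} (f : α ⟶ β) (s t : Term R X β) :
      Rel R X (restrict f (add s t)) (add (restrict f s) (restrict f t))
  | add_mul {α β : Γ} (s s' : Term R X α) (t : Term R X β) :
      Rel R X (mul (add s s') t) (add (mul s t) (mul s' t))
  | mul_add {α β : Γ} (s : Term R X α) (t t' : Term R X β) :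
      Rel R X (mul s (add t t')) (add (mul s t) (mul s t'))
  | mul_res {α α' β β' : Γ} (f : α' ⟶ α) (g : β' ⟶ β) (s : Term R X α) (t : Term R X β) :
      Rel R X (mul (restrict f s) (restrict g t)) (restrict (f ⊗ₘ g) (mul s t))
  | one_mul {α : Γ} (s : Term R X α) : Rel R X (mul (scalar R.one) s) (restrict (λ_ α).hom s)
  | mul_one {α : Γ} (s : Term R X α) : Rel R X (mul s (scalar R.one)) (restrict (ρ_ α).hom s)
  | mul_assoc {α β γ : Γ} (s : Term R X α) (t : Term R X β) (u : Term R X γ) :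
      Rel R X (mul (mul s t) u) (restrict (α_ α β γ).hom (mul s (mul t u)))
  | scalar_add {γ : Γ} (r r' : deg R.obj γ) :
      Rel R X (scalar (r + r')) (add (scalar r) (scalar r'))
  | scalar_res {α β : Γ} (f : α ⟶ β) (r : deg R.obj β) :
      Rel R X (scalar (PicGraded.res R.obj f r)) (restrict f (scalar r))
  | scalar_mul {α β : Γ} (r : deg R.obj α) (r' : deg R.obj β) :
      Rel R X (scalar (R.mul.app r r')) (mul (scalar r) (scalar r'))
  | scalar_comm {α β : Γ} (r : deg R.obj α) (s : Term R X β) :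
      Rel R X (mul (scalar r) s) (restrict (β_ α β).hom (mul s (scalar r)))

variable (R : GrCommRing Γ) (X : Γ → Type u)

instance setoid (γ : Γ) : Setoid (Term R X γ) := ⟨Rel R X, Rel.refl, Rel.symm, Rel.trans⟩

abbrev Carrier (γ : Γ) : Type u := Quotient (setoid R X γ)

variable {R X}
abbrev mk {γ : Γ} (t : Term R X γ) : Carrier R X γ := Quotient.mk _ t

theorem sound {γ : Γ} {s t : Term R X γ} (h : Rel R X s t) : mk s = mk t := Quotient.sound h

instance (γ : Γ) : Zero (Carrier R X γ) := ⟨mk zero⟩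
instance (γ : Γ) : Add (Carrier R X γ) :=
  ⟨Quotient.map₂ add fun _ _ h _ _ h' => Rel.add_congr h h'⟩
instance (γ : Γ) : Neg (Carrier R X γ) := ⟨Quotient.map neg fun _ _ h => Rel.neg_congr h⟩

instance (γ : Γ) : AddCommGroup (Carrier R X γ) :=
  { AddGroup.ofLeftAxioms
      (by
        rintro ⟨a⟩ ⟨b⟩ ⟨c⟩
        exact sound (Rel.add_assoc a b c))
      (by
        rintro ⟨a⟩
        exact sound (Rel.zero_add a))
      (by
        rintro ⟨a⟩
        exact sound (Rel.neg_add a)) with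
    add_comm := by
      rintro ⟨a⟩ ⟨b⟩
      exact sound (Rel.add_comm a b) }

variable (R X)

def grAb : GrAb Γ where
  obj γ := AddCommGrpCat.of (Carrier R X γ.unop)
  map f := AddCommGrpCat.ofHom <| AddMonoidHom.mk'
    (Quotient.map (restrict f.unop) fun _ _ h => Rel.res_congr f.unop h) (by
      rintro ⟨a⟩ ⟨b⟩
      exact sound (Rel.res_add f.unop a b))
  map_id γ := by
    ext ⟨a⟩
    exact sound (Rel.res_id a)
  map_comp f g := by
    ext ⟨a⟩
    exact sound (Rel.res_comp g.unop f.unop a)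

def mulPairing : Pairing (grAb R X) (grAb R X) (grAb R X) where
  app {α β} := AddMonoidHom.mk' (fun a : Carrier R X α => AddMonoidHom.mk'
      (fun b : Carrier R X β => (Quotient.map₂ mul (fun _ _ h _ _ h' => Rel.mul_congr h h') a b :
        Carrier R X (α ⊗ β)))
      (by
        rintro ⟨b⟩ ⟨b'⟩
        induction a using Quotient.inductionOn with | h a => exact sound (Rel.mul_add a b b')))
    (by
      rintro ⟨a⟩ ⟨a'⟩
      refine AddMonoidHom.ext ?_
      rintro ⟨b⟩
      exact sound (Rel.add_mul a a' b))
  app_res f g := by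
    rintro ⟨a⟩ ⟨b⟩
    exact sound (Rel.mul_res f g a b)

end FreeAlg

/-- The free `R`-algebra on a family `X` of sets of homogeneous generators. -/
def FreeAlg (R : GrCommRing Γ) (X : Γ → Type u) : GrAlg R where
  obj := FreeAlg.grAb R X
  mul := FreeAlg.mulPairing R X
  one := FreeAlg.mk (.scalar R.one)
  one_mul := by
    rintro α ⟨a⟩
    exact FreeAlg.sound (.one_mul a)
  mul_one := by
    rintro α ⟨a⟩
    exact FreeAlg.sound (.mul_one a)
  mul_assoc := by
    rintro α β γ ⟨a⟩ ⟨b⟩ ⟨c⟩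
    exact FreeAlg.sound (.mul_assoc a b c)
  unit := mkHom (N := FreeAlg.grAb R X)
    (fun γ => AddMonoidHom.mk' (fun r => FreeAlg.mk (.scalar r))
      fun r r' => FreeAlg.sound (.scalar_add r r'))
    fun f r => FreeAlg.sound (.scalar_res f r)
  unit_one := rfl
  unit_mul r s := FreeAlg.sound (.scalar_mul r s)
  unit_comm := by
    rintro α β r ⟨a⟩
    exact FreeAlg.sound (.scalar_comm r a)

namespace FreeAlg
variable {R : GrCommRing Γ} {X : Γ → Type u}

/-- The generators of the free algebra. -/
def of {γ : Γ} (x : X γ) : deg (FreeAlg R X).obj γ := mk (.of x)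

section lift
variable {B : GrAlg R} (v : ∀ γ : Γ, X γ → deg B.obj γ)

/-- Evaluation of an expression in an algebra. -/
def eval : ∀ {γ : Γ}, Term R X γ → deg B.obj γ
  | _, .of x => v _ x
  | _, .scalar r => ap B.unit r
  | _, .zero => 0
  | _, .add s t => eval s + eval t
  | _, .neg t => -eval t
  | _, .mul s t => B.mul.app (eval s) (eval t)
  | _, .restrict f t => res B.obj f (eval t)

theorem eval_eq {γ : Γ} {s t : Term R X γ} (h : Rel R X s t) : eval v s = eval v t := by
  induction h with
  | refl s => rfl
  | symm _ ih => exact ih.symm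
  | trans _ _ ih ih' => exact ih.trans ih'
  | add_congr _ _ ih ih' => simp only [eval, ih, ih']
  | neg_congr _ ih => simp only [eval, ih]
  | mul_congr _ _ ih ih' => simp only [eval, ih, ih']
  | res_congr f _ ih => simp only [eval, ih]
  | add_assoc s t u => exact _root_.add_assoc _ _ _
  | add_comm s t => exact _root_.add_comm _ _
  | zero_add s => exact _root_.zero_add _
  | neg_add s => exact neg_add_cancel _
  | res_id s => exact PicGraded.res_id _ _
  | res_comp f g s => exact PicGraded.res_comp _ f g _
  | res_add f s t => exact map_add _ _ _
  | add_mul s s' t => simp only [eval, map_add, AddMonoidHom.add_apply]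
  | mul_add s t t' => simp only [eval, map_add]
  | mul_res f g s t => exact B.mul.app_res f g _ _
  | one_mul s =>
    simp only [eval, B.unit_one]
    exact B.one_mul _
  | mul_one s =>
    simp only [eval, B.unit_one]
    exact B.mul_one _
  | mul_assoc s t u => exact B.mul_assoc _ _ _
  | scalar_add r r' => exact map_add _ _ _
  | scalar_res f r => exact ap_res _ _ _
  | scalar_mul r r' => exact B.unit_mul _ _
  | scalar_comm r s => exact B.unit_comm _ _

/-- The universal property of the free algebra. -/
def lift : FreeAlg R X ⟶ B where
  hom := mkHom (M := grAb R X) (fun γ => AddMonoidHom.mk'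
      (Quotient.lift (eval v) fun _ _ h => eval_eq v h) (by
        rintro ⟨a⟩ ⟨b⟩
        rfl)) (by
    rintro α β g ⟨a⟩
    rfl)
  map_one := B.unit_one
  map_mul := by
    rintro α β ⟨a⟩ ⟨b⟩
    rfl
  map_unit _ := rfl

theorem lift_of {γ : Γ} (x : X γ) : ap (lift v).hom (of x) = v γ x := rfl

theorem hom_ext {f g : FreeAlg R X ⟶ B}
    (h : ∀ (γ : Γ) (x : X γ), ap f.hom (of x) = ap g.hom (of x)) : f = g := by
  refine GrAlg.Hom.ext (PicGraded.hom_ext ?_)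
  suffices H : ∀ {γ : Γ} (t : Term R X γ),
      ap f.hom (show deg (FreeAlg R X).obj γ from mk t) = ap g.hom (mk t) by
    rintro γ ⟨t⟩
    exact H t
  intro γ t
  induction t with
  | of x => exact h _ x
  | scalar r => exact (f.map_unit r).trans (g.map_unit r).symm
  | zero => exact (map_zero (ap f.hom)).trans (map_zero (ap g.hom)).symm
  | add s t ih ih' =>
    refine (map_add (ap f.hom) (mk s) (mk t)).trans
      (Eq.trans ?_ (map_add (ap g.hom) (mk s) (mk t)).symm)
    exact congrArg₂ (· + ·) ih ih'
  | neg t ih =>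
    refine (map_neg (ap f.hom) (mk t)).trans (Eq.trans ?_ (map_neg (ap g.hom) (mk t)).symm)
    exact congrArg Neg.neg ih
  | mul s t ih ih' =>
    refine (f.map_mul (mk s) (mk t)).trans (Eq.trans ?_ (g.map_mul (mk s) (mk t)).symm)
    rw [ih, ih']
  | restrict φ t ih =>
    refine (ap_res f.hom φ (mk t)).trans (Eq.trans ?_ (ap_res g.hom φ (mk t)).symm)
    rw [ih]

end lift

end FreeAlg

namespace GrAlg
variable {A B C : GrAlg R}

theorem comp_apply (f : A ⟶ B) (g : B ⟶ C) {γ : Γ} (x : deg A.obj γ) :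
    ap (f ≫ g).hom x = ap g.hom (ap f.hom x) := rfl

/-- The free algebra on the underlying graded set of `B`. -/
def freeOn (B : GrAlg R) : GrAlg R := FreeAlg R fun γ => deg B.obj γ

/-- Functoriality of `freeOn`. -/
def freeOnMap (f : B ⟶ C) : freeOn B ⟶ freeOn C :=
  FreeAlg.lift fun _ x => FreeAlg.of (ap f.hom x)

/-- The canonical map from the free algebra on the underlying graded set of `B` to `B`. -/
def counit (B : GrAlg R) : freeOn B ⟶ B := FreeAlg.lift fun _ x => x

theorem freeOnMap_comp (f : A ⟶ B) (g : B ⟶ C) :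
    freeOnMap (f ≫ g) = freeOnMap f ≫ freeOnMap g := FreeAlg.hom_ext fun _ _ => rfl

theorem freeOnMap_counit (f : B ⟶ C) : freeOnMap f ≫ counit C = counit B ≫ f :=
  FreeAlg.hom_ext fun _ _ => rfl

/-- `bar A (n + 1)` is the term in simplicial degree `n` of the standard simplicial resolution of `A`
by free algebras: the comonad `freeOn` is applied `n + 1` times. -/
def bar (A : GrAlg R) : ℕ → GrAlg R
  | 0 => A
  | n + 1 => freeOn (bar A n)

/-- `face A (n + 1) i` is the `i`-th face map from simplicial degree `n + 1` to simplicial degree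
`n`: apply the counit after `i` copies of `freeOn`. -/
def face (A : GrAlg R) : ∀ (n : ℕ), Fin (n + 1) → (bar A (n + 1) ⟶ bar A n)
  | 0, _ => counit A
  | n + 1, i => Fin.cases (counit (bar A (n + 1))) (fun j => freeOnMap (face A n j)) i

theorem face_zero (A : GrAlg R) (n : ℕ) : face A n 0 = counit (bar A n) := by
  cases n <;> rfl

theorem face_succ (A : GrAlg R) (n : ℕ) (i : Fin (n + 1)) :
    face A (n + 1) i.succ = freeOnMap (face A n i) := rfl

/-- The augmentation of the standard resolution. -/
def augmentation (A : GrAlg R) : ∀ n : ℕ, bar A n ⟶ A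
  | 0 => 𝟙 A
  | n + 1 => counit (bar A n) ≫ augmentation A n

theorem face_augmentation (A : GrAlg R) : ∀ (n : ℕ) (i : Fin (n + 1)),
    face A n i ≫ augmentation A n = augmentation A (n + 1)
  | 0, _ => rfl
  | n + 1, i => by
    refine Fin.cases rfl (fun j => ?_) i
    change freeOnMap (face A n j) ≫ counit _ ≫ augmentation A n = _
    rw [← Category.assoc, freeOnMap_counit, Category.assoc, face_augmentation A n j]
    rfl

theorem face_face (A : GrAlg R) : ∀ (n : ℕ) (i j : Fin (n + 1)), i ≤ j →
    face A (n + 1) j.succ ≫ face A n i = face A (n + 1) i.castSucc ≫ face A n j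
  | n, i, j, hij => by
    induction i using Fin.cases with
    | zero =>
      rw [face_zero, Fin.castSucc_zero, face_zero]
      exact freeOnMap_counit (face A n j)
    | succ i =>
      cases n with
      | zero => exact i.elim0
      | succ n =>
        induction j using Fin.cases with
        | zero => simp at hij
        | succ j =>
          have h := congrArg freeOnMap (face_face A n i j (Fin.succ_le_succ_iff.1 hij))
          rw [freeOnMap_comp, freeOnMap_comp] at h
          exact h

end GrAlg

section derived
variable {A : GrAlg R} (N : GrBimod A)

/-- The alternating sum of the maps induced on derivations by the face maps. -/
def derCoboundary (n : ℕ) :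
    Der (A.augmentation (n + 1)) N →+ Der (A.augmentation (n + 2)) N :=
  ∑ i : Fin (n + 2), (-1 : ℤ) ^ (i : ℕ) •
    Der.pullback (A.face (n + 1) i) (A.face_augmentation (n + 1) i) N

theorem Der.pullback_pullback {B C D : GrAlg R} {f : B ⟶ A} {f' : C ⟶ A} {f'' : D ⟶ A}
   {g : C ⟶ B} (h : g ≫ f = f') {k : D ⟶ C} (h' : k ≫ f' = f'') (d : Der f N) :
   Der.pullback k h' N (Der.pullback g h N d) = Der.pullback (k ≫ g)
     (by rw [Category.assoc, h, h']) N d := rfl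

theorem alternating_sum_eq_zero {G : Type*} [AddCommGroup G] (n : ℕ)
    (T : Fin (n + 2) → Fin (n + 3) → G)
    (hT : ∀ i j : Fin (n + 2), i ≤ j → T i j.succ = T j i.castSucc) :
    ∑ i : Fin (n + 2), ∑ j : Fin (n + 3), (-1 : ℤ) ^ (i : ℕ) • (-1 : ℤ) ^ (j : ℕ) • T i j = 0 := by
  rw [← Finset.sum_product', Finset.univ_product_univ]
  let P := Fin (n + 2) × Fin (n + 3)
  let S : Finset P := {ij : P | (ij.2 : ℕ) ≤ (ij.1 : ℕ)}
  rw [← Finset.sum_add_sum_compl S, ← eq_neg_iff_add_eq_zero, ← Finset.sum_neg_distrib]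
  let φ : ∀ ij : P, ij ∈ S → P := fun ij hij =>
    (Fin.castLT ij.2 (lt_of_le_of_lt (Finset.mem_filter.mp hij).right (Fin.is_lt ij.1)), ij.1.succ)
  apply Finset.sum_bij φ
  · intro ij hij
    simp_rw [S, φ, Finset.compl_filter, Finset.mem_filter_univ, Fin.val_succ,
      Fin.val_castLT] at hij ⊢
    lia
  · rintro ⟨i, j⟩ hij ⟨i', j'⟩ hij' h
    rw [Prod.mk_inj]
    exact ⟨by simpa [φ] using! congr_arg Prod.snd h,
      by simpa [φ, Fin.castSucc_castLT] using! congr_arg Fin.castSucc (congr_arg Prod.fst h)⟩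
  · rintro ⟨i', j'⟩ hij'
    simp_rw [S, Finset.compl_filter, Finset.mem_filter_univ, not_le] at hij'
    refine ⟨(j'.pred <| ?_, Fin.castSucc i'), ?_, ?_⟩
    · rintro rfl
      simp only [Fin.val_zero, not_lt_zero] at hij'
    · simpa [S] using! Nat.le_sub_one_of_lt hij'
    · simp only [φ, Fin.castLT_castSucc, Fin.succ_pred]
  · rintro ⟨i, j⟩ hij
    have hij' : (j : ℕ) ≤ (i : ℕ) := (Finset.mem_filter.mp hij).right
    have hj : (j : ℕ) < n + 2 := lt_of_le_of_lt hij' i.is_lt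
    have h := hT (j.castLT hj) i hij'
    rw [Fin.castSucc_castLT] at h
    change (-1 : ℤ) ^ (i : ℕ) • (-1 : ℤ) ^ (j : ℕ) • T i j =
      -((-1 : ℤ) ^ (j : ℕ) • (-1 : ℤ) ^ ((i : ℕ) + 1) • T (j.castLT hj) i.succ)
    rw [h, smul_smul, smul_smul, ← neg_smul]
    congr 1
    ring

theorem derCoboundary_comp (n : ℕ) (d : Der (A.augmentation (n + 1)) N) :
    derCoboundary N (n + 1) (derCoboundary N n d) = 0 := by
  simp only [derCoboundary, AddMonoidHom.finsetSum_apply, map_sum, AddMonoidHom.smul_apply,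
    map_zsmul, Der.pullback_pullback, Finset.smul_sum]
  refine alternating_sum_eq_zero n (fun i j => Der.pullback
    (A.face (n + 2) j ≫ A.face (n + 1) i)
    (by rw [Category.assoc, A.face_augmentation, A.face_augmentation]) N d) fun i j hij => ?_
  simp only [A.face_face (n + 1) i j hij]

/-- The cochain complex of derivations from the standard simplicial free resolution of `A`. -/
noncomputable def derComplex : CochainComplex AddCommGrpCat.{u} ℕ :=
  CochainComplex.of (fun n => AddCommGrpCat.of (Der (A.augmentation (n + 1)) N))
    (fun n => AddCommGrpCat.ofHom (derCoboundary N n)) fun n =>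
      AddCommGrpCat.hom_ext (AddMonoidHom.ext fun d => derCoboundary_comp N n d)

/-- The derived functors `Der^s_R(A, N)` of derivations, in the sense of Quillen: the cohomology
of derivations on a simplicial resolution of `A` by free algebras. -/
noncomputable def DerivedDer (s : ℕ) : AddCommGrpCat.{u} := (derComplex N).homology s

/-- The degree `γ` part of `HH^0(A, N) → N`: evaluate a bimodule map `A ⟶ N` at `1`. -/
noncomputable def hhZeroToModule (γ : Γ) : HH 0 (N.shift γ) →+ deg N.obj γ where
  toFun e := res N.obj (ρ_ γ).inv (ap (Abelian.Ext.addEquiv₀ e).hom A.one)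
  map_zero' := by
    rw [map_zero]
    exact map_zero _
  map_add' e e' := by
    rw [map_add]
    exact map_add (res N.obj (ρ_ γ).inv) _ _

/-- The degree `γ` part of `N → Der(A, N)`: `n` goes to the derivation `a ↦ a n - n a`. -/
def innerDegree (γ : Γ) : deg N.obj γ →+ Der (𝟙 A) (N.shift γ) :=
  (Der.inner (N.shift γ)).comp (res N.obj (ρ_ γ).hom)

end derived

end
end PicGraded

/-! ### The trace ideal and an `R`-linear retraction of the unit of `A`. -/

namespace PicGraded

section
variable {Γ : Type u} [Category.{u} Γ]

/-! An Azumaya algebra is separable, and separability makes Hochschild cohomology vanish in positive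
degrees. Since the shifts of `A` separate `R`-modules, the trace ideal of `A` is all of `R`;
precomposing with left multiplications yields one `R`-linear map `g : A → R` with `g(1) = 1`
(`exists_retraction_of_isSeparating`). The endomorphism `z ↦ g(z)·1` comes from some `e = ∑ x ⊗ y`
by surjectivity of the sandwich map. Evaluation at `1` gives `∑ x y = 1`; as `g(z)` is central, `a
e` and `e a` induce the same endomorphism, so injectivity gives `a e = e a`. Thus `e` is a
separability idempotent (`IsAzumaya.exists_isSeparabilityIdempotent`).

Averaging with `e`, `m ↦ ∑ x m y`, turns any element of a bimodule into a central one, so `A` is a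
projective bimodule and the higher Ext groups vanish. For a derivation `D`, the element `-∑ D(x) y`
exhibits `D` as inner. A bimodule map out of `A` amounts to a central element, which settles the
left part of the exact sequence.

For the Quillen derived functors, let `coind N` be the bimodule of `R`-linear maps `B → N` vanishing
at `1`; it models the cokernel of `N → Hom_R(B, N)`, `n ↦ (x ↦ x n)`. The inner derivation of such a
map measures its failure to be a derivation, so the kernel of `coind N → Der(B, coind N)` is `Der(B,
N)`. The cokernel is the obstruction to splitting square zero extensions of `B` by `N`. It vanishes
for `B` free by the universal property, and for `B = A` because all derivations of `A` are inner.
Along the augmented standard resolution this gives, levelwise, short exact sequences `0 → Der(B, N)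
→ coind N → Der(B, coind N) → 0` in degree `𝟙_ Γ`.

The middle terms form a contractible complex because the resolution has `R`-linear extra
degeneracies: its terms are retracts of free modules, so these can be chosen on generators by
filling spheres in simplicial abelian groups (`GrAlg.exists_extraDegen`). They must preserve `1` in
order to act on maps vanishing at `1`; `g` provides the correction (`exists_unital_extraDegen`).
Since `coind` turns one system of coefficients into another (`System.coind`), induction on the
degree proves exactness (`System.exists_cobd_eq`). -/

theorem res_congr (M : GrAb Γ) {α β : Γ} {f g : α ⟶ β} (h : f = g) (m : deg M β) :
    res M f m = res M g m := by rw [h]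

theorem res_eq_self (M : GrAb Γ) {α : Γ} {f : α ⟶ α} (h : f = 𝟙 α) (m : deg M α) :
    res M f m = m := by rw [h, res_id]

theorem res_hom_res_inv (N : GrAb Γ) {α β : Γ} (e : α ≅ β) (n : deg N α) :
    res N e.hom (res N e.inv n) = n := by
  rw [← res_comp, e.hom_inv_id, res_id]

end

section
variable {Γ : Type u} [Category.{u} Γ] [MonoidalCategory Γ] [SymmetricCategory Γ]

theorem swap_naturality_left {γ γ' α δ : Γ} (f : γ ⟶ γ') :
    f ▷ (α ⊗ δ) ≫ swap γ' α δ = swap γ α δ ≫ α ◁ f ▷ δ := by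
  have h := congrArg (fun t => t ▷ δ) (BraidedCategory.braiding_naturality_left f α)
  simp only [comp_whiskerRight] at h
  simp only [swap, Category.assoc]
  rw [← associator_naturality_middle, ← reassoc_of% h, ← associator_inv_naturality_left_assoc]

variable {R : GrCommRing Γ}

namespace GrMod

theorem add_apply {M N : GrMod R} (f g : M ⟶ N) {γ : Γ} (m : deg M.obj γ) :
    ap (f + g).hom m = ap f.hom m + ap g.hom m := rfl

variable (R) in
/-- `R` as a module over itself. -/
def scalars : GrMod R where
  obj := R.obj
  smul := R.mul
  one_smul := R.one_mul
  mul_smul := R.mul_assoc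

/-- Graded submodules. -/
structure Sub (M : GrMod R) where
  carrier : ∀ γ : Γ, AddSubgroup (deg M.obj γ)
  res_mem : ∀ {α β : Γ} (f : α ⟶ β) {m : deg M.obj β}, m ∈ carrier β →
    res M.obj f m ∈ carrier α
  smul_mem : ∀ {α β : Γ} (r : deg R.obj α) {m : deg M.obj β}, m ∈ carrier β →
    M.smul.app r m ∈ carrier (α ⊗ β)

namespace Sub
variable {M : GrMod R} (S : Sub M)

def quotGrAb : GrAb Γ where
  obj γ := AddCommGrpCat.of (deg M.obj γ.unop ⧸ S.carrier γ.unop)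
  map f := AddCommGrpCat.ofHom
    (QuotientAddGroup.map _ _ (res M.obj f.unop) fun _ hm => S.res_mem f.unop hm)
  map_id γ := by
    ext m
    exact congrArg (QuotientAddGroup.mk) (res_id M.obj m)
  map_comp f g := by
    ext m
    exact congrArg (QuotientAddGroup.mk) (res_comp M.obj g.unop f.unop m)

theorem quot_ind {γ : Γ} {p : deg S.quotGrAb γ → Prop}
    (h : ∀ m : deg M.obj γ, p (QuotientAddGroup.mk (s := S.carrier γ) m))
    (x : deg S.quotGrAb γ) : p x := QuotientAddGroup.induction_on x h

/-- The quotient by a submodule. -/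
def quotient : GrMod R where
  obj := S.quotGrAb
  smul :=
    { app := fun {α β} => AddMonoidHom.mk' (fun a : deg R.obj α =>
        QuotientAddGroup.map (S.carrier β) (S.carrier (α ⊗ β)) (M.smul.app a)
          fun m hm => S.smul_mem a hm) fun a b =>
            AddMonoidHom.ext (S.quot_ind fun m =>
              congrArg QuotientAddGroup.mk (DFunLike.congr_fun (M.smul.app.map_add a b) m))
      app_res := fun f g a => S.quot_ind fun m =>
        congrArg QuotientAddGroup.mk (M.smul.app_res f g a m) }
  one_smul := S.quot_ind fun m => congrArg QuotientAddGroup.mk (M.one_smul m)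
  mul_smul a b := S.quot_ind fun m => congrArg QuotientAddGroup.mk (M.mul_smul a b m)

def proj : M ⟶ S.quotient where
  hom := mkHom (N := S.quotGrAb) (fun γ => QuotientAddGroup.mk' (S.carrier γ)) fun _ _ => rfl
  map_smul _ _ := rfl

theorem proj_eq_zero_iff {γ : Γ} (m : deg M.obj γ) :
    ap S.proj.hom m = 0 ↔ m ∈ S.carrier γ := QuotientAddGroup.eq_zero_iff m

end Sub

/-- The trace ideal of `P`: the sum of the images of all maps `P.shift γ ⟶ R`. -/
def trace (P : GrMod R) : Sub (scalars R) where
  carrier δ := AddSubgroup.closure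
    {x | ∃ (γ : Γ) (f : P.shift γ ⟶ scalars R) (a : deg (P.shift γ).obj δ), ap f.hom a = x}
  res_mem g _ hm := by
    induction hm using AddSubgroup.closure_induction with
    | mem x hx =>
      obtain ⟨γ, f, a, rfl⟩ := hx
      exact AddSubgroup.subset_closure ⟨γ, f, _, ap_res f.hom g a⟩
    | zero => rw [map_zero]; exact zero_mem _
    | add x y _ _ hx hy => rw [map_add]; exact add_mem hx hy
    | neg x _ hx => rw [map_neg]; exact neg_mem hx
  smul_mem r _ hm := by
    induction hm using AddSubgroup.closure_induction with
    | mem x hx =>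
      obtain ⟨γ, f, a, rfl⟩ := hx
      exact AddSubgroup.subset_closure ⟨γ, f, _, f.map_smul r a⟩
    | zero => rw [map_zero]; exact zero_mem _
    | add x y _ _ hx hy => rw [map_add]; exact add_mem hx hy
    | neg x _ hx => rw [map_neg]; exact neg_mem hx

/-- Every map from a shift of `P` to `R` becomes zero in the quotient of `R` by the trace ideal, so
separation forces the quotient map itself to be zero. -/
theorem mem_trace_of_isSeparating {P : GrMod R}
    (hP : (ObjectProperty.ofObj fun γ : Γ => P.shift γ).IsSeparating) {δ : Γ}
    (r : deg R.obj δ) : r ∈ P.trace.carrier δ := by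
  have h : P.trace.proj = 0 := by
    refine hP _ _ fun G hG f => ?_
    obtain ⟨γ⟩ := hG
    exact hom_ext fun δ a =>
      (P.trace.proj_eq_zero_iff _).2 (AddSubgroup.subset_closure ⟨γ, f, a, rfl⟩)
  exact (P.trace.proj_eq_zero_iff r).1 (congrArg (fun g => ap (Hom.hom g) r) h)

end GrMod

namespace GrAlg
variable (A : GrAlg R)

/-- Left multiplication by an element of degree `γ`, as a map into the shifted module. -/
def leftMul {γ : Γ} (a : deg A.obj (γ ⊗ 𝟙_ Γ)) : A.toMod ⟶ A.toMod.shift γ where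
  hom := mkHom (N := shiftAb γ A.obj)
    (fun δ => (res A.obj ((ρ_ γ).inv ▷ δ)).comp (A.mul.app a)) fun g m => by
      change res A.obj _ (A.mul.app a (res A.obj g m)) =
        res A.obj (_ ◁ g) (res A.obj _ (A.mul.app a m))
      rw [A.mul.res_right, ← res_comp, ← res_comp, whisker_exchange]
  map_smul {β δ} r m := by
    change res A.obj _ (A.mul.app a (A.mul.app (ap A.unit r) m)) = res A.obj (swap γ β δ)
      (A.mul.app (ap A.unit r) (res A.obj _ (A.mul.app a m)))
    rw [A.mul_assoc', A.mul_unit, A.mul.res_left, A.mul_assoc, A.mul.res_right]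
    simp only [← res_comp]
    refine res_congr _ ?_ _
    rw [← swap_naturality_left]
    rfl

theorem leftMul_one {γ : Γ} (a : deg A.obj (γ ⊗ 𝟙_ Γ)) :
    ap (A.leftMul a).hom (γ := 𝟙_ Γ) A.one = a := by
  change res A.obj _ (A.mul.app a A.one) = a
  rw [A.mul_one, ← res_comp]
  exact res_eq_self _ (by simp) _

/-- The trace ideal contains `1`, but a priori only as a sum of values `f(a)` of maps on different
shifts. Left multiplication by `a` carries `1` to `a`, so each `f(a)` is the value at `1` of a map
defined on `A`, and such maps can be added. -/
theorem exists_retraction_of_isSeparating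
    (hA : (ObjectProperty.ofObj fun γ : Γ => A.toMod.shift γ).IsSeparating) :
    ∃ g : A.toMod ⟶ GrMod.scalars R, ap g.hom A.one = R.one := by
  have h := GrMod.mem_trace_of_isSeparating hA R.one
  revert h
  -- The closure induction needs an arbitrary element of the trace ideal: each one of degree `𝟙_ Γ`
  -- is `g(1)` for a single `g`.
  generalize R.one = x
  intro h
  change x ∈ AddSubgroup.closure _ at h
  induction h using AddSubgroup.closure_induction with
  | mem x hx =>
    obtain ⟨γ, f, a, rfl⟩ := hx
    exact ⟨A.leftMul a ≫ f, congrArg (ap f.hom) (A.leftMul_one a)⟩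
  | zero => exact ⟨0, rfl⟩
  | add x y _ _ hx hy =>
    obtain ⟨f, rfl⟩ := hx
    obtain ⟨g, rfl⟩ := hy
    exact ⟨f + g, rfl⟩
  | neg x _ hx =>
    obtain ⟨f, rfl⟩ := hx
    exact ⟨-f, rfl⟩

end GrAlg

end
end PicGraded

/-! ### Balanced pairings, and the two actions of `A` on formal tensors. -/

namespace PicGraded

section
variable {Γ : Type u} [Category.{u} Γ] [MonoidalCategory Γ] [SymmetricCategory Γ]
variable {R : GrCommRing Γ}

/-- A pairing `A × A → N` is balanced if it factors through the tensor product over `R`. -/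
def Pairing.IsBalanced {A : GrAlg R} {N : GrAb Γ} (p : Pairing A.obj A.obj N) : Prop :=
  ∀ {α β δ : Γ} (x : deg A.obj α) (r : deg R.obj β) (y : deg A.obj δ),
    p.app (res A.obj (β_ α β).hom (A.mul.app (ap A.unit r) x)) y =
      res N (α_ α β δ).hom (p.app x (A.mul.app (ap A.unit r) y))

/-- The evaluation of a pairing on a formal sum of tensors. -/
def evalTensor {A : GrAlg R} {N : GrAb Γ} (p : Pairing A.obj A.obj N) (γ : Γ) :
    FreeAbelianGroup (TensorGen A.toMod A.toMod γ) →+ deg N γ :=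
  FreeAbelianGroup.lift fun t => res N t.arrow (p.app t.fst t.snd)

theorem evalTensor_of {A : GrAlg R} {N : GrAb Γ} (p : Pairing A.obj A.obj N) {γ : Γ}
    (t : TensorGen A.toMod A.toMod γ) :
    evalTensor p γ (.of t) = res N t.arrow (p.app t.fst t.snd) :=
  FreeAbelianGroup.lift_apply_of _ _

theorem evalTensor_eq_zero {A : GrAlg R} {N : GrAb Γ} {p : Pairing A.obj A.obj N}
    (hp : p.IsBalanced) {γ : Γ} (t : FreeAbelianGroup (TensorGen A.toMod A.toMod γ))
    (ht : TensorRel A.toMod A.toMod γ t) : evalTensor p γ t = 0 := by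
  cases ht with
  | add_left f m m' n => simp [evalTensor_of, sub_sub]
  | add_right f m n n' => simp [evalTensor_of, sub_sub]
  | res f g h m n =>
    simp only [map_sub, evalTensor_of, sub_eq_zero]
    rw [p.app_res, ← res_comp]
  | balanced f m r n =>
    simp only [map_sub, evalTensor_of, sub_eq_zero]
    rw [res_comp]
    exact congrArg (res N f) (hp m r n)

/-- The universal property of the tensor product, phrased for representatives. `leftAct` and
`rightAct` live on formal sums only, so they need not be descended to the quotient. -/
theorem evalTensor_congr {A : GrAlg R} {N : GrAb Γ} {p : Pairing A.obj A.obj N}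
    (hp : p.IsBalanced) {γ : Γ} {s t : FreeAbelianGroup (TensorGen A.toMod A.toMod γ)}
    (h : (QuotientAddGroup.mk s : Tensor A.toMod A.toMod γ) = QuotientAddGroup.mk t) :
    evalTensor p γ s = evalTensor p γ t := by
  have h' : AddSubgroup.closure {t | TensorRel A.toMod A.toMod γ t} ≤ (evalTensor p γ).ker :=
    (AddSubgroup.closure_le _).2 fun t ht => evalTensor_eq_zero hp t ht
  have := h' (QuotientAddGroup.eq.1 h)
  rw [AddMonoidHom.mem_ker, map_add, map_neg, neg_add_eq_zero] at this
  exact this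

section act
variable {A : GrAlg R} {α : Γ} (a : deg A.obj α)

/-- Left multiplication of tensors of degree `𝟙_ Γ` by `a`. -/
def leftAct : FreeAbelianGroup (TensorGen A.toMod A.toMod (𝟙_ Γ)) →+
    FreeAbelianGroup (TensorGen A.toMod A.toMod α) :=
  FreeAbelianGroup.lift fun t => .of
    ⟨(ρ_ α).inv ≫ α ◁ t.arrow ≫ (α_ _ _ _).inv, A.mul.app a t.fst, t.snd⟩

/-- Right multiplication of tensors of degree `𝟙_ Γ` by `a`. -/
def rightAct : FreeAbelianGroup (TensorGen A.toMod A.toMod (𝟙_ Γ)) →+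
    FreeAbelianGroup (TensorGen A.toMod A.toMod α) :=
  FreeAbelianGroup.lift fun t => .of
    ⟨(λ_ α).inv ≫ t.arrow ▷ α ≫ (α_ _ _ _).hom, t.fst, A.mul.app t.snd a⟩

/-- The map `z ↦ ∑ x z y` attached to a formal sum of tensors `x ⊗ y`. -/
def sandwichEval (A : GrAlg R) (γ δ : Γ) : FreeAbelianGroup (TensorGen A.toMod A.toMod γ) →+
    deg A.obj δ →+ deg A.obj (γ ⊗ δ) :=
  FreeAbelianGroup.lift fun t => sandwichFun A t.arrow t.fst t.snd δ

theorem sandwichEval_of {γ δ : Γ} {β β' : Γ} (f : γ ⟶ β ⊗ β') (x : deg A.obj β)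
    (y : deg A.obj β') (z : deg A.obj δ) :
    sandwichEval A γ δ (.of ⟨f, x, y⟩) z =
      res A.obj (f ▷ δ ≫ rot β β' δ) (A.mul.app x (A.mul.app z y)) := by
  rw [sandwichEval, FreeAbelianGroup.lift_apply_of, sandwichFun_apply]

theorem ap_lift_sandwich {γ : Γ} (t : FreeAbelianGroup (TensorGen A.toMod A.toMod γ)) {δ : Γ}
    (z : deg A.obj δ) :
    ap (FreeAbelianGroup.lift (sandwich A) t).hom z = sandwichEval A γ δ t z := by
  induction t using FreeAbelianGroup.induction_on with
  | zero => rfl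
  | of t =>
    rw [FreeAbelianGroup.lift_apply_of, sandwichEval, FreeAbelianGroup.lift_apply_of]
    rfl
  | neg t ih =>
    rw [map_neg, map_neg, AddMonoidHom.neg_apply, ← ih]
    rfl
  | add s t ih ih' =>
    rw [map_add, map_add, AddMonoidHom.add_apply, ← ih, ← ih']
    rfl

theorem leftAct_of {β β' : Γ} (f : 𝟙_ Γ ⟶ β ⊗ β') (x : deg A.obj β)
    (y : deg A.obj β') : leftAct a (.of ⟨f, x, y⟩) =
      .of ⟨(ρ_ α).inv ≫ α ◁ f ≫ (α_ _ _ _).inv, A.mul.app a x, y⟩ :=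
  FreeAbelianGroup.lift_apply_of _ _

theorem rightAct_of {β β' : Γ} (f : 𝟙_ Γ ⟶ β ⊗ β') (x : deg A.obj β)
    (y : deg A.obj β') : rightAct a (.of ⟨f, x, y⟩) =
      .of ⟨(λ_ α).inv ≫ f ▷ α ≫ (α_ _ _ _).hom, x, A.mul.app y a⟩ :=
  FreeAbelianGroup.lift_apply_of _ _

theorem sandwichEval_leftAct (t : FreeAbelianGroup (TensorGen A.toMod A.toMod (𝟙_ Γ))) {δ : Γ}
    (z : deg A.obj δ) :
    sandwichEval A α δ (leftAct a t) z =
      res A.obj (α ◁ (λ_ δ).inv) (A.mul.app a (sandwichEval A _ δ t z)) := by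
  induction t using FreeAbelianGroup.induction_on with
  | zero => simp
  | of t =>
    obtain ⟨f, x, y⟩ := t
    rw [leftAct_of, sandwichEval_of, sandwichEval_of, A.mul_assoc, A.mul.res_right, ← res_comp,
      ← res_comp]
    refine res_congr _ ?_ _
    simp [rot]
  | neg t ih => simp only [map_neg, AddMonoidHom.neg_apply, ih]
  | add s t ih ih' => simp only [map_add, AddMonoidHom.add_apply, ih, ih']

/-- The product `(∑ x z y) a` has degree in the order `δ ⊗ α`, whereas an endomorphism of degree `α`
takes values in `α ⊗ δ`; the braiding reconciles the two. -/
theorem sandwichEval_rightAct (t : FreeAbelianGroup (TensorGen A.toMod A.toMod (𝟙_ Γ))) {δ : Γ}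
    (z : deg A.obj δ) :
    sandwichEval A α δ (rightAct a t) z =
      res A.obj ((β_ α δ).hom ≫ (λ_ δ).inv ▷ α) (A.mul.app (sandwichEval A _ δ t z) a) := by
  induction t using FreeAbelianGroup.induction_on with
  | zero => simp
  | of t =>
    obtain ⟨f, x, y⟩ := t
    rw [rightAct_of, sandwichEval_of, sandwichEval_of, A.mul.res_left, A.mul_assoc, A.mul_assoc,
      A.mul.res_right]
    simp only [← res_comp]
    refine res_congr _ ?_ _
    -- The only input beyond coherence is the interchange law, which slides the arrow `f` of the
    -- tensor past the braiding of `α` and `δ`.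
    have h : f ▷ (α ⊗ δ) ≫ _ ◁ (β_ α δ).hom = _ ◁ (β_ α δ).hom ≫ f ▷ (δ ⊗ α) :=
      (whisker_exchange _ _).symm
    have h' := congrArg (fun k => (λ_ (α ⊗ δ)).inv ≫ k ≫ (α_ _ _ (δ ⊗ α)).hom ≫
      _ ◁ (α_ _ δ α).inv ≫ _ ◁ (β_ _ δ).hom ▷ α ≫ _ ◁ (α_ δ _ α).hom) h
    simpa [rot] using h'
  | neg t ih => simp only [map_neg, AddMonoidHom.neg_apply, ih]
  | add s t ih ih' => simp only [map_add, AddMonoidHom.add_apply, ih, ih']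

end act

end
end PicGraded

/-! ### Separability idempotents: inner derivations and projectivity of `A`. -/

namespace PicGraded

section
variable {Γ : Type u} [Category.{u} Γ] [MonoidalCategory Γ] [SymmetricCategory Γ]
variable {R : GrCommRing Γ} {A : GrAlg R}

/-- A representative `∑ x ⊗ y` of a separability idempotent: `∑ x y = 1`, and
`∑ a x ⊗ y = ∑ x ⊗ y a` for all `a`, the latter tested on balanced pairings. -/
structure IsSeparabilityIdempotent
    (e : FreeAbelianGroup (TensorGen A.toMod A.toMod (𝟙_ Γ))) : Prop where
  eval_mul : evalTensor A.mul (𝟙_ Γ) e = A.one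
  central : ∀ {N : GrAb Γ} {p : Pairing A.obj A.obj N}, p.IsBalanced → ∀ {α : Γ}
    (a : deg A.obj α), evalTensor p α (leftAct a e) = evalTensor p α (rightAct a e)

/-- Putting `z = 1` in `∑ x z y` recovers `∑ x y`, so the image of a tensor under multiplication can
be read off from its endomorphism. -/
theorem res_rightUnitor_inv_sandwichEval_one
    (t : FreeAbelianGroup (TensorGen A.toMod A.toMod (𝟙_ Γ))) :
    res A.obj (ρ_ (𝟙_ Γ)).inv (sandwichEval A (𝟙_ Γ) (𝟙_ Γ) t A.one) =
      evalTensor A.mul (𝟙_ Γ) t := by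
  induction t using FreeAbelianGroup.induction_on with
  | zero => simp
  | of t =>
    obtain ⟨f, x, y⟩ := t
    rw [sandwichEval_of, evalTensor_of, A.one_mul, A.mul.res_right, ← res_comp, ← res_comp]
    refine res_congr _ ?_ _
    simp [rot]
  | neg t ih => simp only [map_neg, AddMonoidHom.neg_apply, ih]
  | add s t ih ih' => simp only [map_add, AddMonoidHom.add_apply, ih, ih']

/-- The identification of a module with its shift by the unit. -/
def GrMod.toShiftUnit (M : GrMod R) : M ⟶ M.shift (𝟙_ Γ) where
  hom := mkHom (N := shiftAb (𝟙_ Γ) M.obj) (fun δ => res M.obj (λ_ δ).hom) fun {α β} g m => by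
    change res M.obj (λ_ α).hom (res M.obj g m) = res M.obj (𝟙_ Γ ◁ g) (res M.obj (λ_ β).hom m)
    rw [← res_comp, ← res_comp, leftUnitor_naturality]
  map_smul {α β} r m := by
    change res M.obj (λ_ (α ⊗ β)).hom (M.smul.app r m) =
      res M.obj (swap (𝟙_ Γ) α β) (M.smul.app r (res M.obj (λ_ β).hom m))
    rw [M.smul.res_right, ← res_comp]
    refine res_congr _ ?_ _
    simp [swap]

/-- The unit of an algebra, as a map of modules. -/
def GrAlg.unitHom (A : GrAlg R) : GrMod.scalars R ⟶ A.toMod where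
  hom := A.unit
  map_smul r s := A.unit_mul r s

/-- Choose `e` so that `∑ x z y = g(z)`, where `g` is `R`-linear with `g(1) = 1`. Surjectivity of
the sandwich map gives `e`; injectivity gives its centrality, because `a g(z) = g(z) a` for scalars
`g(z)`. -/
theorem IsAzumaya.exists_isSeparabilityIdempotent (hA : IsAzumaya A) :
    ∃ e : FreeAbelianGroup (TensorGen A.toMod A.toMod (𝟙_ Γ)), IsSeparabilityIdempotent e := by
  obtain ⟨g, hg⟩ := A.exists_retraction_of_isSeparating hA.isGradedGenerator.separating
  -- The endomorphism `z ↦ g(z)·1` has degree `𝟙_ Γ`, hence the final map into the shift by the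
  -- unit.
  obtain ⟨⟨e⟩, he⟩ := (hA.bijective (𝟙_ Γ)).2 (g ≫ A.unitHom ≫ A.toMod.toShiftUnit)
  have he' : FreeAbelianGroup.lift (sandwich A) e = g ≫ A.unitHom ≫ A.toMod.toShiftUnit := he
  have key : ∀ {δ : Γ} (z : deg A.obj δ), sandwichEval A (𝟙_ Γ) δ e z =
      res A.obj (λ_ δ).hom (ap A.unit (ap g.hom z)) := fun z => by
    rw [← ap_lift_sandwich, he']
    rfl
  refine ⟨e, ?_, fun {N p} hp {α} a => evalTensor_congr hp ((hA.bijective α).1 ?_)⟩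
  · rw [← res_rightUnitor_inv_sandwichEval_one, key, hg, A.unit_one, ← res_comp]
    exact res_eq_self _ (by rw [unitors_equal]; simp) _
  · change FreeAbelianGroup.lift (sandwich A) _ = FreeAbelianGroup.lift (sandwich A) _
    refine GrMod.hom_ext fun δ z => ?_
    refine (ap_lift_sandwich (leftAct a e) z).trans (Eq.trans ?_ (ap_lift_sandwich (rightAct a e) z).symm)
    -- From here on it matters only that the value at `z` is a scalar, which commutes with `a`.
    obtain ⟨r, hr⟩ : ∃ r : deg R.obj δ, sandwichEval A (𝟙_ Γ) δ e z =
      res A.obj (λ_ δ).hom (ap A.unit r) := ⟨_, key z⟩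
    rw [sandwichEval_leftAct, sandwichEval_rightAct, hr, A.mul.res_right, A.mul.res_left,
      ← res_comp, ← res_comp, A.mul_unit, ← res_comp]
    refine res_congr _ ?_ _
    simp

section
variable {N : GrBimod A} {p : Pairing A.obj A.obj N.obj}

theorem evalTensor_leftAct
    (hp : ∀ {α β γ : Γ} (a : deg A.obj α) (x : deg A.obj β) (y : deg A.obj γ),
      p.app (A.mul.app a x) y = res N.obj (α_ α β γ).hom (N.left.app a (p.app x y)))
    {α : Γ} (a : deg A.obj α) (t : FreeAbelianGroup (TensorGen A.toMod A.toMod (𝟙_ Γ))) :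
    evalTensor p α (leftAct a t) =
      res N.obj (ρ_ α).inv (N.left.app a (evalTensor p (𝟙_ Γ) t)) := by
  induction t using FreeAbelianGroup.induction_on with
  | zero => simp
  | of t =>
    obtain ⟨f, x, y⟩ := t
    rw [leftAct_of, evalTensor_of, evalTensor_of, hp, N.left.res_right, ← res_comp, ← res_comp]
    refine res_congr _ ?_ _
    simp
  | neg t ih => simp only [map_neg, ih]
  | add s t ih ih' => simp only [map_add, ih, ih']

theorem evalTensor_rightAct
    (hp : ∀ {α β γ : Γ} (x : deg A.obj α) (y : deg A.obj β) (a : deg A.obj γ),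
      N.right.app (p.app x y) a = res N.obj (α_ α β γ).hom (p.app x (A.mul.app y a)))
    {α : Γ} (a : deg A.obj α) (t : FreeAbelianGroup (TensorGen A.toMod A.toMod (𝟙_ Γ))) :
    evalTensor p α (rightAct a t) =
      res N.obj (λ_ α).inv (N.right.app (evalTensor p (𝟙_ Γ) t) a) := by
  induction t using FreeAbelianGroup.induction_on with
  | zero => simp
  | of t =>
    obtain ⟨f, x, y⟩ := t
    rw [rightAct_of, evalTensor_of, evalTensor_of, N.right.res_left, hp, ← res_comp, ← res_comp]
    refine res_congr _ ?_ _
    simp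
  | neg t ih => simp only [map_neg, AddMonoidHom.neg_apply, ih]
  | add s t ih ih' => simp only [map_add, AddMonoidHom.add_apply, ih, ih']

/-- For the pairing `(x, y) ↦ D(x) y`, the Leibniz rule adds `D(a) ∑ x y` to the linear formula;
this is the term that isolates `D(a)` once `∑ x y = 1`. -/
theorem evalTensor_leftAct_of_der (D : Der (𝟙 A) N)
    (hp : ∀ {α β γ : Γ} (a : deg A.obj α) (x : deg A.obj β) (y : deg A.obj γ),
      p.app (A.mul.app a x) y = res N.obj (α_ α β γ).hom (N.left.app a (p.app x y)) +
        res N.obj (α_ α β γ).hom (N.right.app (ap D.1 a) (A.mul.app x y)))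
    {α : Γ} (a : deg A.obj α) (t : FreeAbelianGroup (TensorGen A.toMod A.toMod (𝟙_ Γ))) :
    evalTensor p α (leftAct a t) =
      res N.obj (ρ_ α).inv (N.left.app a (evalTensor p (𝟙_ Γ) t)) +
        res N.obj (ρ_ α).inv (N.right.app (ap D.1 a) (evalTensor A.mul (𝟙_ Γ) t)) := by
  induction t using FreeAbelianGroup.induction_on with
  | zero => simp
  | of t =>
    obtain ⟨f, x, y⟩ := t
    rw [leftAct_of, evalTensor_of, evalTensor_of, evalTensor_of, hp, N.left.res_right,
      N.right.res_right, map_add]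
    simp only [← res_comp]
    congr 1 <;>
    · refine res_congr _ ?_ _
      simp
  | neg t ih =>
    simp only [map_neg, ih]
    abel
  | add s t ih ih' =>
    simp only [map_add, ih, ih']
    abel

end

/-- The pairing `(x, y) ↦ D(x) y`. -/
def derPairing {N : GrBimod A} (D : Der (𝟙 A) N) : Pairing A.obj A.obj N.obj where
  app := N.right.app.comp (ap D.1)
  app_res f g x y := by
    change N.right.app (ap D.1 (res A.obj f x)) _ = res N.obj _ (N.right.app (ap D.1 x) y)
    rw [ap_res, N.right.app_res]

theorem derPairing_app {N : GrBimod A} (D : Der (𝟙 A) N) {α β : Γ} (x : deg A.obj α)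
    (y : deg A.obj β) : (derPairing D).app x y = N.right.app (ap D.1 x) y := rfl

theorem Der.map_mul {N : GrBimod A} (D : Der (𝟙 A) N) {α β : Γ} (x : deg A.obj α)
    (y : deg A.obj β) :
    ap D.1 (A.mul.app x y) = N.left.app x (ap D.1 y) + N.right.app (ap D.1 x) y := D.2.2 x y

theorem Der.map_unit_mul {N : GrBimod A} (D : Der (𝟙 A) N) {α β : Γ} (r : deg R.obj α)
    (y : deg A.obj β) :
    ap D.1 (A.mul.app (ap A.unit r) y) = N.left.app (ap A.unit r) (ap D.1 y) := D.2.1 r y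

/-- Scalars pass through `D` by linearity, and then from left to right because the two actions of
`R` on `N` agree. -/
theorem derPairing_isBalanced {N : GrBimod A} (D : Der (𝟙 A) N) : (derPairing D).IsBalanced := by
  intro α β δ x r y
  rw [derPairing_app, derPairing_app, ap_res, Der.map_unit_mul D, N.unit_central, ← res_comp,
    SymmetricCategory.symmetry, res_id, N.right_mul]

/-- With `n = ∑ D(x) y`, centrality of `e` reads `∑ D(a x) y = ∑ D(x) y a`, that is, `a n + D(a) = n
a`. Hence `D` is the inner derivation of `-n`, the sign being due to the convention `a ↦ a n - n a`.
-/
theorem IsSeparabilityIdempotent.inner_surjective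
    {e : FreeAbelianGroup (TensorGen A.toMod A.toMod (𝟙_ Γ))} (he : IsSeparabilityIdempotent e)
    (N : GrBimod A) : Function.Surjective (Der.inner N) := by
  intro D
  refine ⟨-evalTensor (derPairing D) _ e, Subtype.ext (PicGraded.hom_ext fun α a => ?_)⟩
  change Der.commutator N _ α a = _
  have h := he.central (derPairing_isBalanced D) a
  rw [evalTensor_rightAct (fun x y a => N.right_mul _ _ _),
    evalTensor_leftAct_of_der D (fun a x y => by
      rw [derPairing_app, derPairing_app, Der.map_mul D, map_add, AddMonoidHom.add_apply, N.left_right,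
        N.right_mul]), he.eval_mul, N.right_one, ← res_comp, Iso.inv_hom_id, res_id] at h
  rw [Der.commutator_apply, map_neg, map_neg, map_neg, AddMonoidHom.neg_apply, map_neg, ← h]
  abel

/-- The map `A ⟶ N` determined by an element of degree `𝟙_ Γ` that commutes with `A`. -/
def homOfCentral {N : GrBimod A} (n : deg N.obj (𝟙_ Γ))
    (hn : ∀ (α : Γ) (a : deg A.obj α), Der.commutator N n α a = 0) : GrBimod.regular A ⟶ N where
  hom := mkHom (M := A.obj) (fun α => (res N.obj (ρ_ α).inv).comp (N.left.app.flip n))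
    fun {α β} g a => by
      change res N.obj _ (N.left.app (res A.obj g a) n) = res N.obj g (res N.obj _ (N.left.app a n))
      rw [N.left.res_left, ← res_comp, ← res_comp, rightUnitor_inv_naturality]
  map_left {α β} a b := by
    change res N.obj (ρ_ (α ⊗ β)).inv (N.left.app (A.mul.app a (show deg A.obj β from b)) n) =
      N.left.app a (res N.obj (ρ_ β).inv (N.left.app (show deg A.obj β from b) n))
    rw [N.mul_left, N.left.res_right, ← res_comp]
    refine res_congr _ ?_ _
    simp
  map_right {α β} a b := by
    change res N.obj (ρ_ (α ⊗ β)).inv (N.left.app (A.mul.app (show deg A.obj α from a) b) n) =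
      N.right.app (res N.obj (ρ_ α).inv (N.left.app (show deg A.obj α from a) n)) b
    have h := hn _ b
    rw [Der.commutator_apply, sub_eq_zero] at h
    have h' : N.left.app b n = res N.obj ((ρ_ β).hom ≫ (λ_ β).inv) (N.right.app n b) := by
      rw [res_comp, ← h, ← res_comp, Iso.hom_inv_id, res_id]
    rw [N.mul_left, h', N.left.res_right, N.right.res_left, N.left_right]
    simp only [← res_comp]
    refine res_congr _ ?_ _
    simp

theorem homOfCentral_apply {N : GrBimod A} (n : deg N.obj (𝟙_ Γ))
    (hn : ∀ (α : Γ) (a : deg A.obj α), Der.commutator N n α a = 0) {α : Γ} (a : deg A.obj α) :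
    ap (homOfCentral n hn).hom a = res N.obj (ρ_ α).inv (N.left.app a n) := rfl

theorem homOfCentral_one {N : GrBimod A} (n : deg N.obj (𝟙_ Γ))
    (hn : ∀ (α : Γ) (a : deg A.obj α), Der.commutator N n α a = 0) :
    ap (homOfCentral n hn).hom A.one = n := by
  rw [homOfCentral_apply, N.one_left, ← res_comp, unitors_equal, Iso.inv_hom_id, res_id]

/-- A map of bimodules out of `A`, as a map of graded abelian groups. -/
def regularHom {N : GrBimod A} (f : GrBimod.regular A ⟶ N) : A.obj ⟶ N.obj := f.hom

theorem regularHom_apply {N : GrBimod A} (f : GrBimod.regular A ⟶ N) {α : Γ} (a : deg A.obj α) :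
    ap (regularHom f) a = res N.obj (ρ_ α).inv (N.left.app a (ap (regularHom f) A.one)) := by
  have h : ap (regularHom f) (A.mul.app a A.one) = N.left.app a (ap (regularHom f) A.one) :=
    f.map_left a A.one
  rw [← h, ← ap_res, A.mul_one, ← res_comp, Iso.inv_hom_id, res_id]

theorem regularHom_one_apply {N : GrBimod A} (f : GrBimod.regular A ⟶ N) {α : Γ}
    (a : deg A.obj α) :
    ap (regularHom f) a = res N.obj (λ_ α).inv (N.right.app (ap (regularHom f) A.one) a) := by
  have h : ap (regularHom f) (A.mul.app A.one a) = N.right.app (ap (regularHom f) A.one) a :=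
    f.map_right A.one a
  rw [← h, ← ap_res, A.one_mul, ← res_comp, Iso.inv_hom_id, res_id]

theorem regular_hom_ext {N : GrBimod A} {f g : GrBimod.regular A ⟶ N}
    (h : ap (regularHom f) A.one = ap (regularHom g) A.one) : f = g :=
  GrBimod.hom_ext fun _ a => (regularHom_apply f a).trans
    (Eq.trans (by rw [h]) (regularHom_apply g a).symm)

theorem commutator_hom_one {N : GrBimod A} (f : GrBimod.regular A ⟶ N) (α : Γ)
    (a : deg A.obj α) : Der.commutator N (ap (regularHom f) A.one) α a = 0 := by
  rw [Der.commutator_apply, ← regularHom_apply, ← regularHom_one_apply, sub_self]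

/-- The left linear map `a ↦ a n` is right linear exactly when `n` commutes with `A`, and a bimodule
map out of `A` multiplies its value at `1`. -/
theorem inner_eq_zero_iff {N : GrBimod A} (n : deg N.obj (𝟙_ Γ)) :
    Der.inner N n = 0 ↔ ∃ f : GrBimod.regular A ⟶ N, ap (regularHom f) A.one = n := by
  constructor
  · intro h
    have h' : ∀ (α : Γ) (a : deg A.obj α), Der.commutator N n α a = 0 := fun α a =>
      congrArg (fun D : Der (𝟙 A) N => ap D.1 a) h
    exact ⟨homOfCentral n h', homOfCentral_one n h'⟩
  · rintro ⟨f, rfl⟩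
    exact Subtype.ext (PicGraded.hom_ext fun α a => commutator_hom_one f α a)

/-- The pairing `(x, y) ↦ x n y`. -/
def conjPairing (N : GrBimod A) (n : deg N.obj (𝟙_ Γ)) : Pairing A.obj A.obj N.obj where
  app {α β} := AddMonoidHom.mk' (fun x => (res N.obj (α ◁ (λ_ β).inv)).comp
    ((N.left.app x).comp (N.right.app n))) fun x y => by
      ext z
      change res N.obj _ (N.left.app (x + y) _) = _ + _
      rw [map_add, AddMonoidHom.add_apply, map_add]
      rfl
  app_res f g x y := by
    change res N.obj _ (N.left.app (res A.obj f x) (N.right.app n (res A.obj g y))) =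
      res N.obj _ (res N.obj _ (N.left.app x (N.right.app n y)))
    rw [N.right.res_right, N.left.app_res, ← res_comp, ← res_comp]
    refine res_congr _ ?_ _
    simp only [← id_tensorHom, tensorHom_comp_tensorHom, Category.id_comp, Category.comp_id,
      leftUnitor_inv_naturality]

theorem conjPairing_app (N : GrBimod A) (n : deg N.obj (𝟙_ Γ)) {α β : Γ} (x : deg A.obj α)
    (y : deg A.obj β) : (conjPairing N n).app x y =
      res N.obj (α ◁ (λ_ β).inv) (N.left.app x (N.right.app n y)) := rfl

theorem conjPairing_isBalanced (N : GrBimod A) (n : deg N.obj (𝟙_ Γ)) :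
    (conjPairing N n).IsBalanced := by
  intro α β δ x r y
  rw [← A.mul_unit, conjPairing_app, conjPairing_app, N.mul_left, Der.right_mul',
    Der.right_unit, N.right.res_left, N.left_right, N.left.res_right, N.left.res_right,
    N.left.res_right]
  simp only [← res_comp]
  refine res_congr _ ?_ _
  simp [← MonoidalCategory.whiskerLeft_comp]

theorem conjPairing_mul_left (N : GrBimod A) (n : deg N.obj (𝟙_ Γ)) {α β γ : Γ} (a : deg A.obj α)
    (x : deg A.obj β) (y : deg A.obj γ) : (conjPairing N n).app (A.mul.app a x) y =
      res N.obj (α_ α β γ).hom (N.left.app a ((conjPairing N n).app x y)) := by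
  rw [conjPairing_app, conjPairing_app, N.mul_left, N.left.res_right, ← res_comp, ← res_comp]
  refine res_congr _ ?_ _
  simp

theorem conjPairing_mul_right (N : GrBimod A) (n : deg N.obj (𝟙_ Γ)) {α β γ : Γ} (x : deg A.obj α)
    (y : deg A.obj β) (a : deg A.obj γ) : N.right.app ((conjPairing N n).app x y) a =
      res N.obj (α_ α β γ).hom ((conjPairing N n).app x (A.mul.app y a)) := by
  rw [conjPairing_app, conjPairing_app, N.right.res_left, N.left_right, N.right_mul,
    N.left.res_right]
  simp only [← res_comp]
  refine res_congr _ ?_ _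
  simp

theorem ap_evalTensor_conjPairing {M N : GrBimod A} (g : M ⟶ N) (m : deg M.obj (𝟙_ Γ)) {γ : Γ}
    (t : FreeAbelianGroup (TensorGen A.toMod A.toMod γ)) :
    ap g.hom (evalTensor (conjPairing M m) γ t) =
      evalTensor (conjPairing N (ap g.hom m)) γ t := by
  induction t using FreeAbelianGroup.induction_on with
  | zero => simp
  | of t => rw [evalTensor_of, evalTensor_of, conjPairing_app, conjPairing_app, ap_res, ap_res,
      g.map_left, g.map_right]
  | neg t ih => simp only [map_neg, ih]
  | add s t ih ih' => simp only [map_add, ih, ih']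

/-- Since `x f(1) y = f(x y)`, averaging `f(1)` with a tensor gives `f` of the product of the
tensor; a separability idempotent therefore fixes `f(1)`. -/
theorem evalTensor_conjPairing_hom_one {N : GrBimod A} (f : GrBimod.regular A ⟶ N) {γ : Γ}
    (t : FreeAbelianGroup (TensorGen A.toMod A.toMod γ)) :
    evalTensor (conjPairing N (ap (regularHom f) A.one)) γ t =
      ap (regularHom f) (evalTensor A.mul γ t) := by
  induction t using FreeAbelianGroup.induction_on with
  | zero => simp
  | of t =>
    have h (x : deg A.obj t.left) (y : deg A.obj t.right) :
      ap (regularHom f) (A.mul.app x y) = N.left.app x (ap (regularHom f) y) := f.map_left x y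
    rw [evalTensor_of, evalTensor_of, conjPairing_app, ap_res]
    refine congrArg (res N.obj t.arrow) ?_
    rw [← N.left.res_right, ← regularHom_one_apply]
    exact (h _ _).symm
  | neg t ih => simp only [map_neg, ih]
  | add s t ih ih' => simp only [map_add, ih, ih']

/-- To lift `f` along an epimorphism, lift `f(1)` to any `m` and replace `m` by its average `∑ x m
y`. The average is central, so it defines a bimodule map, and it still maps to `f(1)` because `∑ x y
= 1`. -/
theorem IsSeparabilityIdempotent.projective_regular
    {e : FreeAbelianGroup (TensorGen A.toMod A.toMod (𝟙_ Γ))} (he : IsSeparabilityIdempotent e) :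
    Projective (GrBimod.regular A) where
  factors {M N} f g hg := by
    obtain ⟨m, hm⟩ := GrBimod.ap_surjective_of_epi g _ (ap (regularHom f) A.one)
    have hc : ∀ (α : Γ) (a : deg A.obj α),
        Der.commutator M (evalTensor (conjPairing M m) _ e) α a = 0 := fun α a => by
      have h := he.central (conjPairing_isBalanced M m) a
      rw [evalTensor_leftAct (conjPairing_mul_left M m),
        evalTensor_rightAct (conjPairing_mul_right M m)] at h
      rw [Der.commutator_apply, h, sub_self]
    refine ⟨homOfCentral _ hc, regular_hom_ext ?_⟩
    change ap g.hom (ap (homOfCentral _ hc).hom A.one) = _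
    rw [homOfCentral_one, ap_evalTensor_conjPairing, hm, evalTensor_conjPairing_hom_one,
      he.eval_mul]

end
end PicGraded

/-! ### Free graded modules, right shifts and graded `R`-linear maps. -/

namespace PicGraded

section
variable {Γ : Type u} [Category.{u} Γ] [MonoidalCategory Γ] [SymmetricCategory Γ]

namespace FreeMod

/-- Formal expressions in the language of `R`-modules, in generators `X`. -/
inductive Term (R : GrCommRing Γ) (X : Γ → Type u) : Γ → Type u
  | of {γ : Γ} (x : X γ) : Term R X γ
  | zero {γ : Γ} : Term R X γ
  | add {γ : Γ} (s t : Term R X γ) : Term R X γ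
  | neg {γ : Γ} (t : Term R X γ) : Term R X γ
  | smul {α β : Γ} (r : deg R.obj α) (t : Term R X β) : Term R X (α ⊗ β)
  | restrict {α β : Γ} (f : α ⟶ β) (t : Term R X β) : Term R X α

open Term

/-- The congruence on expressions generated by the axioms of an `R`-module. -/
inductive Rel (R : GrCommRing Γ) (X : Γ → Type u) : ∀ {γ : Γ}, Term R X γ → Term R X γ → Prop
  | refl {γ : Γ} (s : Term R X γ) : Rel R X s s
  | symm {γ : Γ} {s t : Term R X γ} : Rel R X s t → Rel R X t s
  | trans {γ : Γ} {s t u : Term R X γ} : Rel R X s t → Rel R X t u → Rel R X s u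
  | add_congr {γ : Γ} {s s' t t' : Term R X γ} :
      Rel R X s s' → Rel R X t t' → Rel R X (add s t) (add s' t')
  | neg_congr {γ : Γ} {s s' : Term R X γ} : Rel R X s s' → Rel R X (neg s) (neg s')
  | smul_congr {α β : Γ} (r : deg R.obj α) {t t' : Term R X β} :
      Rel R X t t' → Rel R X (smul r t) (smul r t')
  | res_congr {α β : Γ} (f : α ⟶ β) {s s' : Term R X β} :
      Rel R X s s' → Rel R X (restrict f s) (restrict f s')
  | add_assoc {γ : Γ} (s t u : Term R X γ) : Rel R X (add (add s t) u) (add s (add t u))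
  | add_comm {γ : Γ} (s t : Term R X γ) : Rel R X (add s t) (add t s)
  | zero_add {γ : Γ} (s : Term R X γ) : Rel R X (add zero s) s
  | neg_add {γ : Γ} (s : Term R X γ) : Rel R X (add (neg s) s) zero
  | res_id {γ : Γ} (s : Term R X γ) : Rel R X (restrict (𝟙 γ) s) s
  | res_comp {α β γ : Γ} (f : α ⟶ β) (g : β ⟶ γ) (s : Term R X γ) :
      Rel R X (restrict (f ≫ g) s) (restrict f (restrict g s))
  | res_add {α β : Γ} (f : α ⟶ β) (s t : Term R X β) :
      Rel R X (restrict f (add s t)) (add (restrict f s) (restrict f t))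
  | add_smul {α β : Γ} (r r' : deg R.obj α) (t : Term R X β) :
      Rel R X (smul (r + r') t) (add (smul r t) (smul r' t))
  | smul_add {α β : Γ} (r : deg R.obj α) (t t' : Term R X β) :
      Rel R X (smul r (add t t')) (add (smul r t) (smul r t'))
  | smul_res {α α' β β' : Γ} (f : α' ⟶ α) (g : β' ⟶ β) (r : deg R.obj α) (t : Term R X β) :
      Rel R X (smul (PicGraded.res R.obj f r) (restrict g t)) (restrict (f ⊗ₘ g) (smul r t))
  | one_smul {α : Γ} (t : Term R X α) : Rel R X (smul R.one t) (restrict (λ_ α).hom t)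
  | mul_smul {α β γ : Γ} (r : deg R.obj α) (s : deg R.obj β) (t : Term R X γ) :
      Rel R X (smul (R.mul.app r s) t) (restrict (α_ α β γ).hom (smul r (smul s t)))

variable (R : GrCommRing Γ) (X : Γ → Type u)

instance setoid (γ : Γ) : Setoid (Term R X γ) := ⟨Rel R X, Rel.refl, Rel.symm, Rel.trans⟩

abbrev Carrier (γ : Γ) : Type u := Quotient (setoid R X γ)

variable {R X}

abbrev mk {γ : Γ} (t : Term R X γ) : Carrier R X γ := Quotient.mk _ t

theorem sound {γ : Γ} {s t : Term R X γ} (h : Rel R X s t) : mk s = mk t := Quotient.sound h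

instance (γ : Γ) : Zero (Carrier R X γ) := ⟨mk zero⟩
instance (γ : Γ) : Add (Carrier R X γ) :=
  ⟨Quotient.map₂ add fun _ _ h _ _ h' => Rel.add_congr h h'⟩
instance (γ : Γ) : Neg (Carrier R X γ) := ⟨Quotient.map neg fun _ _ h => Rel.neg_congr h⟩

instance (γ : Γ) : AddCommGroup (Carrier R X γ) :=
  { AddGroup.ofLeftAxioms
      (by
        rintro ⟨a⟩ ⟨b⟩ ⟨c⟩
        exact sound (Rel.add_assoc a b c))
      (by
        rintro ⟨a⟩
        exact sound (Rel.zero_add a))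
      (by
        rintro ⟨a⟩
        exact sound (Rel.neg_add a)) with
    add_comm := by
      rintro ⟨a⟩ ⟨b⟩
      exact sound (Rel.add_comm a b) }

variable (R X)

def grAb : GrAb Γ where
  obj γ := AddCommGrpCat.of (Carrier R X γ.unop)
  map f := AddCommGrpCat.ofHom <| AddMonoidHom.mk'
    (Quotient.map (restrict f.unop) fun _ _ h => Rel.res_congr f.unop h) (by
      rintro ⟨a⟩ ⟨b⟩
      exact sound (Rel.res_add f.unop a b))
  map_id γ := by
    ext ⟨a⟩
    exact sound (Rel.res_id a)
  map_comp f g := by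
    ext ⟨a⟩
    exact sound (Rel.res_comp g.unop f.unop a)

def smulPairing : Pairing R.obj (grAb R X) (grAb R X) where
  app {α β} := AddMonoidHom.mk' (fun r : deg R.obj α => AddMonoidHom.mk'
      (fun b : Carrier R X β => (Quotient.map (smul r) (fun _ _ h => Rel.smul_congr r h) b :
        Carrier R X (α ⊗ β)))
      (by
        rintro ⟨b⟩ ⟨b'⟩
        exact sound (Rel.smul_add r b b')))
    (by
      intro a a'
      refine AddMonoidHom.ext ?_
      rintro ⟨b⟩
      exact sound (Rel.add_smul a a' b))
  app_res f g := by
    rintro a ⟨b⟩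
    exact sound (Rel.smul_res f g a b)

end FreeMod

/-- The free `R`-module on a family `X` of sets of homogeneous generators. -/
def FreeMod (R : GrCommRing Γ) (X : Γ → Type u) : GrMod R where
  obj := FreeMod.grAb R X
  smul := FreeMod.smulPairing R X
  one_smul := by
    rintro α ⟨a⟩
    exact FreeMod.sound (.one_smul a)
  mul_smul := by
    rintro α β γ a b ⟨c⟩
    exact FreeMod.sound (.mul_smul a b c)

namespace FreeMod
variable {R : GrCommRing Γ} {X : Γ → Type u}

/-- The generators of the free module. -/
def of {γ : Γ} (x : X γ) : deg (FreeMod R X).obj γ := mk (.of x)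

variable {Y : GrMod R} (v : ∀ γ : Γ, X γ → deg Y.obj γ)

/-- Evaluation of an expression in a module. -/
def eval : ∀ {γ : Γ}, Term R X γ → deg Y.obj γ
  | _, .of x => v _ x
  | _, .zero => 0
  | _, .add s t => eval s + eval t
  | _, .neg t => -eval t
  | _, .smul r t => Y.smul.app r (eval t)
  | _, .restrict f t => res Y.obj f (eval t)

theorem eval_eq {γ : Γ} {s t : Term R X γ} (h : Rel R X s t) : eval v s = eval v t := by
  induction h with
  | refl s => rfl
  | symm _ ih => exact ih.symm
  | trans _ _ ih ih' => exact ih.trans ih'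
  | add_congr _ _ ih ih' => simp only [eval, ih, ih']
  | neg_congr _ ih => simp only [eval, ih]
  | smul_congr r _ ih => simp only [eval, ih]
  | res_congr f _ ih => simp only [eval, ih]
  | add_assoc s t u => exact _root_.add_assoc _ _ _
  | add_comm s t => exact _root_.add_comm _ _
  | zero_add s => exact _root_.zero_add _
  | neg_add s => exact neg_add_cancel _
  | res_id s => exact PicGraded.res_id _ _
  | res_comp f g s => exact PicGraded.res_comp _ f g _
  | res_add f s t => exact map_add _ _ _
  | add_smul r r' t => simp only [eval, map_add, AddMonoidHom.add_apply]
  | smul_add s t t' => simp only [eval, map_add]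
  | smul_res f g s t => exact Y.smul.app_res f g _ _
  | one_smul s => exact Y.one_smul _
  | mul_smul s t u => exact Y.mul_smul _ _ _

/-- The universal property of the free module. -/
def lift : FreeMod R X ⟶ Y where
  hom := mkHom (M := grAb R X) (fun γ => AddMonoidHom.mk'
      (Quotient.lift (eval v) fun _ _ h => eval_eq v h) (by
        rintro ⟨a⟩ ⟨b⟩
        rfl)) (by
    rintro α β g ⟨a⟩
    rfl)
  map_smul := by
    rintro α β a ⟨b⟩
    rfl

theorem hom_ext {f g : FreeMod R X ⟶ Y}
    (h : ∀ (γ : Γ) (x : X γ), ap f.hom (of x) = ap g.hom (of x)) : f = g := by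
  refine GrMod.hom_ext ?_
  suffices H : ∀ {γ : Γ} (t : Term R X γ),
      ap f.hom (show deg (FreeMod R X).obj γ from mk t) = ap g.hom (mk t) by
    rintro γ ⟨t⟩
    exact H t
  intro γ t
  induction t with
  | of x => exact h _ x
  | zero => exact (map_zero (ap f.hom)).trans (map_zero (ap g.hom)).symm
  | add s t ih ih' =>
    refine (map_add (ap f.hom) (mk s) (mk t)).trans
      (Eq.trans ?_ (map_add (ap g.hom) (mk s) (mk t)).symm)
    exact congrArg₂ (· + ·) ih ih'
  | neg t ih =>
    refine (map_neg (ap f.hom) (mk t)).trans (Eq.trans ?_ (map_neg (ap g.hom) (mk t)).symm)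
    exact congrArg Neg.neg ih
  | smul r t ih =>
    refine (f.map_smul r (mk t)).trans (Eq.trans ?_ (g.map_smul r (mk t)).symm)
    rw [ih]
  | restrict φ t ih =>
    refine (ap_res f.hom φ (mk t)).trans (Eq.trans ?_ (ap_res g.hom φ (mk t)).symm)
    rw [ih]

end FreeMod

/-- Induction on the elements of a free algebra. -/
theorem FreeAlg.induction {R : GrCommRing Γ} {X : Γ → Type u}
    {p : ∀ γ : Γ, deg (FreeAlg R X).obj γ → Prop} (of : ∀ {γ : Γ} (x : X γ), p γ (FreeAlg.of x))
    (unit : ∀ {γ : Γ} (r : deg R.obj γ), p γ (ap (FreeAlg R X).unit r))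
    (add : ∀ {γ : Γ} (a b : deg (FreeAlg R X).obj γ), p γ a → p γ b → p γ (a + b))
    (neg : ∀ {γ : Γ} (a : deg (FreeAlg R X).obj γ), p γ a → p γ (-a))
    (mul : ∀ {α β : Γ} (a : deg (FreeAlg R X).obj α) (b : deg (FreeAlg R X).obj β), p α a → p β b →
      p (α ⊗ β) ((FreeAlg R X).mul.app a b))
    (res : ∀ {α β : Γ} (f : α ⟶ β) (a : deg (FreeAlg R X).obj β), p β a →
      p α (res (FreeAlg R X).obj f a)) {γ : Γ} (a : deg (FreeAlg R X).obj γ) : p γ a := by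
  suffices H : ∀ {γ : Γ} (t : FreeAlg.Term R X γ), p γ (FreeAlg.mk t) by
    obtain ⟨t⟩ := a
    exact H t
  intro γ t
  induction t with
  | of x => exact of x
  | scalar r => exact unit r
  -- Zero needs no clause of its own in the induction principle: it is the image of the scalar `0`.
  | @zero γ =>
    have := unit (0 : deg R.obj γ)
    rwa [map_zero] at this
  | add s t ih ih' => exact add _ _ ih ih'
  | neg t ih => exact neg _ ih
  | mul s t ih ih' => exact mul _ _ ih ih'
  | restrict f t ih => exact res f _ ih

variable {R : GrCommRing Γ}

/-- The module `δ ↦ M_{δ ⊗ γ}`. -/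
def GrMod.rshift (M : GrMod R) (γ : Γ) : GrMod R where
  obj := (tensorRight γ).op ⋙ M.obj
  smul :=
    { app := fun {α δ} => AddMonoidHom.compr₂ M.smul.app (res M.obj (α_ α δ γ).hom)
      app_res := fun f g r m => by
        change res M.obj _ (M.smul.app (res R.obj f r) (res M.obj (g ▷ γ) m)) =
          res M.obj ((f ⊗ₘ g) ▷ γ) (res M.obj _ (M.smul.app r m))
        rw [M.smul.app_res, ← res_comp, ← res_comp]
        refine res_congr _ ?_ _
        rw [← tensorHom_id, ← tensorHom_id, associator_naturality] }
  one_smul {δ} m := by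
    change res M.obj (α_ (𝟙_ Γ) δ γ).hom (M.smul.app R.one m) = res M.obj ((λ_ δ).hom ▷ γ) m
    rw [M.one_smul, ← res_comp]
    refine res_congr _ ?_ _
    change (α_ _ δ γ).hom ≫ (λ_ (δ ⊗ γ)).hom = _
    simp
  mul_smul {α β δ} r s m := by
    change res M.obj (α_ (α ⊗ β) δ γ).hom (M.smul.app (R.mul.app r s) m) =
      res M.obj ((α_ α β δ).hom ▷ γ) (res M.obj (α_ α (β ⊗ δ) γ).hom
        (M.smul.app r (res M.obj (α_ β δ γ).hom (M.smul.app s m))))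
    rw [M.mul_smul, M.smul.res_right, ← res_comp, ← res_comp, ← res_comp]
    refine res_congr _ ?_ _
    change (α_ (α ⊗ β) δ γ).hom ≫ (α_ α β (δ ⊗ γ)).hom = _
    simp

/-- Restriction along `g` as a map of shifted modules. -/
def GrMod.rshiftRes (M : GrMod R) {α β : Γ} (g : α ⟶ β) : M.rshift β ⟶ M.rshift α where
  hom := mkHom (M := (M.rshift β).obj) (N := (M.rshift α).obj) (fun δ => res M.obj (δ ◁ g))
    fun {δ ε} f (m : deg M.obj (ε ⊗ β)) => by
      change res M.obj (δ ◁ g) (res M.obj (f ▷ β) m) = res M.obj (f ▷ α) (res M.obj (ε ◁ g) m)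
      rw [← res_comp, ← res_comp, whisker_exchange]
  map_smul {δ ε} r (m : deg M.obj (ε ⊗ β)) := by
    change res M.obj ((δ ⊗ ε) ◁ g) (res M.obj (α_ δ ε β).hom (M.smul.app r m)) =
      res M.obj (α_ δ ε α).hom (M.smul.app r (res M.obj (ε ◁ g) m))
    rw [M.smul.res_right, ← res_comp, ← res_comp]
    refine res_congr _ ?_ _
    simp

/-- Functoriality of the shift. -/
def GrMod.rshiftMap {M N : GrMod R} (f : M ⟶ N) (γ : Γ) : M.rshift γ ⟶ N.rshift γ where
  hom := mkHom (M := (M.rshift γ).obj) (N := (N.rshift γ).obj) (fun δ => ap f.hom (γ := δ ⊗ γ))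
    fun {δ ε} g m => ap_res f.hom (g ▷ γ) m
  map_smul {δ ε} r (m : deg M.obj (ε ⊗ γ)) := by
    change ap f.hom (res M.obj _ (M.smul.app r m)) = res N.obj _ (N.smul.app r (ap f.hom m))
    rw [ap_res, f.map_smul]

/-- The graded abelian group of `R`-linear maps `x ↦ (x)φ`, where `(x)φ` has degree `δ ⊗ γ` if `x`
has degree `δ` and `φ` has degree `γ`. -/
def RHom (X Y : GrMod R) : GrAb Γ where
  obj γ := AddCommGrpCat.of (X ⟶ Y.rshift γ.unop)
  map g := AddCommGrpCat.ofHom <| AddMonoidHom.mk' (fun φ => φ ≫ Y.rshiftRes g.unop) fun φ ψ =>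
    GrMod.hom_ext fun δ x => map_add (res Y.obj (δ ◁ g.unop)) _ _
  map_id γ := by
    ext φ
    exact GrMod.hom_ext fun δ x => res_eq_self Y.obj (whiskerLeft_id _ _) _
  map_comp f g := by
    ext φ
    refine GrMod.hom_ext fun δ x => ?_
    refine Eq.trans ?_ (res_comp Y.obj (δ ◁ g.unop) (δ ◁ f.unop) _)
    exact res_congr Y.obj (MonoidalCategory.whiskerLeft_comp _ _ _) _

namespace RHom
variable {X Y : GrMod R} {γ : Γ}

/-- The value of `φ` at an element of degree `δ`. -/
def ev (φ : deg (RHom X Y) γ) {δ : Γ} : deg X.obj δ →+ deg Y.obj (δ ⊗ γ) :=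
  ap (GrMod.Hom.hom (show X ⟶ Y.rshift γ from φ))

theorem ext {φ ψ : deg (RHom X Y) γ} (h : ∀ (δ : Γ) (x : deg X.obj δ), ev φ x = ev ψ x) : φ = ψ :=
  GrMod.hom_ext h

theorem ev_add (φ ψ : deg (RHom X Y) γ) {δ : Γ} (x : deg X.obj δ) :
    ev (φ + ψ) x = ev φ x + ev ψ x := rfl

theorem ev_of_res {γ' : Γ} (g : γ' ⟶ γ) (φ : deg (RHom X Y) γ) {δ : Γ} (x : deg X.obj δ) :
    ev (res (RHom X Y) g φ) x = res Y.obj (δ ◁ g) (ev φ x) := rfl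

theorem ev_res (φ : deg (RHom X Y) γ) {δ ε : Γ} (f : δ ⟶ ε) (x : deg X.obj ε) :
    ev φ (res X.obj f x) = res Y.obj (f ▷ γ) (ev φ x) :=
  ap_res (GrMod.Hom.hom (show X ⟶ Y.rshift γ from φ)) f x

theorem ev_smul (φ : deg (RHom X Y) γ) {α δ : Γ} (r : deg R.obj α) (x : deg X.obj δ) :
    ev φ (X.smul.app r x) = res Y.obj (α_ α δ γ).hom (Y.smul.app r (ev φ x)) :=
  GrMod.Hom.map_smul (show X ⟶ Y.rshift γ from φ) r x

/-- Constructor for graded maps. -/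
def mk (f : ∀ δ : Γ, deg X.obj δ →+ deg Y.obj (δ ⊗ γ))
    (hf : ∀ {δ ε : Γ} (g : δ ⟶ ε) (x : deg X.obj ε), f δ (res X.obj g x) =
      res Y.obj (g ▷ γ) (f ε x))
    (hs : ∀ {α δ : Γ} (r : deg R.obj α) (x : deg X.obj δ), f _ (X.smul.app r x) =
      res Y.obj (α_ α δ γ).hom (Y.smul.app r (f δ x))) : deg (RHom X Y) γ :=
  show X ⟶ Y.rshift γ from
  { hom := mkHom (N := (Y.rshift γ).obj) f hf
    map_smul := hs }

end RHom

end
end PicGraded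

/-! ### Endomorphism algebras, and free algebras as retracts of free modules. -/

namespace PicGraded

section
variable {Γ : Type u} [Category.{u} Γ] [MonoidalCategory Γ] [SymmetricCategory Γ]
variable {R : GrCommRing Γ}

namespace RHom
variable {X Y Z : GrMod R}

/-- Composition of graded maps, in the order in which they are applied. -/
def comp {α β : Γ} (φ : deg (RHom X Y) α) (ψ : deg (RHom Y Z) β) : deg (RHom X Z) (α ⊗ β) :=
  mk (fun δ => (res Z.obj (α_ δ α β).inv).comp ((ev ψ).comp (ev φ)))
    (fun {δ ε} g x => by
      change res Z.obj _ (ev ψ (ev φ _)) = res Z.obj _ (res Z.obj _ (ev ψ (ev φ x)))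
      rw [ev_res, ev_res, ← res_comp, ← res_comp]
      refine res_congr _ ?_ _
      simp)
    (fun {ε δ} r x => by
      change res Z.obj _ (ev ψ (ev φ _)) = res Z.obj _ (Z.smul.app r (res Z.obj _ (ev ψ (ev φ x))))
      rw [ev_smul, ev_res, ev_smul, Z.smul.res_right, ← res_comp, ← res_comp, ← res_comp]
      refine res_congr _ ?_ _
      simp)

theorem ev_comp {α β : Γ} (φ : deg (RHom X Y) α) (ψ : deg (RHom Y Z) β) {δ : Γ}
    (x : deg X.obj δ) : ev (comp φ ψ) x = res Z.obj (α_ δ α β).inv (ev ψ (ev φ x)) := rfl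

/-- Composition of graded maps as a pairing. -/
def compPairing (X Y Z : GrMod R) : Pairing (RHom X Y) (RHom Y Z) (RHom X Z) where
  app {α β} := AddMonoidHom.mk' (fun φ => AddMonoidHom.mk' (fun ψ => comp φ ψ) fun ψ ψ' =>
      ext fun δ x => by
        rw [ev_add, ev_comp, ev_comp, ev_comp, ev_add, map_add]) fun φ φ' =>
    AddMonoidHom.ext fun ψ => ext fun δ x => by
      change ev (comp (φ + φ') ψ) x = ev (comp φ ψ) x + ev (comp φ' ψ) x
      rw [ev_comp, ev_comp, ev_comp, ev_add, map_add, map_add]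
  app_res f g φ ψ := ext fun δ x => by
    change ev (comp (res _ f φ) (res _ g ψ)) x = ev (res _ _ (comp φ ψ)) x
    rw [ev_of_res, ev_comp, ev_comp, ev_of_res, ev_of_res, ev_res, ← res_comp, ← res_comp,
      ← res_comp]
    refine res_congr _ ?_ _
    simp [MonoidalCategory.tensorHom_def']

theorem ev_compPairing {α β : Γ} (φ : deg (RHom X Y) α) (ψ : deg (RHom Y Z) β) {δ : Γ}
    (x : deg X.obj δ) :
    ev ((compPairing X Y Z).app φ ψ) x = res Z.obj (α_ δ α β).inv (ev ψ (ev φ x)) := rfl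

/-- The identity map. -/
def one (X : GrMod R) : deg (RHom X X) (𝟙_ Γ) :=
  mk (fun δ => res X.obj (ρ_ δ).hom)
    (fun {δ ε} g x => by rw [← res_comp, ← res_comp, rightUnitor_naturality])
    (fun {ε δ} r x => by
      rw [X.smul.res_right, ← res_comp]
      refine res_congr _ ?_ _
      simp)

theorem ev_one {δ : Γ} (x : deg X.obj δ) : ev (one X) x = res X.obj (ρ_ δ).hom x := rfl

/-- Multiplication by a scalar. -/
def scalar (X : GrMod R) {γ : Γ} (r : deg R.obj γ) : deg (RHom X X) γ :=
  mk (fun δ => (res X.obj (β_ δ γ).hom).comp (X.smul.app r))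
    (fun {δ ε} g x => by
      change res X.obj _ (X.smul.app r _) = res X.obj _ (res X.obj _ (X.smul.app r x))
      rw [X.smul.res_right, ← res_comp, ← res_comp, BraidedCategory.braiding_naturality_left])
    (fun {ε δ} s x => by
      change res X.obj _ (X.smul.app r _) = res X.obj _ (X.smul.app s (res X.obj _ (X.smul.app r x)))
      have h : ∀ {α β δ : Γ} (r : deg R.obj α) (s : deg R.obj β) (x : deg X.obj δ),
          X.smul.app r (X.smul.app s x) =
            res X.obj (α_ α β δ).inv (X.smul.app (R.mul.app r s) x) := fun r s x => by
        rw [X.mul_smul, ← res_comp, Iso.inv_hom_id, res_id]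
      -- Multiplication by `r` is `R`-linear because `r (s x) = (r s) x = (s r) x`, which uses
      -- commutativity of `R`.
      rw [h, R.mul_comm, X.smul.res_left, X.mul_smul, X.smul.res_right]
      simp only [← res_comp]
      refine res_congr _ ?_ _
      simp [← comp_whiskerRight_assoc])

theorem ev_scalar {γ δ : Γ} (r : deg R.obj γ) (x : deg X.obj δ) :
    ev (scalar X r) x = res X.obj (β_ δ γ).hom (X.smul.app r x) := rfl

/-- The endomorphism algebra of a module, acting from the right. -/
def endAlg (X : GrMod R) : GrAlg R where
  obj := RHom X X
  mul := compPairing X X X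
  one := one X
  one_mul {α} φ := ext fun δ x => by
    rw [ev_compPairing, ev_one, ev_res, ev_of_res, ← res_comp]
    refine res_congr _ ?_ _
    simp
  mul_one {α} φ := ext fun δ x => by
    rw [ev_compPairing, ev_one, ev_of_res, ← res_comp]
    refine res_congr _ ?_ _
    simp
  mul_assoc {α β γ} φ ψ χ := ext fun δ x => by
    rw [ev_of_res, ev_compPairing, ev_compPairing, ev_compPairing, ev_compPairing, ev_res,
      ← res_comp, ← res_comp, ← res_comp]
    refine res_congr _ ?_ _
    simp
  unit := mkHom (fun γ => AddMonoidHom.mk' (fun r => (scalar X r : deg (RHom X X) γ)) fun r s =>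
      ext fun δ x => by
        rw [ev_add, ev_scalar, ev_scalar, ev_scalar, map_add, AddMonoidHom.add_apply, map_add])
    fun {α β} g r => ext fun δ x => by
      change ev (scalar X _) x = ev (res (RHom X X) g (scalar X r)) x
      rw [ev_of_res, ev_scalar, ev_scalar, X.smul.res_left, ← res_comp, ← res_comp,
        BraidedCategory.braiding_naturality_right]
  unit_one := ext fun δ x => by
    change ev (scalar X _) x = _
    rw [ev_scalar, ev_one, X.one_smul, ← res_comp]
    refine res_congr _ ?_ _
    simp
  unit_mul {α β} r s := ext fun δ x => by
    change ev (scalar X _) x = ev ((compPairing X X X).app (scalar X r) (scalar X s)) x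
    rw [ev_compPairing, ev_scalar, ev_scalar, ev_scalar, R.mul_comm, X.smul.res_left,
      X.mul_smul, X.smul.res_right]
    simp only [← res_comp]
    refine res_congr _ ?_ _
    -- The remaining identity compares two ways of permuting the degrees of the element and of the
    -- two scalars.
    simpa using BraidedCategory.yang_baxter δ α β
  unit_comm {α β} r φ := ext fun δ x => by
    change ev ((compPairing X X X).app (scalar X r) φ) x =
      ev (res (RHom X X) _ ((compPairing X X X).app φ (scalar X r))) x
    rw [ev_of_res, ev_compPairing, ev_compPairing, ev_scalar, ev_scalar, ev_res, ev_smul]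
    simp only [← res_comp]
    refine res_congr _ ?_ _
    simp [← MonoidalCategory.whiskerLeft_comp_assoc]

theorem ev_unit_endAlg {γ δ : Γ} (r : deg R.obj γ) (x : deg X.obj δ) :
    ev (ap (endAlg X).unit r) x = res X.obj (β_ δ γ).hom (X.smul.app r x) := rfl

theorem ev_add_endAlg {γ δ : Γ} (φ ψ : deg (endAlg X).obj γ) (x : deg X.obj δ) :
    ev (φ + ψ) x = ev φ x + ev ψ x := rfl

theorem ev_neg_endAlg {γ δ : Γ} (φ : deg (endAlg X).obj γ) (x : deg X.obj δ) :
    ev (-φ) x = -ev φ x := rfl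

theorem ev_of_res_endAlg {γ γ' δ : Γ} (g : γ' ⟶ γ) (φ : deg (endAlg X).obj γ) (x : deg X.obj δ) :
    ev (res (endAlg X).obj g φ) x = res X.obj (δ ◁ g) (ev φ x) := rfl

theorem ev_mul_endAlg {α β δ : Γ} (φ : deg (endAlg X).obj α) (ψ : deg (endAlg X).obj β)
    (x : deg X.obj δ) : ev ((endAlg X).mul.app φ ψ) x = res X.obj (α_ δ α β).inv (ev ψ (ev φ x)) :=
  rfl

end RHom

/-- A module is a retract of a free module if the canonical map onto it splits. -/
def IsRetractOfFree (M : GrMod R) : Prop :=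
  ∃ s : M ⟶ FreeMod R (deg M.obj), s ≫ FreeMod.lift (fun _ m => m) = 𝟙 M

/-- Right multiplication by `b`. -/
def GrAlg.mulRight (B : GrAlg R) {γ : Γ} (b : deg B.obj γ) : deg (RHom B.toMod B.toMod) γ :=
  RHom.mk (X := B.toMod) (Y := B.toMod) (fun δ => B.mul.app.flip b)
    (fun {δ ε} g x => B.mul.res_left g x b)
    (fun {α δ} r x => B.mul_assoc _ x b)

namespace FreeAlg
variable (R) (X : Γ → Type u)

/-- The free module on the underlying graded set of the free algebra. -/
abbrev cover : GrMod R := FreeMod R (deg (FreeAlg R X).obj)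

/-- The canonical map onto the free algebra. -/
abbrev coverMap : cover R X ⟶ (FreeAlg R X).toMod := FreeMod.lift (fun _ m => m)

/-- The free algebra acts on the free module on its elements. -/
def coverAct : FreeAlg R X ⟶ RHom.endAlg (cover R X) :=
  FreeAlg.lift fun γ x => show cover R X ⟶ (cover R X).rshift γ from
    FreeMod.lift (Y := (cover R X).rshift γ) fun δ y =>
      show deg (cover R X).obj (δ ⊗ γ) from FreeMod.of ((FreeAlg R X).mul.app y (FreeAlg.of x))

theorem coverMap_coverAct_of {γ : Γ} (x : X γ) {δ : Γ} (z : deg (cover R X).obj δ) :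
    ap (coverMap R X).hom (RHom.ev (ap (coverAct R X).hom (FreeAlg.of x)) z) =
      (FreeAlg R X).mul.app (ap (coverMap R X).hom z) (FreeAlg.of x) := by
  have h : (FreeMod.lift (Y := (cover R X).rshift γ) fun δ y =>
      show deg (cover R X).obj (δ ⊗ γ) from FreeMod.of ((FreeAlg R X).mul.app y (FreeAlg.of x))) ≫
        GrMod.rshiftMap (coverMap R X) γ = coverMap R X ≫
        (show (FreeAlg R X).toMod ⟶ (FreeAlg R X).toMod.rshift γ from
          (FreeAlg R X).mulRight (FreeAlg.of x)) := by
    exact FreeMod.hom_ext fun _ _ => rfl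
  exact congrArg (fun g => ap (GrMod.Hom.hom g) z) h

/-- Under the map onto the free algebra, the action on its cover becomes right multiplication. This
holds for generators by construction and is preserved by all the operations that build `b`. -/
theorem coverMap_coverAct {γ : Γ} (b : deg (FreeAlg R X).obj γ) {δ : Γ}
    (z : deg (cover R X).obj δ) :
    ap (coverMap R X).hom (RHom.ev (ap (coverAct R X).hom b) z) =
      (FreeAlg R X).mul.app (ap (coverMap R X).hom z) b := by
  induction b using FreeAlg.induction generalizing δ with
  | of x => exact coverMap_coverAct_of R X x z
  | unit r =>
    rw [(coverAct R X).map_unit, RHom.ev_unit_endAlg, ap_res, (coverMap R X).map_smul,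
      GrAlg.mul_unit]
    rfl
  | add a b ha hb => rw [map_add, RHom.ev_add_endAlg, map_add, ha, hb, map_add]
  | neg a ha => rw [map_neg, RHom.ev_neg_endAlg, map_neg, ha, map_neg]
  | mul a b ha hb =>
    rw [(coverAct R X).map_mul, RHom.ev_mul_endAlg, ap_res, hb, ha, GrAlg.mul_assoc']
  | res f a ha => rw [ap_res, RHom.ev_of_res_endAlg, ap_res, ha, Pairing.res_right]

/-- The section is `b ↦ [1]·b`, where the free algebra acts from the right on the free module on its
elements, a generator `x` sending `[y]` to `[y x]`. The map onto the free algebra sends `[1]·b` to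
`1·b = b`. No basis of words is needed. -/
theorem isRetractOfFree : IsRetractOfFree (FreeAlg R X).toMod := by
  let z : deg (cover R X).obj (𝟙_ Γ) := FreeMod.of (FreeAlg R X).one
  let φ : ∀ {γ : Γ}, deg (FreeAlg R X).obj γ →+ deg (RHom (cover R X) (cover R X)) γ :=
    ap (coverAct R X).hom
  let s : ∀ γ : Γ, deg (FreeAlg R X).obj γ →+ deg (cover R X).obj γ := fun γ =>
    AddMonoidHom.mk' (fun b => res (cover R X).obj (λ_ γ).inv (RHom.ev (φ b) z)) fun a b => by
      rw [map_add, RHom.ev_add, map_add]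
  refine ⟨⟨mkHom (M := (FreeAlg R X).obj) s fun {α β} g b => ?_, fun {α β} r (b : deg (FreeAlg R X).obj β) => ?_⟩,
    GrMod.hom_ext fun γ b => ?_⟩
  · change res (cover R X).obj _ (RHom.ev (ap (coverAct R X).hom _) z) =
      res (cover R X).obj g (res (cover R X).obj _ (RHom.ev (ap (coverAct R X).hom b) z))
    rw [ap_res]
    change res (cover R X).obj _ (res (cover R X).obj _ (RHom.ev (ap (coverAct R X).hom b) z)) = _
    rw [← res_comp, ← res_comp]
    refine res_congr _ ?_ _
    simp
  · change res (cover R X).obj (λ_ (α ⊗ β)).inv (RHom.ev (ap (coverAct R X).hom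
      ((FreeAlg R X).mul.app (ap (FreeAlg R X).unit r) b)) z) =
      (cover R X).smul.app r
        (res (cover R X).obj _ (RHom.ev (ap (coverAct R X).hom b) z))
    rw [(coverAct R X).map_mul, (coverAct R X).map_unit, RHom.ev_mul_endAlg,
      RHom.ev_unit_endAlg]
    generalize ap (coverAct R X).hom b = ψ
    change deg (RHom (cover R X) (cover R X)) β at ψ
    rw [RHom.ev_res, RHom.ev_smul, Pairing.res_right]
    simp only [← res_comp]
    refine res_congr _ ?_ _
    simp
  · change ap (coverMap R X).hom (res (cover R X).obj _
      (RHom.ev (ap (coverAct R X).hom (show deg (FreeAlg R X).obj γ from b)) z)) = _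
    rw [ap_res, coverMap_coverAct]
    change res (FreeAlg R X).obj _ ((FreeAlg R X).mul.app (FreeAlg R X).one b) = b
    rw [(FreeAlg R X).one_mul, ← res_comp, Iso.inv_hom_id, res_id]

end FreeAlg

/-- The inverse of the identification of a module with its shift by the unit. -/
def GrMod.ofShiftUnit (M : GrMod R) : M.shift (𝟙_ Γ) ⟶ M where
  hom := mkHom (M := shiftAb (𝟙_ Γ) M.obj) (fun δ => res M.obj (λ_ δ).inv)
    fun {α β} g (m : deg M.obj (𝟙_ Γ ⊗ β)) => by
      change res M.obj (λ_ α).inv (res M.obj (𝟙_ Γ ◁ g) m) = res M.obj g (res M.obj (λ_ β).inv m)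
      rw [← res_comp, ← res_comp]
      refine res_congr _ ?_ _
      simp
  map_smul {α β} r (m : deg M.obj (𝟙_ Γ ⊗ β)) := by
    change res M.obj (λ_ (α ⊗ β)).inv (res M.obj (swap (𝟙_ Γ) α β) (M.smul.app r m)) =
      M.smul.app r (res M.obj (λ_ β).inv m)
    rw [M.smul.res_right, ← res_comp]
    refine res_congr _ ?_ _
    simp [swap]

theorem GrMod.toShiftUnit_ofShiftUnit (M : GrMod R) : M.toShiftUnit ≫ M.ofShiftUnit = 𝟙 M :=
  GrMod.hom_ext fun δ (m : deg M.obj δ) => by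
    change res M.obj (λ_ δ).inv (res M.obj (λ_ δ).hom m) = m
    rw [← res_comp, Iso.inv_hom_id, res_id]

theorem GrMod.epi_of_surjective {M N : GrMod R} (f : M ⟶ N)
    (hf : ∀ γ : Γ, Function.Surjective (ap f.hom (γ := γ))) : Epi f where
  left_cancellation g h e := GrMod.hom_ext fun γ n => by
    obtain ⟨m, rfl⟩ := hf γ n
    exact congrArg (fun k => ap (GrMod.Hom.hom k) m) e

/-- `M` is a retract of its shift by the unit, hence projective, so the canonical surjection from
the free module on its elements splits. -/
theorem isRetractOfFree_of_projective (M : GrMod R) [Projective (M.shift (𝟙_ Γ))] :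
    IsRetractOfFree M := by
  have : Epi (FreeMod.lift (R := R) (Y := M) (fun _ m => m)) :=
    GrMod.epi_of_surjective _ fun γ m => ⟨FreeMod.of m, rfl⟩
  have : Projective M :=
    Retract.projective ⟨M.toShiftUnit, M.ofShiftUnit, M.toShiftUnit_ofShiftUnit⟩
  exact ⟨Projective.factorThru (𝟙 M) _, Projective.factorThru_comp _ _⟩

end
end PicGraded

/-! ### Linear extra degeneracies of the standard resolution. -/

namespace PicGraded

section
variable {Γ : Type u} [Category.{u} Γ] [MonoidalCategory Γ] [SymmetricCategory Γ]
variable {R : GrCommRing Γ}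

namespace GrAlg
variable {A B C : GrAlg R}

/-- The comultiplication of the comonad `freeOn`. -/
def freeOnDup (B : GrAlg R) : freeOn B ⟶ freeOn (freeOn B) :=
  FreeAlg.lift fun _ x => FreeAlg.of (show deg (freeOn B).obj _ from FreeAlg.of x)

theorem freeOnDup_map_counit (B : GrAlg R) : freeOnDup B ≫ freeOnMap (counit B) = 𝟙 _ :=
  FreeAlg.hom_ext fun _ _ => rfl

theorem freeOnDup_naturality (f : B ⟶ C) :
    freeOnDup B ≫ freeOnMap (freeOnMap f) = freeOnMap f ≫ freeOnDup C :=
  FreeAlg.hom_ext fun _ _ => rfl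

theorem freeOnMap_id (B : GrAlg R) : freeOnMap (𝟙 B) = 𝟙 _ := FreeAlg.hom_ext fun _ _ => rfl

/-- The degeneracy maps of the standard resolution. -/
def degen (A : GrAlg R) : ∀ n : ℕ, Fin n → (bar A n ⟶ bar A (n + 1))
  | 0, i => i.elim0
  | n + 1, i => Fin.cases (freeOnDup (bar A n)) (fun j => freeOnMap (degen A n j)) i

theorem degen_zero (A : GrAlg R) (n : ℕ) : degen A (n + 1) 0 = freeOnDup (bar A n) := rfl

theorem degen_succ (A : GrAlg R) (n : ℕ) (i : Fin n) :
    degen A (n + 1) i.succ = freeOnMap (degen A n i) := rfl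

theorem degen_face_succ (A : GrAlg R) : ∀ (n : ℕ) (i : Fin n),
    degen A n i ≫ face A n i.succ = 𝟙 _
  | n + 1, i => by
    induction i using Fin.cases with
    | zero =>
      rw [degen_zero, face_succ, face_zero]
      exact freeOnDup_map_counit _
    | succ i =>
      rw [degen_succ, face_succ]
      exact (freeOnMap_comp _ _).symm.trans
        ((congrArg freeOnMap (degen_face_succ A n i)).trans (freeOnMap_id _))

/-- Together with `degen_face_succ` this is the part of the simplicial identities needed to correct
faces one at a time from the highest index downwards. It follows by induction from naturality of the
comultiplication. -/
theorem degen_face_of_lt (A : GrAlg R) : ∀ (n : ℕ) (i : Fin n) (j : Fin (n + 1)),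
    i.castSucc < j → degen A (n + 1) i.castSucc ≫ face A (n + 1) j.succ = face A n j ≫ degen A n i
  | n + 1, i, j, hij => by
    induction j using Fin.cases with
    | zero => exact absurd hij (Fin.not_lt_zero _)
    | succ j =>
      induction i using Fin.cases with
      | zero => exact freeOnDup_naturality (face A n j)
      | succ i =>
        have h := congrArg freeOnMap (degen_face_of_lt A n i j (Fin.succ_lt_succ_iff.1 hij))
        rw [freeOnMap_comp, freeOnMap_comp] at h
        exact h

/-- A map of algebras, as a map of modules. -/
def homToMod (f : B ⟶ C) : B.toMod ⟶ C.toMod where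
  hom := f.hom
  map_smul r x := (f.map_mul (ap B.unit r) x).trans (by
    rw [f.map_unit]
    rfl)

variable (A)

/-- The faces of a simplex satisfy the simplicial identity. -/
theorem face_face_apply {n : ℕ} {i j : Fin (n + 1)} (hij : i ≤ j) {γ : Γ}
    (z : deg (bar A (n + 2)).obj γ) :
    ap (face A n i).hom (ap (face A (n + 1) j.succ).hom z) =
      ap (face A n j).hom (ap (face A (n + 1) i.castSucc).hom z) :=
  congrArg (fun f => ap (Hom.hom f) z) (face_face A n i j hij)

theorem degen_face_succ_apply {n : ℕ} (i : Fin n) {γ : Γ} (z : deg (bar A n).obj γ) :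
    ap (face A n i.succ).hom (ap (degen A n i).hom z) = z :=
  congrArg (fun f => ap (Hom.hom f) z) (degen_face_succ A n i)

theorem degen_face_of_lt_apply {n : ℕ} {i : Fin n} {j : Fin (n + 1)} (hij : i.castSucc < j) {γ : Γ}
    (z : deg (bar A (n + 1)).obj γ) :
    ap (face A (n + 1) j.succ).hom (ap (degen A (n + 1) i.castSucc).hom z) =
      ap (degen A n i).hom (ap (face A n j).hom z) :=
  congrArg (fun f => ap (Hom.hom f) z) (degen_face_of_lt A n i j hij)

/-- The generator attached to a simplex; this is an extra degeneracy that is not additive. -/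
def extraDegen (n : ℕ) {γ : Γ} (x : deg (bar A n).obj γ) : deg (bar A (n + 1)).obj γ :=
  FreeAlg.of (X := fun γ => deg (bar A n).obj γ) x

theorem face_zero_extraDegen (n : ℕ) {γ : Γ} (x : deg (bar A n).obj γ) :
    ap (face A n 0).hom (extraDegen A n x) = x := by
  rw [face_zero]
  rfl

theorem face_succ_extraDegen (n : ℕ) (i : Fin (n + 1)) {γ : Γ} (x : deg (bar A (n + 1)).obj γ) :
    ap (face A (n + 1) i.succ).hom (extraDegen A (n + 1) x) =
      extraDegen A n (ap (face A n i).hom x) := rfl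

variable {A}

/-- This is Moore's argument that simplicial groups satisfy the Kan condition, for the horn without
its zeroth face. Each graded degree of the resolution is a simplicial abelian group, augmented at
level `0`. -/
theorem exists_horn_filler {n : ℕ} {γ : Γ} (y : Fin (n + 2) → deg (bar A (n + 1)).obj γ)
    (hy : ∀ i j : Fin (n + 1), i ≤ j →
      ap (face A n i).hom (y j.succ) = ap (face A n j).hom (y i.castSucc)) :
    ∃ z : deg (bar A (n + 2)).obj γ, ∀ i : Fin (n + 1),
      ap (face A (n + 1) i.succ).hom z = y i.succ := by
  -- `t` counts the faces that are already correct, starting from the top one.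
  suffices H : ∀ t ≤ n + 1, ∃ z : deg (bar A (n + 2)).obj γ, ∀ i : Fin (n + 1), n + 1 - t ≤ i →
      ap (face A (n + 1) i.succ).hom z = y i.succ by
    obtain ⟨z, hz⟩ := H (n + 1) le_rfl
    exact ⟨z, fun i => hz i (by lia)⟩
  intro t
  induction t with
  | zero => exact fun _ => ⟨0, fun i hi => absurd i.isLt (by lia)⟩
  | succ t ih =>
    intro ht
    obtain ⟨z, hz⟩ := ih (by lia)
    have hk : n - t < n + 1 := by lia
    let k : Fin (n + 1) := ⟨n - t, hk⟩
    -- The degenerate correction repairs the face `k + 1`. It does not disturb the higher faces,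
    -- because there the error `y k.succ - d z` has zero face by the compatibility of `y`.
    refine ⟨z + ap (degen A (n + 1) k).hom (y k.succ - ap (face A (n + 1) k.succ).hom z),
      fun i hi => ?_⟩
    rw [map_add]
    rcases eq_or_lt_of_le (show k ≤ i from Fin.le_def.2 (by change n - t ≤ _; lia)) with h | h
    · subst h
      rw [degen_face_succ_apply, add_sub_cancel]
    · obtain ⟨l, hl⟩ : ∃ l : Fin n, l.castSucc = k :=
        ⟨⟨n - t, by have := Fin.lt_def.1 h; have := i.isLt; change n - t < _ at *; lia⟩, rfl⟩
      rw [← hl] at h ⊢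
      have hle : l.succ ≤ i := Fin.le_def.2 (by have := Fin.lt_def.1 h; simp at this ⊢; lia)
      rw [degen_face_of_lt_apply A h, hz i (by have := Fin.lt_def.1 h; rw [hl] at this; change n - t < _ at this; lia), map_sub]
      have h1 := hy _ _ hle
      have h2 := face_face_apply A hle z
      rw [hz i (by have := Fin.lt_def.1 h; rw [hl] at this; change n - t < _ at this; lia)] at h2
      rw [← Fin.castSucc_succ] at *
      rw [← h1, ← h2, sub_self, map_zero, add_zero]

/-- After the horn is filled, the error in the zeroth face is annihilated by all faces, so the
non-additive extra degeneracy can remove it without changing the other faces. -/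
theorem exists_sphere_filler {n : ℕ} {γ : Γ} (y : Fin (n + 2) → deg (bar A (n + 1)).obj γ)
    (hy : ∀ i j : Fin (n + 1), i ≤ j →
      ap (face A n i).hom (y j.succ) = ap (face A n j).hom (y i.castSucc)) :
    ∃ z : deg (bar A (n + 2)).obj γ, ∀ i : Fin (n + 2), ap (face A (n + 1) i).hom z = y i := by
  obtain ⟨z, hz⟩ := exists_horn_filler y hy
  have hv : ∀ i : Fin (n + 1),
      ap (face A n i).hom (y 0 - ap (face A (n + 1) 0).hom z) = 0 := fun i => by
    have h1 := hy 0 i (Fin.zero_le _)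
    have h2 := face_face_apply A (Fin.zero_le i) z
    rw [Fin.castSucc_zero] at h1 h2
    rw [map_sub, ← h1, ← h2, hz, sub_self]
  -- The generator `[0]` is not zero in the free algebra; subtracting it makes the positive faces
  -- `[0] - [0]` of the correction vanish.
  refine ⟨z + (extraDegen A (n + 1) (y 0 - ap (face A (n + 1) 0).hom z) -
    extraDegen A (n + 1) 0), fun i => ?_⟩
  rw [map_add, map_sub]
  induction i using Fin.cases with
  | zero => rw [face_zero_extraDegen, face_zero_extraDegen, sub_zero, add_sub_cancel]
  | succ i =>
    rw [face_succ_extraDegen, face_succ_extraDegen, hv, map_zero, sub_self, add_zero, hz]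

/-- The conditions on a linear map `σ` under which the next linear extra degeneracy exists. -/
structure IsExtraDegen (n : ℕ) (σ : (bar A n).toMod ⟶ (bar A (n + 1)).toMod) : Prop where
  face_zero : ∀ {γ : Γ} (x : deg (bar A n).obj γ), ap (face A n 0).hom (ap σ.hom x) = x
  face_succ : ∀ {γ : Γ} (x : deg (bar A (n + 1)).obj γ) (i : Fin n) (j : Fin (n + 1)),
    i.castSucc < j → ap (face A n i.succ).hom (ap σ.hom (ap (face A n j).hom x)) =
      ap (face A n j).hom (ap σ.hom (ap (face A n i.castSucc).hom x))

/-- The map `x ↦ [x]` splits the counit but is not additive; it becomes linear after extension to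
the free module on the elements of `A`, and then a linear section of that module onto `A` is
composed with it. -/
theorem exists_isExtraDegen_zero (h : IsRetractOfFree (bar A 0).toMod) :
    ∃ σ : (bar A 0).toMod ⟶ (bar A 1).toMod, IsExtraDegen 0 σ := by
  obtain ⟨s, hs⟩ := h
  refine ⟨s ≫ FreeMod.lift fun _ x => extraDegen A 0 x, ⟨fun {γ} x => ?_, fun x i => i.elim0⟩⟩
  have e : FreeMod.lift (R := R) (Y := (bar A 1).toMod) (fun _ x => extraDegen A 0 x) ≫
      homToMod (face A 0 0) = FreeMod.lift (Y := (bar A 0).toMod) (fun _ m => m) := FreeMod.hom_ext fun _ _ => rfl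
  rw [← e] at hs
  exact congrArg (fun f => ap (GrMod.Hom.hom f) x) hs

/-- The required faces of `τ(x)` are `x, σ(d₀ x), …, σ(dₙ x)`. The conditions in `IsExtraDegen` say
exactly that these form a sphere, so each `x` has a filler. The choice of fillers is made linear by
extending it to the free module on all `x` and restricting along the section. -/
theorem IsExtraDegen.exists_succ {n : ℕ} (h : IsRetractOfFree (bar A (n + 1)).toMod)
    {σ : (bar A n).toMod ⟶ (bar A (n + 1)).toMod} (hσ : IsExtraDegen n σ) :
    ∃ τ : (bar A (n + 1)).toMod ⟶ (bar A (n + 2)).toMod, IsExtraDegen (n + 1) τ ∧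
      ∀ {γ : Γ} (i : Fin (n + 1)) (x : deg (bar A (n + 1)).obj γ),
        ap (face A (n + 1) i.succ).hom (ap τ.hom x) = ap σ.hom (ap (face A n i).hom x) := by
  have H : ∀ (γ : Γ) (x : deg (bar A (n + 1)).obj γ), ∃ z : deg (bar A (n + 2)).obj γ,
      ap (face A (n + 1) 0).hom z = x ∧ ∀ i : Fin (n + 1),
        ap (face A (n + 1) i.succ).hom z = ap σ.hom (ap (face A n i).hom x) := fun γ x => by
    obtain ⟨z, hz⟩ := exists_sphere_filler (A := A) (n := n)
      (fun i => Fin.cases (motive := fun _ => deg (bar A (n + 1)).obj γ) x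
        (fun i => ap σ.hom (ap (face A n i).hom x)) i) fun i j hij => by
      induction i using Fin.cases with
      | zero => exact hσ.face_zero _
      | succ i =>
        exact hσ.face_succ x i j (Fin.castSucc_lt_iff_succ_le.2 hij)
    exact ⟨z, hz 0, fun i => hz i.succ⟩
  choose v hv0 hv using H
  obtain ⟨s, hs⟩ := h
  have e0 : FreeMod.lift (R := R) (Y := (bar A (n + 2)).toMod) v ≫ homToMod (face A (n + 1) 0) =
      FreeMod.lift (Y := (bar A (n + 1)).toMod) (fun _ m => m) := FreeMod.hom_ext fun γ x => hv0 γ x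
  have e : ∀ i : Fin (n + 1), FreeMod.lift (R := R) (Y := (bar A (n + 2)).toMod) v ≫
      homToMod (face A (n + 1) i.succ) =
      FreeMod.lift (Y := (bar A (n + 1)).toMod) (fun _ m => m) ≫ homToMod (face A n i) ≫ σ := fun i =>
    FreeMod.hom_ext fun γ x => hv γ x i
  have k0 : ∀ {γ : Γ} (x : deg (bar A (n + 1)).obj γ),
      ap (face A (n + 1) 0).hom (ap (s ≫ FreeMod.lift (Y := (bar A (n + 2)).toMod) v).hom x) = x := fun x => by
    have := hs
    rw [← e0] at this
    exact congrArg (fun f => ap (GrMod.Hom.hom f) x) this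
  have k : ∀ {γ : Γ} (i : Fin (n + 1)) (x : deg (bar A (n + 1)).obj γ),
      ap (face A (n + 1) i.succ).hom (ap (s ≫ FreeMod.lift (Y := (bar A (n + 2)).toMod) v).hom x) =
        ap σ.hom (ap (face A n i).hom x) := fun i x => by
    have := congrArg (fun f => s ≫ f) (e i)
    simp only [← Category.assoc] at this
    rw [hs, Category.id_comp] at this
    exact congrArg (fun f => ap (GrMod.Hom.hom f) x) this
  refine ⟨s ≫ FreeMod.lift (Y := (bar A (n + 2)).toMod) v, ⟨k0, fun x i j hij => ?_⟩, k⟩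
  induction j using Fin.cases with
  | zero => exact absurd hij (Fin.not_lt_zero _)
  | succ j =>
    rw [k, k, face_face_apply A (Fin.castSucc_lt_succ_iff.1 hij)]

theorem exists_extraDegen (h : ∀ n, IsRetractOfFree (bar A n).toMod) :
    ∃ σ : ∀ n, (bar A n).toMod ⟶ (bar A (n + 1)).toMod,
      (∀ (n : ℕ) {γ : Γ} (x : deg (bar A n).obj γ),
        ap (face A n 0).hom (ap (σ n).hom x) = x) ∧
      ∀ (n : ℕ) {γ : Γ} (i : Fin (n + 1)) (x : deg (bar A (n + 1)).obj γ),
        ap (face A (n + 1) i.succ).hom (ap (σ (n + 1)).hom x) =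
          ap (σ n).hom (ap (face A n i).hom x) := by
  obtain ⟨σ₀, h₀⟩ := exists_isExtraDegen_zero (h 0)
  choose τ hτ hτ' using fun (n : ℕ)
    (s : {σ : (bar A n).toMod ⟶ (bar A (n + 1)).toMod // IsExtraDegen n σ}) =>
      s.2.exists_succ (h (n + 1))
  let S : ∀ n, {σ : (bar A n).toMod ⟶ (bar A (n + 1)).toMod // IsExtraDegen n σ} := fun n =>
    Nat.rec ⟨σ₀, h₀⟩ (fun n s => ⟨τ n s, hτ n s⟩) n
  exact ⟨fun n => (S n).1, fun n _ x => (S n).2.face_zero x, fun n _ i x => hτ' n (S n) i x⟩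

end GrAlg

/-- The map from `R` determined by an element of degree `𝟙_ Γ`. -/
def GrMod.ofElement (M : GrMod R) (c : deg M.obj (𝟙_ Γ)) : scalars R ⟶ M where
  hom := mkHom (M := R.obj) (fun γ => (res M.obj (ρ_ γ).inv).comp (M.smul.app.flip c))
    fun {α β} g r => by
      change res M.obj _ (M.smul.app (res R.obj g r) c) = res M.obj g (res M.obj _ (M.smul.app r c))
      rw [M.smul.res_left, ← res_comp, ← res_comp, rightUnitor_inv_naturality]
  map_smul {α β} r (s : deg R.obj β) := by
    change res M.obj _ (M.smul.app (R.mul.app r s) c) =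
      M.smul.app r (res M.obj (ρ_ β).inv (M.smul.app s c))
    rw [M.mul_smul, M.smul.res_right, ← res_comp]
    refine res_congr _ ?_ _
    change (ρ_ (α ⊗ β)).inv ≫ _ = _
    simp

theorem GrMod.ofElement_one (M : GrMod R) (c : deg M.obj (𝟙_ Γ)) :
    ap (M.ofElement c).hom (γ := 𝟙_ Γ) R.one = c := by
  change res M.obj (ρ_ (𝟙_ Γ)).inv (M.smul.app R.one c) = c
  rw [M.one_smul, ← res_comp]
  exact res_eq_self _ (by rw [unitors_equal]; simp) _

theorem GrMod.ofElement_comp {M N : GrMod R} (c : deg M.obj (𝟙_ Γ)) (f : M ⟶ N) :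
    M.ofElement c ≫ f = N.ofElement (ap f.hom c) :=
  GrMod.hom_ext fun γ (r : deg R.obj γ) => by
    change ap f.hom (res M.obj (ρ_ γ).inv (M.smul.app r c)) =
      res N.obj (ρ_ γ).inv (N.smul.app r (ap f.hom c))
    rw [ap_res, f.map_smul]

theorem GrMod.ofElement_zero (M : GrMod R) : M.ofElement 0 = 0 :=
  GrMod.hom_ext fun γ (r : deg R.obj γ) => by
    change res M.obj (ρ_ γ).inv (M.smul.app r 0) = 0
    rw [map_zero, map_zero]

namespace GrAlg
variable {A : GrAlg R}

/-- Add to `σ n` the rank one map `x ↦ ε(x) c`, where `c = 1 - σ(1)` and `ε` is the augmentation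
followed by `g`. As `ε(1) = 1`, the new map preserves `1`. The identities survive because `ε` is
compatible with the faces, the zeroth face kills `c`, and the other faces carry each `c` to the
preceding one. -/
theorem exists_unital_extraDegen (h : ∀ n, IsRetractOfFree (bar A n).toMod)
    (g : A.toMod ⟶ GrMod.scalars R) (hg : ap g.hom A.one = R.one) :
    ∃ σ : ∀ n, (bar A n).toMod ⟶ (bar A (n + 1)).toMod,
      (∀ (n : ℕ) {γ : Γ} (x : deg (bar A n).obj γ),
        ap (face A n 0).hom (ap (σ n).hom x) = x) ∧
      (∀ (n : ℕ) {γ : Γ} (i : Fin (n + 1)) (x : deg (bar A (n + 1)).obj γ),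
        ap (face A (n + 1) i.succ).hom (ap (σ (n + 1)).hom x) =
          ap (σ n).hom (ap (face A n i).hom x)) ∧
      ∀ n, ap (σ n).hom (bar A n).one = (bar A (n + 1)).one := by
  obtain ⟨σ, h0, hs⟩ := exists_extraDegen h
  let ε : ∀ n, (bar A n).toMod ⟶ GrMod.scalars R := fun n => homToMod (augmentation A n) ≫ g
  have hε : ∀ n, ap (ε n).hom (bar A n).one = R.one := fun n => by
    change ap g.hom (ap (augmentation A n).hom (bar A n).one) = _
    rw [(augmentation A n).map_one, hg]
  have hεf : ∀ (n : ℕ) (i : Fin (n + 1)) {γ : Γ} (x : deg (bar A (n + 1)).obj γ),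
      ap (ε n).hom (ap (face A n i).hom x) = ap (ε (n + 1)).hom x := fun n i γ x =>
    congrArg (fun f => ap g.hom (ap (Hom.hom f) x)) (face_augmentation A n i)
  let c : ∀ n, deg (bar A (n + 1)).obj (𝟙_ Γ) := fun n =>
    (bar A (n + 1)).one - ap (σ n).hom (bar A n).one
  let e : ∀ n, (bar A n).toMod ⟶ (bar A (n + 1)).toMod := fun n =>
    ε n ≫ (bar A (n + 1)).toMod.ofElement (c n)
  have key : ∀ {n m : ℕ} (f : bar A (n + 1) ⟶ bar A m) {γ : Γ} (x : deg (bar A n).obj γ),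
      ap f.hom (ap (e n).hom x) =
        ap ((bar A m).toMod.ofElement (ap f.hom (c n))).hom (ap (ε n).hom x) := fun {n m} f γ x =>
    congrArg (fun k => ap (GrMod.Hom.hom k) (ap (ε n).hom x))
      (GrMod.ofElement_comp (M := (bar A (n + 1)).toMod) (c n) (homToMod f))
  refine ⟨fun n => σ n + e n, fun n γ x => ?_, fun n γ i x => ?_, fun n => ?_⟩
  · have hc : ap (face A n 0).hom (c n) = 0 := by
      rw [map_sub, h0, (face A n 0).map_one, sub_self]
    rw [GrMod.add_apply, map_add, h0, key, hc, GrMod.ofElement_zero]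
    exact add_zero x
  · have hc : ap (face A (n + 1) i.succ).hom (c (n + 1)) = c n := by
      rw [map_sub, hs, (face A (n + 1) i.succ).map_one, (face A n i).map_one]
    rw [GrMod.add_apply, map_add, hs, key, hc, ← hεf n i, GrMod.add_apply]
    rfl
  · have he : ap (e n).hom (bar A n).one = c n := by
      refine Eq.trans ?_ ((bar A (n + 1)).toMod.ofElement_one (c n))
      exact congrArg (ap ((bar A (n + 1)).toMod.ofElement (c n)).hom) (hε n)
    rw [GrMod.add_apply, he]
    exact add_sub_cancel _ _

end GrAlg

end
end PicGraded

/-! ### The bimodule `coind N` and the dimension shift for derivations. -/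

namespace PicGraded

section
variable {Γ : Type u} [Category.{u} Γ] [MonoidalCategory Γ] [SymmetricCategory Γ]
variable {R : GrCommRing Γ}

theorem braiding_whiskerRight_cancel (α β γ : Γ) :
    (β_ α β).hom ▷ γ ≫ (β_ β α).hom ▷ γ = 𝟙 ((α ⊗ β) ⊗ γ) := by
  rw [← comp_whiskerRight, SymmetricCategory.symmetry, id_whiskerRight]

/-- The underlying `R`-module of a bimodule. -/
@[reducible] def GrBimod.toMod {A : GrAlg R} (N : GrBimod A) : GrMod R where
  obj := N.obj
  smul :=
    { app := N.left.app.comp (ap A.unit)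
      app_res := fun f g r a => by
        change N.left.app (ap A.unit (res R.obj f r)) _ = res _ _ (N.left.app (ap A.unit r) a)
        rw [ap_res, N.left.app_res] }
  one_smul a := by
    change N.left.app (ap A.unit R.one) a = _
    rw [A.unit_one, N.one_left]
  mul_smul r s a := by
    change N.left.app (ap A.unit (R.mul.app r s)) a = res _ _ (N.left.app _ (N.left.app _ a))
    rw [A.unit_mul, N.mul_left]

theorem GrBimod.mul_left' {A : GrAlg R} (N : GrBimod A) {α β γ : Γ} (a : deg A.obj α)
    (b : deg A.obj β) (n : deg N.obj γ) : N.left.app a (N.left.app b n) =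
      res N.obj (α_ α β γ).inv (N.left.app (A.mul.app a b) n) := by
  rw [N.mul_left, ← res_comp, Iso.inv_hom_id, res_id]

namespace Coind
variable {B : GrAlg R} (N : GrBimod B)

/-- The `R`-linear maps `B → N` of degree `γ` that vanish at `1`. -/
def carrier (γ : Γ) : AddSubgroup (deg (RHom B.toMod N.toMod) γ) where
  carrier := {φ | RHom.ev (X := B.toMod) (Y := N.toMod) φ B.one = 0}
  zero_mem' := rfl
  add_mem' {φ ψ} h h' := by
    change RHom.ev (X := B.toMod) (Y := N.toMod) φ B.one +
      RHom.ev (X := B.toMod) (Y := N.toMod) ψ B.one = 0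
    rw [h, h', add_zero]
  neg_mem' {φ} h := by
    change -RHom.ev (X := B.toMod) (Y := N.toMod) φ B.one = 0
    rw [h, neg_zero]

def grAb : GrAb Γ where
  obj γ := AddCommGrpCat.of (carrier N γ.unop)
  map f := AddCommGrpCat.ofHom
    (((res (RHom B.toMod N.toMod) f.unop).comp (carrier N _).subtype).codRestrict (carrier N _)
      fun φ => (congrArg (res N.obj (𝟙_ Γ ◁ f.unop)) φ.2).trans (map_zero _))
  map_id γ := by
    ext m
    exact res_id (RHom B.toMod N.toMod) m.1
  map_comp f g := by
    ext m
    exact res_comp (RHom B.toMod N.toMod) g.unop f.unop m.1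

variable {N} {γ : Γ}

/-- The value of `φ` at an element of degree `δ`. -/
def ev (φ : deg (grAb N) γ) {δ : Γ} : deg B.obj δ →+ deg N.obj (δ ⊗ γ) :=
  RHom.ev (X := B.toMod) (Y := N.toMod) (show carrier N γ from φ).1

theorem ext {φ ψ : deg (grAb N) γ} (h : ∀ (δ : Γ) (x : deg B.obj δ), ev φ x = ev ψ x) : φ = ψ :=
  Subtype.ext (RHom.ext h)

theorem ev_add (φ ψ : deg (grAb N) γ) {δ : Γ} (x : deg B.obj δ) :
    ev (φ + ψ) x = ev φ x + ev ψ x := rfl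

theorem ev_sub (φ ψ : deg (grAb N) γ) {δ : Γ} (x : deg B.obj δ) :
    ev (φ - ψ) x = ev φ x - ev ψ x := rfl

theorem ev_of_res {γ' : Γ} (g : γ' ⟶ γ) (φ : deg (grAb N) γ) {δ : Γ} (x : deg B.obj δ) :
    ev (res (grAb N) g φ) x = res N.obj (δ ◁ g) (ev φ x) := rfl

theorem ev_res (φ : deg (grAb N) γ) {δ ε : Γ} (f : δ ⟶ ε) (x : deg B.obj ε) :
    ev φ (res B.obj f x) = res N.obj (f ▷ γ) (ev φ x) :=
  RHom.ev_res (X := B.toMod) (Y := N.toMod) _ f x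

theorem ev_unit_mul (φ : deg (grAb N) γ) {α δ : Γ} (r : deg R.obj α) (x : deg B.obj δ) :
    ev φ (B.mul.app (ap B.unit r) x) =
      res N.obj (α_ α δ γ).hom (N.left.app (ap B.unit r) (ev φ x)) :=
  RHom.ev_smul (X := B.toMod) (Y := N.toMod) _ r x

theorem ev_one (φ : deg (grAb N) γ) : ev φ B.one = 0 := (show carrier N γ from φ).2

theorem ev_unit (φ : deg (grAb N) γ) {α : Γ} (r : deg R.obj α) : ev φ (ap B.unit r) = 0 := by
  have h : ap B.unit r = res B.obj (ρ_ α).inv (B.mul.app (ap B.unit r) B.one) := by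
    rw [B.mul_one, ← res_comp, Iso.inv_hom_id, res_id]
  rw [h, ev_res, ev_unit_mul, ev_one, map_zero, map_zero, map_zero]

theorem ev_mul_unit (φ : deg (grAb N) γ) {α δ : Γ} (r : deg R.obj α) (x : deg B.obj δ) :
    ev φ (B.mul.app x (ap B.unit r)) =
      res N.obj ((α_ δ α γ).hom ≫ swap δ α γ) (N.left.app (ap B.unit r) (ev φ x)) := by
  rw [B.mul_unit, ev_res, ev_unit_mul, ← res_comp]
  refine res_congr _ ?_ _
  simp [swap]

/-- Constructor. -/
def mk (f : ∀ δ : Γ, deg B.obj δ →+ deg N.obj (δ ⊗ γ))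
    (hf : ∀ {δ ε : Γ} (g : δ ⟶ ε) (x : deg B.obj ε), f δ (res B.obj g x) =
      res N.obj (g ▷ γ) (f ε x))
    (hs : ∀ {α δ : Γ} (r : deg R.obj α) (x : deg B.obj δ), f _ (B.mul.app (ap B.unit r) x) =
      res N.obj (α_ α δ γ).hom (N.left.app (ap B.unit r) (f δ x)))
    (h1 : f _ B.one = 0) : deg (grAb N) γ :=
  show carrier N γ from ⟨RHom.mk (X := B.toMod) (Y := N.toMod) f hf hs, h1⟩

/-- The left action `(x)(b φ) = (x b)φ - x ((b)φ)`. -/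
def left {β : Γ} (b : deg B.obj β) (φ : deg (grAb N) γ) : deg (grAb N) (β ⊗ γ) :=
  mk (fun δ => (res N.obj (α_ δ β γ).inv).comp ((ev φ).comp (B.mul.app.flip b)) -
      N.left.app.flip (ev φ b))
    (fun {δ ε} g x => by
      change res N.obj _ (ev φ (B.mul.app _ b)) - N.left.app _ (ev φ b) =
        res N.obj _ (res N.obj _ (ev φ (B.mul.app x b)) - N.left.app x (ev φ b))
      rw [B.mul.res_left, ev_res, N.left.res_left, map_sub, ← res_comp, ← res_comp]
      refine congrArg₂ _ (res_congr _ ?_ _) rfl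
      simp)
    (fun {α δ} r x => by
      change res N.obj _ (ev φ (B.mul.app _ b)) - N.left.app _ (ev φ b) =
        res N.obj _ (N.left.app _ (res N.obj _ (ev φ (B.mul.app x b)) - N.left.app x (ev φ b)))
      rw [B.mul_assoc, ev_res, ev_unit_mul, N.mul_left, map_sub, map_sub, N.left.res_right,
        ← res_comp, ← res_comp, ← res_comp]
      refine congrArg₂ _ (res_congr _ ?_ _) rfl
      simp)
    (by
      change res N.obj _ (ev φ (B.mul.app _ b)) - N.left.app _ (ev φ b) = 0
      rw [B.one_mul, ev_res, N.one_left, ← res_comp, sub_eq_zero]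
      refine res_congr _ ?_ _
      simp)

theorem ev_left {β δ : Γ} (b : deg B.obj β) (φ : deg (grAb N) γ) (x : deg B.obj δ) :
    ev (left b φ) x =
      res N.obj (α_ δ β γ).inv (ev φ (B.mul.app x b)) - N.left.app x (ev φ b) := rfl

/-- The right action `(x)(φ b) = ((x)φ) b`. -/
def right {β : Γ} (φ : deg (grAb N) γ) (b : deg B.obj β) : deg (grAb N) (γ ⊗ β) :=
  mk (fun δ => (res N.obj (α_ δ γ β).inv).comp ((N.right.app.flip b).comp (ev φ)))
    (fun {δ ε} g x => by
      change res N.obj _ (N.right.app (ev φ _) b) =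
        res N.obj _ (res N.obj _ (N.right.app (ev φ x) b))
      rw [ev_res, N.right.res_left, ← res_comp, ← res_comp]
      refine res_congr _ ?_ _
      simp)
    (fun {α δ} r x => by
      change res N.obj _ (N.right.app (ev φ _) b) =
        res N.obj _ (N.left.app _ (res N.obj _ (N.right.app (ev φ x) b)))
      rw [ev_unit_mul, N.right.res_left, N.left_right, N.left.res_right, ← res_comp, ← res_comp,
        ← res_comp]
      refine res_congr _ ?_ _
      simp)
    (by
      change res N.obj _ (N.right.app (ev φ _) b) = 0
      rw [ev_one, map_zero, AddMonoidHom.zero_apply, map_zero])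

theorem ev_right {β δ : Γ} (φ : deg (grAb N) γ) (b : deg B.obj β) (x : deg B.obj δ) :
    ev (right φ b) x = res N.obj (α_ δ γ β).inv (N.right.app (ev φ x) b) := rfl

def leftPairing (N : GrBimod B) : Pairing B.obj (grAb N) (grAb N) where
  app {α β} := AddMonoidHom.mk' (fun b => AddMonoidHom.mk' (fun φ => left b φ) fun φ ψ =>
      ext fun δ x => by
        simp only [ev_add, ev_left, map_add]
        abel) fun b c => AddMonoidHom.ext fun φ => ext fun δ x => by
      change ev (left (b + c) φ) x = ev (left b φ) x + ev (left c φ) x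
      simp only [ev_left, map_add]
      abel
  app_res f g b φ := ext fun δ x => by
    change ev (left (res _ f b) (res _ g φ)) x = ev (res _ _ (left b φ)) x
    rw [ev_of_res, ev_left, ev_left, ev_of_res, ev_of_res, B.mul.res_right, ev_res, ev_res,
      N.left.res_right, N.left.res_right, map_sub]
    simp only [← res_comp]
    refine congrArg₂ _ (res_congr _ ?_ _) (res_congr _ ?_ _)
    · simp [MonoidalCategory.tensorHom_def']
    · simp [MonoidalCategory.tensorHom_def']

def rightPairing (N : GrBimod B) : Pairing (grAb N) B.obj (grAb N) where
  app {α β} := AddMonoidHom.mk' (fun φ => AddMonoidHom.mk' (fun b => right φ b) fun b c =>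
      ext fun δ x => by simp only [ev_add, ev_right, map_add]) fun φ ψ =>
      AddMonoidHom.ext fun b => ext fun δ x => by
      change ev (right (φ + ψ) b) x = ev (right φ b) x + ev (right ψ b) x
      simp only [ev_right, ev_add, map_add, AddMonoidHom.add_apply]
  app_res f g φ b := ext fun δ x => by
    change ev (right (res _ f φ) (res _ g b)) x = ev (res _ _ (right φ b)) x
    rw [ev_of_res, ev_right, ev_right, ev_of_res, N.right.res_left, N.right.res_right]
    simp only [← res_comp]
    refine res_congr _ ?_ _
    simp [MonoidalCategory.tensorHom_def]

end Coind

/-- The bimodule of `R`-linear maps `B → N` that vanish at `1`. -/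
def coind {B : GrAlg R} (N : GrBimod B) : GrBimod B where
  obj := Coind.grAb N
  left := Coind.leftPairing N
  right := Coind.rightPairing N
  one_left φ := Coind.ext fun δ x => by
    change Coind.ev (Coind.left B.one φ) x = _
    rw [Coind.ev_left, Coind.ev_one, map_zero, sub_zero, B.mul_one, Coind.ev_res, Coind.ev_of_res,
      ← res_comp]
    refine res_congr _ ?_ _
    simp
  mul_left a b φ := Coind.ext fun δ x => by
    change Coind.ev (Coind.left _ φ) x = Coind.ev (res _ _ (Coind.left a (Coind.left b φ))) x
    simp only [Coind.ev_left, Coind.ev_of_res, map_sub, B.mul_assoc', N.mul_left',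
      Coind.ev_res, N.left.res_right, ← res_comp]
    -- Expanding `a (b φ)` at `x` gives `(x a b)φ - x a ((b)φ) - (x ((a b)φ) - x a ((b)φ))`; the
    -- middle terms cancel.
    rw [sub_sub_sub_cancel_right]
    refine congrArg₂ _ (res_congr _ ?_ _) (Eq.symm (res_eq_self _ ?_ _))
    · simp
    · simp
  right_one φ := Coind.ext fun δ x => by
    change Coind.ev (Coind.right φ B.one) x = _
    rw [Coind.ev_right, N.right_one, Coind.ev_of_res, ← res_comp]
    refine res_congr _ ?_ _
    simp
  right_mul φ a b := Coind.ext fun δ x => by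
    change Coind.ev (Coind.right (Coind.right φ a) b) x = Coind.ev (res _ _ (Coind.right φ _)) x
    rw [Coind.ev_of_res, Coind.ev_right, Coind.ev_right, Coind.ev_right, N.right.res_left,
      N.right_mul, ← res_comp, ← res_comp, ← res_comp]
    refine res_congr _ ?_ _
    simp
  left_right a φ b := Coind.ext fun δ x => by
    change Coind.ev (Coind.right (Coind.left a φ) b) x =
      Coind.ev (res _ _ (Coind.left a (Coind.right φ b))) x
    rw [Coind.ev_of_res, Coind.ev_right, Coind.ev_left, Coind.ev_left, Coind.ev_right,
      Coind.ev_right]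
    simp only [map_sub, AddMonoidHom.sub_apply, N.right.res_left, N.left_right, N.left.res_right,
      ← res_comp]
    refine congrArg₂ _ (res_congr _ ?_ _) (res_congr _ ?_ _)
    · simp
    · simp
  unit_central r φ := Coind.ext fun δ x => by
    change Coind.ev (Coind.left _ φ) x = Coind.ev (res _ _ (Coind.right φ _)) x
    -- The correction term of the left action vanishes for scalars, since `φ` is `R`-linear and
    -- kills `1`.
    rw [Coind.ev_of_res, Coind.ev_right, Coind.ev_left, Coind.ev_unit, map_zero, sub_zero,
      Coind.ev_mul_unit, N.unit_central]
    simp only [← res_comp]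
    refine res_congr _ ?_ _
    have h := braiding_whiskerRight_cancel δ
    simp [swap, reassoc_of% h]

theorem Der.map_one {B : GrAlg R} {N : GrBimod B} (D : Der (𝟙 B) N) : ap D.1 B.one = 0 := by
  have h := Der.map_mul D B.one B.one
  rw [B.one_mul, N.one_left, N.right_one, ap_res, unitors_equal, ← map_add] at h
  have h' := congrArg (res N.obj (ρ_ (𝟙_ Γ)).inv) h
  rw [← res_comp, ← res_comp, Iso.inv_hom_id, res_id, res_id] at h'
  simpa using h'

theorem Der.map_unit {B : GrAlg R} {N : GrBimod B} (D : Der (𝟙 B) N) {α : Γ} (r : deg R.obj α) :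
    ap D.1 (ap B.unit r) = 0 := by
  have h : ap B.unit r = res B.obj (ρ_ α).inv (B.mul.app (ap B.unit r) B.one) := by
    rw [B.mul_one, ← res_comp, Iso.inv_hom_id, res_id]
  rw [h, ap_res, Der.map_unit_mul D, Der.map_one D, map_zero, map_zero]

namespace Coind
variable {B : GrAlg R} {N : GrBimod B}

/-- An `R`-linear map that vanishes at `1`, as an element of degree `𝟙_ Γ`. -/
def ofLinear (ψ : B.obj ⟶ N.obj)
    (hs : ∀ {α δ : Γ} (r : deg R.obj α) (x : deg B.obj δ),
      ap ψ (B.mul.app (ap B.unit r) x) = N.left.app (ap B.unit r) (ap ψ x))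
    (h1 : ap ψ B.one = 0) : deg (grAb N) (𝟙_ Γ) :=
  mk (fun δ => (res N.obj (ρ_ δ).hom).comp (ap ψ))
    (fun {δ ε} g x => by
      change res N.obj _ (ap ψ (res B.obj g x)) = res N.obj _ (res N.obj _ (ap ψ x))
      rw [ap_res, ← res_comp, ← res_comp]
      refine res_congr _ ?_ _
      simp)
    (fun {α δ} r x => by
      change res N.obj _ (ap ψ (B.mul.app _ x)) =
        res N.obj _ (N.left.app _ (res N.obj _ (ap ψ x)))
      rw [hs, N.left.res_right, ← res_comp]
      refine res_congr _ ?_ _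
      simp)
    (by
      change res N.obj _ (ap ψ B.one) = 0
      rw [h1, map_zero])

theorem ev_ofLinear (ψ : B.obj ⟶ N.obj)
    (hs : ∀ {α δ : Γ} (r : deg R.obj α) (x : deg B.obj δ),
      ap ψ (B.mul.app (ap B.unit r) x) = N.left.app (ap B.unit r) (ap ψ x))
    (h1 : ap ψ B.one = 0) {δ : Γ} (x : deg B.obj δ) :
    ev (ofLinear ψ hs h1) x = res N.obj (ρ_ δ).hom (ap ψ x) := rfl

/-- A derivation, as an `R`-linear map that vanishes at `1`. -/
def ofDer (N : GrBimod B) : Der (𝟙 B) N →+ deg (grAb N) (𝟙_ Γ) :=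
  AddMonoidHom.mk' (fun D => ofLinear D.1 (Der.map_unit_mul D) (Der.map_one D))
    fun D E => ext fun δ x => map_add (res N.obj (ρ_ δ).hom) _ _

theorem ev_ofDer (D : Der (𝟙 B) N) {δ : Γ} (x : deg B.obj δ) :
    ev (ofDer N D) x = res N.obj (ρ_ δ).hom (ap D.1 x) := rfl

/-- The value is the Leibniz defect `φ(x b) - x φ(b) - φ(x) b`, so the inner derivation of a cochain
is its Hochschild coboundary up to sign. This identifies the kernel of `Der.inner` on `coind N` with
the derivations into `N`. -/
theorem ev_inner (φ : deg (grAb N) (𝟙_ Γ)) {β δ : Γ} (b : deg B.obj β) (x : deg B.obj δ) :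
    ev (N := N) (ap (Der.inner (coind N) φ).1 b) x =
      res N.obj (ρ_ (δ ⊗ β)).inv (ev φ (B.mul.app x b)) -
        N.left.app x (res N.obj (ρ_ β).inv (ev φ b)) -
        N.right.app (res N.obj (ρ_ δ).inv (ev φ x)) b := by
  change ev (N := N) (res (grAb N) (ρ_ β).inv (left b φ) - res (grAb N) (λ_ β).inv (right φ b)) x = _
  rw [ev_sub, ev_of_res, ev_of_res, ev_left, ev_right, map_sub, N.left.res_right,
    N.right.res_left, ← res_comp, ← res_comp]
  refine congrArg₂ _ (congrArg₂ _ (res_congr _ ?_ _) rfl) (res_congr _ ?_ _)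
  · simp
  · simp

theorem inner_ofDer (D : Der (𝟙 B) N) : Der.inner (coind N) (ofDer N D) = 0 := by
  refine Subtype.ext (PicGraded.hom_ext fun β b => ext fun δ x => ?_)
  change ev (N := N) (ap (Der.inner (coind N) (ofDer N D)).1 b) x = 0
  rw [ev_inner, ev_ofDer, ev_ofDer, ev_ofDer]
  simp only [← res_comp, Iso.inv_hom_id, res_id]
  rw [Der.map_mul D]
  abel

/-- By `ev_inner` the Leibniz defect of `φ` vanishes; removing the factor `𝟙_ Γ` from the degrees
leaves a derivation. -/
theorem exists_ofDer_eq (φ : deg (grAb N) (𝟙_ Γ)) (h : Der.inner (coind N) φ = 0) :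
    ∃ D, ofDer N D = φ := by
  have key : ∀ {β δ : Γ} (b : deg B.obj β) (x : deg B.obj δ),
      res N.obj (ρ_ (δ ⊗ β)).inv (ev φ (B.mul.app x b)) =
        N.left.app x (res N.obj (ρ_ β).inv (ev φ b)) +
        N.right.app (res N.obj (ρ_ δ).inv (ev φ x)) b := fun {β δ} b x => by
    have := ev_inner φ b x
    rw [h] at this
    rw [← sub_eq_zero, ← sub_sub]
    exact this.symm
  refine ⟨⟨mkHom (fun δ => (res N.obj (ρ_ δ).inv).comp (ev φ)) fun {δ ε} g x => ?_,
    fun {α β} r x => ?_, fun {α β} x y => ?_⟩, ext fun δ x => ?_⟩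
  · change res N.obj _ (ev φ _) = res N.obj _ (res N.obj _ (ev φ x))
    rw [ev_res, ← res_comp, ← res_comp]
    refine res_congr _ ?_ _
    simp
  · change res N.obj _ (ev φ _) = N.left.app _ (res N.obj _ (ev φ x))
    rw [ev_unit_mul, N.left.res_right, ← res_comp]
    refine res_congr _ ?_ _
    simp
  · exact key y x
  · change res N.obj (ρ_ δ).hom (res N.obj (ρ_ δ).inv (ev φ x)) = _
    rw [← res_comp, Iso.hom_inv_id, res_id]

theorem ofDer_injective (N : GrBimod B) : Function.Injective (ofDer N) := fun D E h => by
  refine Subtype.ext (PicGraded.hom_ext fun δ x => ?_)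
  have := congrArg (fun φ => res N.obj (ρ_ δ).inv (ev φ x)) h
  simpa only [ev_ofDer, ← res_comp, Iso.inv_hom_id, res_id] using this

end Coind

end
end PicGraded

/-! ### Square zero extensions and derivations of free algebras. -/

namespace PicGraded

section
variable {Γ : Type u} [Category.{u} Γ] [MonoidalCategory Γ] [SymmetricCategory Γ]
variable {R : GrCommRing Γ}

namespace SqZero
variable {B : GrAlg R} {N : GrBimod B}

/-- The `2`-cocycle of a derivation with values in `coind N`. -/
def cocycle (E : Der (𝟙 B) (coind N)) {α β : Γ} :
    deg B.obj α →+ deg B.obj β →+ deg N.obj (α ⊗ β) :=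
  AddMonoidHom.mk' (fun x => AddMonoidHom.mk'
      (fun y => Coind.ev (N := N) (ap E.1 y) x) fun y z => by
        rw [map_add]
        rfl) fun x y => AddMonoidHom.ext fun z => map_add (Coind.ev (N := N) (ap E.1 z)) x y

variable (E : Der (𝟙 B) (coind N))

theorem cocycle_apply {α β : Γ} (x : deg B.obj α) (y : deg B.obj β) :
    cocycle E x y = Coind.ev (N := N) (ap E.1 y) x := rfl

theorem cocycle_res {α α' β β' : Γ} (f : α' ⟶ α) (g : β' ⟶ β) (x : deg B.obj α)
    (y : deg B.obj β) :
    cocycle E (res B.obj f x) (res B.obj g y) = res N.obj (f ⊗ₘ g) (cocycle E x y) := by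
  rw [cocycle_apply, cocycle_apply, ap_res]
  generalize ap E.1 y = φ
  change deg (Coind.grAb N) β at φ
  change Coind.ev (res (Coind.grAb N) g φ) (res B.obj f x) = _
  rw [Coind.ev_of_res, Coind.ev_res, ← res_comp]
  refine res_congr _ ?_ _
  rw [MonoidalCategory.tensorHom_def']

/-- This is the Leibniz rule for `E(y z)` evaluated at `x`. The corrected left action on `coind N`
supplies the term `x c(y, z)`, giving the Hochschild cocycle identity needed for associativity of
the extension. -/
theorem cocycle_mul {α β γ : Γ} (x : deg B.obj α) (y : deg B.obj β) (z : deg B.obj γ) :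
    cocycle E x (B.mul.app y z) =
      res N.obj (α_ α β γ).inv (cocycle E (B.mul.app x y) z) - N.left.app x (cocycle E y z) +
        res N.obj (α_ α β γ).inv (N.right.app (cocycle E x y) z) := by
  rw [cocycle_apply, Der.map_mul E]
  rfl

theorem cocycle_unit_right {α β : Γ} (x : deg B.obj α) (r : deg R.obj β) :
    cocycle E x (ap B.unit r) = 0 := by
  rw [cocycle_apply, Der.map_unit E]
  rfl

theorem cocycle_unit_left {α β : Γ} (r : deg R.obj α) (x : deg B.obj β) :
    cocycle E (ap B.unit r) x = 0 := Coind.ev_unit _ r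

variable (N) in
def grAb : GrAb Γ where
  obj γ := AddCommGrpCat.of (deg B.obj γ.unop × deg N.obj γ.unop)
  map f := AddCommGrpCat.ofHom ((res B.obj f.unop).prodMap (res N.obj f.unop))
  map_id γ := by
    refine AddCommGrpCat.hom_ext (AddMonoidHom.ext fun m => ?_)
    exact Prod.ext (res_id B.obj m.1) (res_id N.obj m.2)
  map_comp f g := by
    refine AddCommGrpCat.hom_ext (AddMonoidHom.ext fun m => ?_)
    exact Prod.ext (res_comp B.obj g.unop f.unop m.1) (res_comp N.obj g.unop f.unop m.2)

/-- The product `(x, m) (y, n) = (x y, x n + m y + c(x, y))`. -/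
def mul : Pairing (grAb N) (grAb N) (grAb N) where
  app {α β} := AddMonoidHom.mk' (fun p : deg B.obj α × deg N.obj α => AddMonoidHom.mk'
      (fun q : deg B.obj β × deg N.obj β => show deg (grAb N) (α ⊗ β) from
        (B.mul.app p.1 q.1, N.left.app p.1 q.2 + N.right.app p.2 q.1 + cocycle E p.1 q.1))
      fun q q' => Prod.ext (map_add (B.mul.app p.1) q.1 q'.1) (by
        change N.left.app p.1 (q.2 + q'.2) + N.right.app p.2 (q.1 + q'.1) +
          cocycle E p.1 (q.1 + q'.1) =
            (N.left.app p.1 q.2 + N.right.app p.2 q.1 + cocycle E p.1 q.1) +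
            (N.left.app p.1 q'.2 + N.right.app p.2 q'.1 + cocycle E p.1 q'.1)
        simp only [map_add]
        abel)) fun p p' => AddMonoidHom.ext fun q : deg B.obj β × deg N.obj β =>
      Prod.ext (congrArg (fun t => t q.1) (map_add B.mul.app p.1 p'.1)) (by
        change N.left.app (p.1 + p'.1) q.2 + N.right.app (p.2 + p'.2) q.1 +
          cocycle E (p.1 + p'.1) q.1 =
            (N.left.app p.1 q.2 + N.right.app p.2 q.1 + cocycle E p.1 q.1) +
            (N.left.app p'.1 q.2 + N.right.app p'.2 q.1 + cocycle E p'.1 q.1)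
        simp only [map_add, AddMonoidHom.add_apply]
        abel)
  app_res {α α' β β'} f g (p : deg B.obj α × deg N.obj α) (q : deg B.obj β × deg N.obj β) :=
    Prod.ext (B.mul.app_res f g p.1 q.1) (by
      change N.left.app (res B.obj f p.1) (res N.obj g q.2) +
        N.right.app (res N.obj f p.2) (res B.obj g q.1) +
        cocycle E (res B.obj f p.1) (res B.obj g q.1) = res N.obj (f ⊗ₘ g)
          (N.left.app p.1 q.2 + N.right.app p.2 q.1 + cocycle E p.1 q.1)
      rw [N.left.app_res, N.right.app_res, cocycle_res, map_add, map_add])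

/-- The extension of `B` by the square zero ideal `N` given by a derivation with values in
`coind N`. -/
def alg : GrAlg R where
  obj := grAb N
  mul := mul E
  one := show deg B.obj _ × deg N.obj _ from (B.one, 0)
  one_mul {α} (p : deg B.obj α × deg N.obj α) := Prod.ext (B.one_mul p.1) (by
    change N.left.app B.one p.2 + N.right.app 0 p.1 + cocycle E B.one p.1 =
      res N.obj (λ_ α).hom p.2
    rw [← B.unit_one, cocycle_unit_left, B.unit_one, N.one_left, map_zero,
      AddMonoidHom.zero_apply, add_zero, add_zero])
  mul_one {α} (p : deg B.obj α × deg N.obj α) := Prod.ext (B.mul_one p.1) (by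
    change N.left.app p.1 0 + N.right.app p.2 B.one + cocycle E p.1 B.one =
      res N.obj (ρ_ α).hom p.2
    rw [← B.unit_one, cocycle_unit_right, B.unit_one, N.right_one, map_zero, zero_add, add_zero])
  mul_assoc {α β γ} (p : deg B.obj α × deg N.obj α) (q : deg B.obj β × deg N.obj β)
      (r : deg B.obj γ × deg N.obj γ) := Prod.ext (B.mul_assoc p.1 q.1 r.1) (by
    change N.left.app (B.mul.app p.1 q.1) r.2 +
        N.right.app (N.left.app p.1 q.2 + N.right.app p.2 q.1 + cocycle E p.1 q.1) r.1 +
        cocycle E (B.mul.app p.1 q.1) r.1 = res N.obj (α_ α β γ).hom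
          (N.left.app p.1 (N.left.app q.1 r.2 + N.right.app q.2 r.1 + cocycle E q.1 r.1) +
            N.right.app p.2 (B.mul.app q.1 r.1) + cocycle E p.1 (B.mul.app q.1 r.1))
    simp only [map_add, map_sub, AddMonoidHom.add_apply, cocycle_mul, N.mul_left, N.right_mul,
      N.left_right, ← res_comp, Iso.hom_inv_id, res_id]
    abel)
  unit := mkHom (N := grAb N)
    (fun γ => AddMonoidHom.mk' (fun r => show deg B.obj γ × deg N.obj γ from (ap B.unit r, 0))
      fun r s => Prod.ext (map_add (ap B.unit) r s) (add_zero _).symm)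
    fun f r => Prod.ext (ap_res B.unit f r) (map_zero (res N.obj f)).symm
  unit_one := Prod.ext B.unit_one rfl
  unit_mul {α β} r s := Prod.ext (B.unit_mul r s) (by
    change 0 = N.left.app (ap B.unit r) 0 + N.right.app 0 (ap B.unit s) +
      cocycle E (ap B.unit r) (ap B.unit s)
    rw [cocycle_unit_left, map_zero, map_zero, AddMonoidHom.zero_apply, add_zero, add_zero])
  unit_comm {α β} r (p : deg B.obj β × deg N.obj β) := Prod.ext (B.unit_comm r p.1) (by
    change N.left.app (ap B.unit r) p.2 + N.right.app 0 p.1 + cocycle E (ap B.unit r) p.1 =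
      res N.obj (β_ α β).hom (N.left.app p.1 0 + N.right.app p.2 (ap B.unit r) +
        cocycle E p.1 (ap B.unit r))
    rw [cocycle_unit_left, cocycle_unit_right, map_zero, map_zero, AddMonoidHom.zero_apply,
      add_zero, add_zero, add_zero, zero_add, N.unit_central])

/-- The projection of the extension to `B`. -/
def fst : alg E ⟶ B where
  hom := mkHom (M := grAb N) (fun γ => AddMonoidHom.fst (deg B.obj γ) (deg N.obj γ)) fun _ _ => rfl
  map_one := rfl
  map_mul _ _ := rfl
  map_unit _ := rfl

variable (N) in
/-- The projection of the extension to `N`. -/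
def snd : grAb N ⟶ N.obj :=
  mkHom (M := grAb N) (fun γ => AddMonoidHom.snd (deg B.obj γ) (deg N.obj γ)) fun _ _ => rfl

theorem snd_mul {α β : Γ} (p : deg (alg E).obj α) (q : deg (alg E).obj β) :
    ap (snd N) ((alg E).mul.app p q) = N.left.app (ap (fst E).hom p) (ap (snd N) q) +
      N.right.app (ap (snd N) p) (ap (fst E).hom q) +
      cocycle E (ap (fst E).hom p) (ap (fst E).hom q) := rfl

/-- A derivation with values in `coind N` is inner if its square zero extension splits. -/
theorem exists_inner_eq (s : B ⟶ alg E) (hs : s ≫ fst E = 𝟙 B) :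
    ∃ φ, Der.inner (coind N) φ = E := by
  have hfst : ∀ {γ : Γ} (x : deg B.obj γ), ap (fst E).hom (ap s.hom x) = x := fun {γ} x =>
    congrArg (fun f : B ⟶ B => ap f.hom x) hs
  have hmul : ∀ {α β : Γ} (x : deg B.obj α) (y : deg B.obj β),
      ap (s.hom ≫ snd N) (B.mul.app x y) = N.left.app x (ap (s.hom ≫ snd N) y) +
        N.right.app (ap (s.hom ≫ snd N) x) y + cocycle E x y := fun {α β} x y => by
    have h := snd_mul E (ap s.hom x) (ap s.hom y)
    rw [← s.map_mul, hfst, hfst] at h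
    exact h
  have hunit : ∀ {α : Γ} (r : deg R.obj α), ap (s.hom ≫ snd N) (ap B.unit r) = 0 :=
    fun {α} r => congrArg (ap (snd N)) (s.map_unit r)
  -- The `N`-component of the section is the required cochain: multiplicativity of `s` says that its
  -- Leibniz defect is the cocycle of `E`.
  refine ⟨Coind.ofLinear (s.hom ≫ snd N) (fun {α δ} r x => ?_) ?_,
    Subtype.ext (PicGraded.hom_ext fun β b => Coind.ext fun δ x => ?_)⟩
  · rw [hmul, hunit, cocycle_unit_left, map_zero, AddMonoidHom.zero_apply, add_zero, add_zero]
  · rw [← B.unit_one, hunit]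
  · rw [Coind.ev_inner]
    simp only [Coind.ev_ofLinear, ← res_comp, Iso.inv_hom_id, res_id]
    rw [hmul, ← cocycle_apply]
    abel

end SqZero

/-- Derivations of a free algebra with values in a bimodule of the form `coind N` are inner. -/
theorem FreeAlg.inner_surjective (X : Γ → Type u) (N : GrBimod (FreeAlg R X)) :
    Function.Surjective (Der.inner (coind N)) := fun E =>
  SqZero.exists_inner_eq E
    -- Freeness splits the extension; the component in `N` of the lift of a generator is arbitrary
    -- and is taken to be `0`.
    (FreeAlg.lift (B := SqZero.alg E) fun γ x =>
      show deg (FreeAlg R X).obj γ × deg N.obj γ from (FreeAlg.of x, 0))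
    (FreeAlg.hom_ext fun _ _ => rfl)

end
end PicGraded

/-! ### Functoriality of `coind` for semilinear and for `R`-linear maps. -/

namespace PicGraded

section
variable {Γ : Type u} [Category.{u} Γ] [MonoidalCategory Γ] [SymmetricCategory Γ]
variable {R : GrCommRing Γ}

/-- The restriction of a bimodule along a map of algebras. -/
def GrBimod.restrict {A B : GrAlg R} (f : B ⟶ A) (M : GrBimod A) : GrBimod B where
  obj := M.obj
  left :=
    { app := M.left.app.comp (ap f.hom)
      app_res := fun g h b m => by
        change M.left.app (ap f.hom (res B.obj g b)) _ = res _ _ (M.left.app (ap f.hom b) m)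
        rw [ap_res, M.left.app_res] }
  right :=
    { app := M.right.app.compl₂ (ap f.hom)
      app_res := fun g h m b => by
        change M.right.app _ (ap f.hom (res B.obj h b)) = res _ _ (M.right.app m (ap f.hom b))
        rw [ap_res, M.right.app_res] }
  one_left m := by
    change M.left.app (ap f.hom B.one) m = _
    rw [f.map_one, M.one_left]
  mul_left a b m := by
    change M.left.app (ap f.hom (B.mul.app a b)) m =
      res M.obj _ (M.left.app (ap f.hom a) (M.left.app (ap f.hom b) m))
    rw [f.map_mul, M.mul_left]
  right_one m := by
    change M.right.app m (ap f.hom B.one) = _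
    rw [f.map_one, M.right_one]
  right_mul m a b := by
    change M.right.app (M.right.app m (ap f.hom a)) (ap f.hom b) =
      res M.obj _ (M.right.app m (ap f.hom (B.mul.app a b)))
    rw [f.map_mul, M.right_mul]
  left_right a m b := M.left_right (ap f.hom a) m (ap f.hom b)
  unit_central r m := by
    change M.left.app (ap f.hom (ap B.unit r)) m =
      res M.obj _ (M.right.app m (ap f.hom (ap B.unit r)))
    rw [f.map_unit, M.unit_central]

/-- A map of bimodules that is linear over a map of algebras. -/
structure SemiHom {B C : GrAlg R} (f : C ⟶ B) (N : GrBimod B) (N' : GrBimod C) where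
  hom : N.obj ⟶ N'.obj
  map_left : ∀ {α β : Γ} (c : deg C.obj α) (n : deg N.obj β),
    ap hom (N.left.app (ap f.hom c) n) = N'.left.app c (ap hom n)
  map_right : ∀ {α β : Γ} (n : deg N.obj α) (c : deg C.obj β),
    ap hom (N.right.app n (ap f.hom c)) = N'.right.app (ap hom n) c

namespace SemiHom
variable {B C : GrAlg R} {f : C ⟶ B} {N : GrBimod B} {N' : GrBimod C} (t : SemiHom f N N')

theorem map_unit_left {α β : Γ} (r : deg R.obj α) (n : deg N.obj β) :
    ap t.hom (N.left.app (ap B.unit r) n) = N'.left.app (ap C.unit r) (ap t.hom n) := by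
  rw [← t.map_left, f.map_unit]

/-- The derivation `t ∘ D ∘ f`. -/
def mapDer : Der (𝟙 B) N →+ Der (𝟙 C) N' :=
  AddMonoidHom.mk' (fun D => ⟨f.hom ≫ D.1 ≫ t.hom, by
    refine ⟨fun {α β} r x => ?_, fun {α β} x y => ?_⟩
    · change ap t.hom (ap D.1 (ap f.hom (C.mul.app (ap C.unit r) x))) =
        N'.left.app (ap C.unit r) (ap t.hom (ap D.1 (ap f.hom x)))
      rw [f.map_mul, f.map_unit, Der.map_unit_mul D, t.map_unit_left]
    · change ap t.hom (ap D.1 (ap f.hom (C.mul.app x y))) =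
        N'.left.app x (ap t.hom (ap D.1 (ap f.hom y))) +
          N'.right.app (ap t.hom (ap D.1 (ap f.hom x))) y
      rw [f.map_mul, Der.map_mul D, map_add, t.map_left, t.map_right]⟩) fun D E =>
    Subtype.ext (PicGraded.hom_ext fun γ x => map_add (ap t.hom) _ _)

theorem mapDer_apply (D : Der (𝟙 B) N) {γ : Γ} (x : deg C.obj γ) :
    ap (t.mapDer D).1 x = ap t.hom (ap D.1 (ap f.hom x)) := rfl

theorem mapDer_inner (n : deg N.obj (𝟙_ Γ)) :
    t.mapDer (Der.inner N n) = Der.inner N' (ap t.hom n) := by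
  refine Subtype.ext (PicGraded.hom_ext fun γ x => ?_)
  change ap t.hom (Der.commutator N n γ (ap f.hom x)) = Der.commutator N' (ap t.hom n) γ x
  rw [Der.commutator_apply, Der.commutator_apply, map_sub, ap_res, ap_res, t.map_left,
    t.map_right]

/-- The map `φ ↦ t ∘ φ ∘ f`. -/
def coindHom : Coind.grAb N ⟶ Coind.grAb N' :=
  mkHom (fun γ => AddMonoidHom.mk' (fun φ : deg (Coind.grAb N) γ =>
      Coind.mk (fun δ => (ap t.hom).comp ((Coind.ev φ).comp (ap f.hom)))
        (fun {δ ε} g x => by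
          change ap t.hom (Coind.ev φ (ap f.hom (res C.obj g x))) =
            res N'.obj _ (ap t.hom (Coind.ev φ (ap f.hom x)))
          rw [ap_res, Coind.ev_res, ap_res])
        (fun {α δ} r x => by
          change ap t.hom (Coind.ev φ (ap f.hom (C.mul.app (ap C.unit r) x))) =
            res N'.obj _ (N'.left.app _ (ap t.hom (Coind.ev φ (ap f.hom x))))
          rw [f.map_mul, f.map_unit, Coind.ev_unit_mul, ap_res, t.map_unit_left])
        (by
          change ap t.hom (Coind.ev φ (ap f.hom C.one)) = 0
          rw [f.map_one, Coind.ev_one, map_zero])) fun φ ψ =>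
      Coind.ext fun δ x => map_add (ap t.hom) _ _)
    fun {α β} g φ => Coind.ext fun δ x => ap_res t.hom _ _

theorem ev_coindHom {γ δ : Γ} (φ : deg (Coind.grAb N) γ) (x : deg C.obj δ) :
    Coind.ev (ap t.coindHom φ) x = ap t.hom (Coind.ev φ (ap f.hom x)) := rfl

theorem coindHom_ofDer (D : Der (𝟙 B) N) :
    ap t.coindHom (Coind.ofDer N D) = Coind.ofDer N' (t.mapDer D) := by
  refine Coind.ext fun δ x => ?_
  rw [ev_coindHom, Coind.ev_ofDer, Coind.ev_ofDer, mapDer_apply, ap_res]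

/-- The semilinear map `φ ↦ t ∘ φ ∘ f`. -/
def coind : SemiHom f (coind N) (PicGraded.coind N') where
  hom := t.coindHom
  map_left {α β} c (φ : deg (Coind.grAb N) β) := Coind.ext fun δ x => by
    change Coind.ev (ap t.coindHom (Coind.left (ap f.hom c) φ)) x =
      Coind.ev (Coind.left c (ap t.coindHom φ)) x
    rw [ev_coindHom, Coind.ev_left, Coind.ev_left, ev_coindHom, ev_coindHom, map_sub, ap_res,
      t.map_left, f.map_mul]
  map_right {α β} (φ : deg (Coind.grAb N) α) c := Coind.ext fun δ x => by
    change Coind.ev (ap t.coindHom (Coind.right φ (ap f.hom c))) x =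
      Coind.ev (Coind.right (ap t.coindHom φ) c) x
    rw [ev_coindHom, Coind.ev_right, Coind.ev_right, ev_coindHom, ap_res, t.map_right]

end SemiHom

namespace Coind
variable {B C : GrAlg R} {N : GrBimod B} {N' : GrBimod C}

/-- Scalars act on `coind N` through the values alone. Hence `φ ↦ s ∘ φ ∘ σ` is `R`-linear even when
`σ` and `s` respect only the module structures. -/
theorem ev_left_unit {γ α δ : Γ} (r : deg R.obj α) (φ : deg (grAb N) γ) (x : deg B.obj δ) :
    ev (left (ap B.unit r) φ) x =
      res N.obj (swap δ α γ) (N.left.app (ap B.unit r) (ev φ x)) := by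
  rw [ev_left, ev_unit, map_zero, sub_zero, ev_mul_unit, ← res_comp, Iso.inv_hom_id_assoc]

variable (σ : C.toMod ⟶ B.toMod) (hσ : ap σ.hom C.one = B.one) (s : N.toMod ⟶ N'.toMod)

theorem map_unit_mul_of_linear {α β : Γ} (r : deg R.obj α) (x : deg C.obj β) :
    ap σ.hom (C.mul.app (ap C.unit r) x) = B.mul.app (ap B.unit r) (ap σ.hom x) :=
  σ.map_smul r x

theorem map_unit_left_of_linear {α β : Γ} (r : deg R.obj α) (n : deg N.obj β) :
    ap s.hom (N.left.app (ap B.unit r) n) = N'.left.app (ap C.unit r) (ap s.hom n) :=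
  s.map_smul r n

/-- The map `φ ↦ s ∘ φ ∘ σ`, where `σ` and `s` are only `R`-linear. -/
def linearHom : grAb N ⟶ grAb N' :=
  mkHom (fun γ => AddMonoidHom.mk' (fun φ : deg (Coind.grAb N) γ =>
      mk (fun δ => (ap (M := N.obj) (N := N'.obj) s.hom).comp ((ev φ).comp (ap σ.hom)))
        (fun {δ ε} g x => by
          change ap s.hom (ev φ (ap σ.hom (res C.obj g x))) =
            res N'.obj _ (ap s.hom (ev φ (ap σ.hom x)))
          rw [ap_res, ev_res, ap_res])
        (fun {α δ} r x => by
          change ap s.hom (ev φ (ap σ.hom (C.mul.app (ap C.unit r) x))) =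
            res N'.obj _ (N'.left.app _ (ap s.hom (ev φ (ap σ.hom x))))
          rw [map_unit_mul_of_linear, ev_unit_mul, ap_res, map_unit_left_of_linear])
        (by
          change ap s.hom (ev φ (ap σ.hom C.one)) = 0
          rw [hσ, ev_one, map_zero])) fun φ ψ => ext fun δ x => map_add (ap s.hom) _ _)
    fun {α β} g φ => ext fun δ x => ap_res s.hom _ _

theorem ev_linearHom {γ δ : Γ} (φ : deg (grAb N) γ) (x : deg C.obj δ) :
    ev (ap (linearHom σ hσ s) φ) x = ap s.hom (ev φ (ap σ.hom x)) := rfl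

/-- The `R`-linear map `φ ↦ s ∘ φ ∘ σ`. -/
def linearMap : (coind N).toMod ⟶ (coind N').toMod where
  hom := linearHom σ hσ s
  map_smul {α β} r (φ : deg (grAb N) β) := ext fun δ x => by
    change ev (ap (linearHom σ hσ s) (left (ap B.unit r) φ)) x =
      ev (left (ap C.unit r) (ap (linearHom σ hσ s) φ)) x
    rw [ev_left_unit, ev_linearHom, ev_left_unit, ev_linearHom, ap_res, map_unit_left_of_linear]

end Coind

end
end PicGraded

/-! ### Contractible cosimplicial systems and exactness of the derivation complex. -/

namespace PicGraded

section cobd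
variable {G H : ℕ → Type*} [∀ n, AddCommGroup (G n)] [∀ n, AddCommGroup (H n)]

/-- The alternating sum of cofaces. -/
def cobd (d : ∀ n, Fin (n + 1) → G n →+ G (n + 1)) (n : ℕ) : G n →+ G (n + 1) :=
  ∑ i : Fin (n + 1), (-1 : ℤ) ^ (i : ℕ) • d n i

theorem cobd_apply (d : ∀ n, Fin (n + 1) → G n →+ G (n + 1)) (n : ℕ) (x : G n) :
    cobd d n x = ∑ i : Fin (n + 1), (-1 : ℤ) ^ (i : ℕ) • d n i x := by
  simp [cobd, AddMonoidHom.finsetSum_apply]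

theorem cobd_cobd (d : ∀ n, Fin (n + 1) → G n →+ G (n + 1))
    (hd : ∀ n (i j : Fin (n + 1)), i ≤ j → ∀ x,
      d (n + 1) j.succ (d n i x) = d (n + 1) i.castSucc (d n j x)) :
    ∀ (n : ℕ) (x : G n), cobd d (n + 1) (cobd d n x) = 0
  -- `alternating_sum_eq_zero` begins with two outer cofaces; the augmented complex also has a level
  -- with only one.
  | 0, x => by
    have h := hd 0 0 0 le_rfl x
    rw [cobd_apply, cobd_apply, Fin.sum_univ_two]
    have hx : ∑ i : Fin (0 + 1), (-1 : ℤ) ^ (i : ℕ) • d 0 i x = d 0 0 x := by simp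
    rw [hx, Fin.val_zero, Fin.val_one, pow_zero, pow_one, one_smul, neg_smul, one_smul]
    exact (sub_eq_add_neg _ _).symm.trans (sub_eq_zero.2 h.symm)
  | n + 1, x => by
    simp only [cobd_apply, map_sum, map_zsmul, Finset.smul_sum]
    exact alternating_sum_eq_zero n (fun i j => d (n + 2) j (d (n + 1) i x))
      fun i j hij => hd (n + 1) i j hij x

theorem contract_cobd_zero (d : ∀ n, Fin (n + 1) → G n →+ G (n + 1)) (h : ∀ n, G (n + 1) →+ G n)
    (h0 : ∀ n x, h n (d n 0 x) = x) (x : G 0) : h 0 (cobd d 0 x) = x := by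
  rw [cobd_apply]
  simp [h0]

/-- The zeroth coface contributes `x`. Moving `h` past a positive coface lowers its index by one and
so reverses its sign, which leaves `-d h x`. -/
theorem contract_cobd_succ (d : ∀ n, Fin (n + 1) → G n →+ G (n + 1)) (h : ∀ n, G (n + 1) →+ G n)
    (h0 : ∀ n x, h n (d n 0 x) = x)
    (hs : ∀ n (i : Fin (n + 1)) x, h (n + 1) (d (n + 1) i.succ x) = d n i (h n x))
    (n : ℕ) (x : G (n + 1)) : h (n + 1) (cobd d (n + 1) x) = x - cobd d n (h n x) := by
  rw [cobd_apply, cobd_apply, Fin.sum_univ_succ, map_add, map_sum, sub_eq_add_neg,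
    ← Finset.sum_neg_distrib]
  refine congrArg₂ _ ?_ (Finset.sum_congr rfl fun i _ => ?_)
  · rw [Fin.val_zero, pow_zero, one_smul, h0]
  · rw [map_zsmul, hs, Fin.val_succ, pow_succ, mul_neg_one, neg_smul]

theorem map_cobd (d : ∀ n, Fin (n + 1) → G n →+ G (n + 1))
    (d' : ∀ n, Fin (n + 1) → H n →+ H (n + 1)) (f : ∀ n, G n →+ H n)
    (hf : ∀ n i x, f (n + 1) (d n i x) = d' n i (f n x)) (n : ℕ) (x : G n) :
    f (n + 1) (cobd d n x) = cobd d' n (f n x) := by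
  simp only [cobd_apply, map_sum, map_zsmul, hf]

end cobd

section
variable {Γ : Type u} [Category.{u} Γ] [MonoidalCategory Γ] [SymmetricCategory Γ]
variable {R : GrCommRing Γ}

/-- Unital `R`-linear extra degeneracies of the standard resolution of `A`. -/
structure UnitalContraction (A : GrAlg R) where
  map : ∀ n, (A.bar n).toMod ⟶ (A.bar (n + 1)).toMod
  face_zero : ∀ n {γ : Γ} (x : deg (A.bar n).obj γ), ap (A.face n 0).hom (ap (map n).hom x) = x
  face_succ : ∀ n {γ : Γ} (i : Fin (n + 1)) (x : deg (A.bar (n + 1)).obj γ),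
    ap (A.face (n + 1) i.succ).hom (ap (map (n + 1)).hom x) =
      ap (map n).hom (ap (A.face n i).hom x)
  map_one : ∀ n, ap (map n).hom (A.bar n).one = (A.bar (n + 1)).one

/-- A cosimplicial bimodule over the standard resolution of `A`, with an `R`-linear contraction. -/
structure System (A : GrAlg R) where
  N : ∀ n, GrBimod (A.bar n)
  t : ∀ n (i : Fin (n + 1)), SemiHom (A.face n i) (N n) (N (n + 1))
  t_t : ∀ n (i j : Fin (n + 1)), i ≤ j → ∀ {γ : Γ} (x : deg (N n).obj γ),
    ap (t (n + 1) j.succ).hom (ap (t n i).hom x) =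
      ap (t (n + 1) i.castSucc).hom (ap (t n j).hom x)
  s : ∀ n, (N (n + 1)).toMod ⟶ (N n).toMod
  s_t_zero : ∀ n {γ : Γ} (x : deg (N n).obj γ), ap (s n).hom (ap (t n 0).hom x) = x
  s_t_succ : ∀ n (i : Fin (n + 1)) {γ : Γ} (x : deg (N (n + 1)).obj γ),
    ap (s (n + 1)).hom (ap (t (n + 1) i.succ).hom x) = ap (t n i).hom (ap (s n).hom x)

namespace System
variable {A : GrAlg R}

/-- The constant system of an `A`-bimodule. -/
def const (M : GrBimod A) : System A where
  N n := M.restrict (A.augmentation n)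
  t n i :=
    { hom := 𝟙 M.obj
      map_left := fun c m => by
        change M.left.app (ap (A.augmentation n).hom (ap (A.face n i).hom c)) m =
          M.left.app (ap (A.augmentation (n + 1)).hom c) m
        rw [← GrAlg.comp_apply, A.face_augmentation]
      map_right := fun m c => by
        change M.right.app m (ap (A.augmentation n).hom (ap (A.face n i).hom c)) =
          M.right.app m (ap (A.augmentation (n + 1)).hom c)
        rw [← GrAlg.comp_apply, A.face_augmentation] }
  t_t _ _ _ _ _ _ := rfl
  s n :=
    { hom := 𝟙 M.obj
      map_smul := fun r m => by
        change M.left.app (ap (A.augmentation (n + 1)).hom (ap (A.bar (n + 1)).unit r)) m =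
          M.left.app (ap (A.augmentation n).hom (ap (A.bar n).unit r)) m
        rw [GrAlg.Hom.map_unit, GrAlg.Hom.map_unit] }
  s_t_zero _ _ _ := rfl
  s_t_succ _ _ _ _ := rfl

/-- The cofaces on derivations. -/
def derCoface (S : System A) (n : ℕ) (i : Fin (n + 1)) :
    Der (𝟙 (A.bar n)) (S.N n) →+ Der (𝟙 (A.bar (n + 1))) (S.N (n + 1)) := (S.t n i).mapDer

/-- The system of the bimodules `coind (S.N n)`. -/
def coind (S : System A) (σ : UnitalContraction A) : System A where
  N n := PicGraded.coind (S.N n)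
  t n i := (S.t n i).coind
  t_t n i j hij γ (φ : deg (Coind.grAb (S.N n)) γ) := Coind.ext fun δ x => by
    change ap (S.t (n + 1) j.succ).hom (ap (S.t n i).hom (Coind.ev φ (ap (A.face n i).hom
      (ap (A.face (n + 1) j.succ).hom x)))) = ap (S.t (n + 1) i.castSucc).hom (ap (S.t n j).hom
        (Coind.ev φ (ap (A.face n j).hom (ap (A.face (n + 1) i.castSucc).hom x))))
    rw [S.t_t n i j hij, A.face_face_apply hij]
  -- Unitality of `σ` enters here: precomposition with `σ` must preserve vanishing at `1`.
  s n := Coind.linearMap (σ.map n) (σ.map_one n) (S.s n)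
  s_t_zero n γ (φ : deg (Coind.grAb (S.N n)) γ) := Coind.ext fun δ x => by
    change ap (S.s n).hom (ap (S.t n 0).hom (Coind.ev φ (ap (A.face n 0).hom
      (ap (σ.map n).hom x)))) = Coind.ev φ x
    rw [S.s_t_zero, σ.face_zero]
  s_t_succ n i γ (φ : deg (Coind.grAb (S.N (n + 1))) γ) := Coind.ext fun δ x => by
    change ap (S.s (n + 1)).hom (ap (S.t (n + 1) i.succ).hom (Coind.ev φ
      (ap (A.face (n + 1) i.succ).hom (ap (σ.map (n + 1)).hom x)))) =
      ap (S.t n i).hom (ap (S.s n).hom (Coind.ev φ (ap (σ.map n).hom (ap (A.face n i).hom x))))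
    rw [S.s_t_succ, σ.face_succ]

/-- The cofaces on the degree `𝟙_ Γ` part of a system of the form `coind`. -/
def coindCoface (S : System A) (n : ℕ) (i : Fin (n + 1)) :
    deg (Coind.grAb (S.N n)) (𝟙_ Γ) →+ deg (Coind.grAb (S.N (n + 1))) (𝟙_ Γ) :=
  ap (S.t n i).coindHom

/-- The contraction of the degree `𝟙_ Γ` part of a system of the form `coind`. -/
def coindContract (S : System A) (σ : UnitalContraction A) (n : ℕ) :
    deg (Coind.grAb (S.N (n + 1))) (𝟙_ Γ) →+ deg (Coind.grAb (S.N n)) (𝟙_ Γ) :=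
  ap (Coind.linearHom (σ.map n) (σ.map_one n) (S.s n))

theorem ofDer_cobd (S : System A) (n : ℕ) (D : Der (𝟙 (A.bar n)) (S.N n)) :
    Coind.ofDer (S.N (n + 1)) (cobd S.derCoface n D) =
      cobd S.coindCoface n (Coind.ofDer (S.N n) D) :=
  map_cobd S.derCoface S.coindCoface (fun n => Coind.ofDer (S.N n))
    (fun n i D => ((S.t n i).coindHom_ofDer D).symm) n D

/-- With `ofDer_cobd`, this makes the levelwise sequences `Der(N) → coind N → Der(coind N)` maps of
complexes, so that cocycles can be chased through them. -/
theorem inner_cobd (S : System A) (σ : UnitalContraction A) (n : ℕ)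
    (φ : deg (Coind.grAb (S.N n)) (𝟙_ Γ)) :
    Der.inner (PicGraded.coind (S.N (n + 1))) (cobd S.coindCoface n φ) =
      cobd (S.coind σ).derCoface n (Der.inner (PicGraded.coind (S.N n)) φ) :=
  map_cobd S.coindCoface (S.coind σ).derCoface
    (fun n => Der.inner (PicGraded.coind (S.N n)))
    (fun n i φ => ((S.t n i).coind.mapDer_inner φ).symm) n φ

theorem coindContract_coindCoface_zero (S : System A) (σ : UnitalContraction A) (n : ℕ)
    (φ : deg (Coind.grAb (S.N n)) (𝟙_ Γ)) :
    S.coindContract σ n (S.coindCoface n 0 φ) = φ :=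
  (S.coind σ).s_t_zero n φ

theorem coindContract_coindCoface_succ (S : System A) (σ : UnitalContraction A) (n : ℕ)
    (i : Fin (n + 1))
    (φ : deg (Coind.grAb (S.N (n + 1))) (𝟙_ Γ)) :
    S.coindContract σ (n + 1) (S.coindCoface (n + 1) i.succ φ) =
      S.coindCoface n i (S.coindContract σ n φ) :=
  (S.coind σ).s_t_succ n i φ

theorem coindCoface_coindCoface (σ : UnitalContraction A) (S : System A) (n : ℕ)
    (i j : Fin (n + 1)) (hij : i ≤ j)
    (φ : deg (Coind.grAb (S.N n)) (𝟙_ Γ)) : S.coindCoface (n + 1) j.succ (S.coindCoface n i φ) =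
      S.coindCoface (n + 1) i.castSucc (S.coindCoface n j φ) :=
  (S.coind σ).t_t n i j hij φ

/-- Derivations embed in the contractible complex of `coind`, whose first coboundary has the
contraction as a left inverse. -/
theorem eq_zero_of_cobd_eq_zero (σ : UnitalContraction A) (S : System A) (D : Der (𝟙 (A.bar 0)) (S.N 0))
    (hD : cobd S.derCoface 0 D = 0) : D = 0 := by
  have h := contract_cobd_zero S.coindCoface (S.coindContract σ)
    (S.coindContract_coindCoface_zero σ) (Coind.ofDer (S.N 0) D)
  rw [← ofDer_cobd, hD, map_zero, map_zero] at h
  exact Coind.ofDer_injective _ (h.symm.trans (map_zero _).symm)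

/-- A cocycle `D` is the coboundary of an `R`-linear cochain whose inner derivation is a
cocycle. -/
theorem exists_cobd_eq_ofDer (S : System A) (σ : UnitalContraction A) (n : ℕ)
    (D : Der (𝟙 (A.bar (n + 1))) (S.N (n + 1)))
    (hD : cobd S.derCoface (n + 1) D = 0) :
    ∃ φ : deg (Coind.grAb (S.N n)) (𝟙_ Γ),
      cobd S.coindCoface n φ = Coind.ofDer (S.N (n + 1)) D ∧
      cobd (S.coind σ).derCoface n (Der.inner (PicGraded.coind (S.N n)) φ) = 0 := by
  have h := contract_cobd_succ S.coindCoface (S.coindContract σ)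
    (S.coindContract_coindCoface_zero σ) (S.coindContract_coindCoface_succ σ) n
    (Coind.ofDer (S.N (n + 1)) D)
  rw [← ofDer_cobd, hD, map_zero, map_zero] at h
  have h' := (sub_eq_zero.1 h.symm).symm
  -- The witness is the contraction of `D` regarded as a cochain. The coboundary of its inner
  -- derivation is the inner derivation of `D` itself, which is zero because `D` is a derivation.
  exact ⟨_, h', (S.inner_cobd σ n _).symm.trans
    ((congrArg (Der.inner (PicGraded.coind (S.N (n + 1)))) h').trans (Coind.inner_ofDer D))⟩

/-- The complex of derivations of a system is exact in positive degrees. -/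
theorem exists_cobd_eq (σ : UnitalContraction A)
    (hi : ∀ n (N : GrBimod (A.bar n)), Function.Surjective (Der.inner (PicGraded.coind N)))
    (n : ℕ) : ∀ (S : System A) (D : Der (𝟙 (A.bar (n + 1))) (S.N (n + 1))),
      cobd S.derCoface (n + 1) D = 0 → ∃ E, cobd S.derCoface n E = D := by
  induction n with
  | zero =>
    intro S D hD
    obtain ⟨φ, h, h'⟩ := S.exists_cobd_eq_ofDer σ 0 D hD
    -- At the lowest level a cocycle of derivations is zero, so the inner derivation of `φ` vanishes
    -- and `φ` is itself a derivation.
    obtain ⟨E, rfl⟩ := Coind.exists_ofDer_eq φ (eq_zero_of_cobd_eq_zero σ (S.coind σ) _ h')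
    exact ⟨E, Coind.ofDer_injective _ (by rw [ofDer_cobd, h])⟩
  | succ n ih =>
    intro S D hD
    obtain ⟨φ, h, h'⟩ := S.exists_cobd_eq_ofDer σ (n + 1) D hD
    -- The induction hypothesis is applied to the system `coind`, one degree lower: the inner
    -- derivation of `φ` is a coboundary of some `E'`, and `E'` is inner by `hi`.
    obtain ⟨E', hE'⟩ := ih (S.coind σ) _ h'
    obtain ⟨ψ, rfl⟩ := hi n (S.N n) E'
    change deg (Coind.grAb (S.N n)) (𝟙_ Γ) at ψ
    -- Subtracting the coboundary of `ψ` makes the inner derivation of `φ` zero, and does not change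
    -- the coboundary of `φ`.
    obtain ⟨E, hE⟩ := Coind.exists_ofDer_eq (φ - cobd S.coindCoface n ψ) (by
      refine (map_sub (Der.inner (PicGraded.coind (S.N (n + 1)))) φ _).trans (sub_eq_zero.2 ?_)
      exact ((S.inner_cobd σ n ψ).trans hE').symm)
    refine ⟨E, Coind.ofDer_injective _ ?_⟩
    rw [ofDer_cobd, hE, map_sub, cobd_cobd S.coindCoface (coindCoface_coindCoface σ S), sub_zero, h]

end System

end
end PicGraded

/-! ### Derived functors of derivations and the proposition itself. -/

namespace PicGraded

section
variable {Γ : Type u} [Category.{u} Γ] [MonoidalCategory Γ] [SymmetricCategory Γ]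
variable {R : GrCommRing Γ}

/-- Derivations over `f` with values in `M` are derivations with values in the restriction. -/
def Der.restrictEquiv {A B : GrAlg R} (f : B ⟶ A) (M : GrBimod A) :
    Der f M ≃+ Der (𝟙 B) (M.restrict f) where
  toFun D := ⟨D.1, fun {α β} r x => by
    change ap D.1 _ = M.left.app (ap f.hom (ap B.unit r)) (ap D.1 x)
    rw [D.2.1, f.map_unit], D.2.2⟩
  invFun D := ⟨D.1, fun {α β} r x => by
    change _ = M.left.app (ap A.unit r) (ap D.1 x)
    rw [← f.map_unit]
    exact D.2.1 r x, D.2.2⟩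
  left_inv _ := rfl
  right_inv _ := rfl
  map_add' _ _ := rfl

variable {A : GrAlg R}

/-- The terms of the complex `derComplex M`, as derivations with values in the constant system. -/
def constDer (M : GrBimod A) (n : ℕ) :
    Der (A.augmentation n) M ≃+ Der (𝟙 (A.bar n)) ((System.const M).N n) :=
  Der.restrictEquiv (A.augmentation n) M

theorem constDer_derCoboundary (M : GrBimod A) (n : ℕ) (D : Der (A.augmentation (n + 1)) M) :
    constDer M (n + 2) (derCoboundary M n D) =
      cobd (System.const M).derCoface (n + 1) (constDer M (n + 1) D) := by
  rw [cobd_apply, derCoboundary, AddMonoidHom.finsetSum_apply, map_sum]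
  exact Finset.sum_congr rfl fun i _ => map_zsmul (constDer M (n + 2)) _ _

theorem derComplex_d (M : GrBimod A) (n : ℕ) :
    (derComplex M).d n (n + 1) = AddCommGrpCat.ofHom (derCoboundary M n) :=
  CochainComplex.of_d (fun n => AddCommGrpCat.of (Der (A.augmentation (n + 1)) M))
    (fun n => AddCommGrpCat.ofHom (derCoboundary M n)) n

/-- The derived functors of derivations vanish if the standard resolution of `A` has unital
`R`-linear extra degeneracies and all derivations of `A` are inner. -/
theorem derivedDer_subsingleton (σ : UnitalContraction A)
    (hi : ∀ N : GrBimod A, Function.Surjective (Der.inner N)) (M : GrBimod A) (s : ℕ) :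
    Subsingleton (DerivedDer M (s + 1)) := by
  -- Level `0` of the augmented resolution is `A` itself, where the hypothesis applies; the other
  -- levels are free algebras.
  have hi' : ∀ n (N : GrBimod (A.bar n)), Function.Surjective (Der.inner (coind N))
    | 0, N => hi (coind N)
    | n + 1, N => FreeAlg.inner_surjective _ N
  refine AddCommGrpCat.subsingleton_of_isZero
    ((HomologicalComplex.exactAt_iff_isZero_homology _ _).1 ?_)
  rw [HomologicalComplex.exactAt_iff' _ s (s + 1) (s + 2) (by simp) (by simp),
    ShortComplex.ab_exact_iff]
  intro (D : Der (A.augmentation (s + 2)) M) hD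
  have hD' : derCoboundary M (s + 1) D = 0 :=
    (congrArg (fun f => f.hom D) (derComplex_d M (s + 1))).symm.trans hD
  -- Degree `s` of the complex sits at level `s + 1` of the augmented resolution, since `bar A 0` is
  -- `A`.
  obtain ⟨E, hE⟩ := System.exists_cobd_eq σ hi' (s + 1) (System.const M)
    (constDer M (s + 2) D) (by rw [← constDer_derCoboundary, hD', map_zero])
  have h : derCoboundary M s ((constDer M (s + 1)).symm E) = D := by
    apply (constDer M (s + 2)).injective
    rw [constDer_derCoboundary, AddEquiv.apply_symm_apply, hE]
  exact ⟨(constDer M (s + 1)).symm E,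
    (congrArg (fun f => f.hom ((constDer M (s + 1)).symm E)) (derComplex_d M s)).trans h⟩

/-- Both halves of the generator condition are used: projectivity splits the cover of `A` at the
augmentation level, and separation provides the retraction that makes the extra degeneracies unital.
-/
theorem IsAzumaya.exists_unitalContraction (hA : IsAzumaya A) : Nonempty (UnitalContraction A) := by
  obtain ⟨g, hg⟩ := A.exists_retraction_of_isSeparating hA.isGradedGenerator.separating
  have := hA.isGradedGenerator.projective (𝟙_ Γ)
  obtain ⟨σ, h0, hs, h1⟩ := GrAlg.exists_unital_extraDegen (A := A)
    (fun n => match n with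
      | 0 => isRetractOfFree_of_projective A.toMod
      | n + 1 => FreeAlg.isRetractOfFree R fun γ => deg (A.bar n).obj γ) g hg
  exact ⟨⟨σ, h0, hs, h1⟩⟩

theorem hhZeroToModule_apply (M : GrBimod A) (γ : Γ) (e : HH 0 (M.shift γ)) :
    hhZeroToModule M γ e =
      res M.obj (ρ_ γ).inv (ap (regularHom (Abelian.Ext.addEquiv₀ e)) A.one) := rfl

theorem hhZeroToModule_injective (M : GrBimod A) (γ : Γ) :
    Function.Injective (hhZeroToModule M γ) := fun e e' h => by
  refine Abelian.Ext.addEquiv₀.injective (regular_hom_ext ?_)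
  have h' := congrArg (res M.obj (ρ_ γ).hom) h
  exact (res_hom_res_inv M.obj (ρ_ γ) _).symm.trans (h'.trans (res_hom_res_inv M.obj (ρ_ γ) _))

/-- This is `inner_eq_zero_iff` for the shifted bimodule, whose part of degree `𝟙_ Γ` is `M_{γ ⊗
𝟙}`; the right unitor identifies it with `M_γ`. -/
theorem exact_hhZeroToModule_innerDegree (M : GrBimod A) (γ : Γ) :
    Function.Exact (hhZeroToModule M γ) (innerDegree M γ) := fun m => by
  refine (inner_eq_zero_iff (N := M.shift γ) (res M.obj (ρ_ γ).hom m)).trans ⟨?_, ?_⟩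
  · rintro ⟨f, hf⟩
    refine ⟨Abelian.Ext.addEquiv₀.symm f, ?_⟩
    rw [hhZeroToModule_apply, AddEquiv.apply_symm_apply]
    refine (congrArg (res M.obj (ρ_ γ).inv) hf).trans ?_
    exact res_hom_res_inv M.obj (ρ_ γ).symm m
  · rintro ⟨e, rfl⟩
    refine ⟨Abelian.Ext.addEquiv₀ e, ?_⟩
    exact (res_hom_res_inv M.obj (ρ_ γ) _).symm

theorem innerDegree_surjective (M : GrBimod A) (γ : Γ)
    (h : Function.Surjective (Der.inner (M.shift γ))) :
    Function.Surjective (innerDegree M γ) := fun D => by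
  obtain ⟨(n : deg M.obj (γ ⊗ 𝟙_ Γ)), hn⟩ := h D
  refine ⟨res M.obj (ρ_ γ).inv n, ?_⟩
  change Der.inner (M.shift γ) (res M.obj (ρ_ γ).hom (res M.obj (ρ_ γ).inv n)) = D
  rw [res_hom_res_inv]
  exact hn

end
end PicGraded

theorem mainTheorem12 {Γ : Type u} [Groupoid.{u} Γ] [MonoidalCategory Γ] [SymmetricCategory Γ]
    [PicGraded.IsPicard Γ] {R : PicGraded.GrCommRing Γ} (A : PicGraded.GrAlg R)
    (hA : PicGraded.IsAzumaya A) (M : PicGraded.GrBimod A) :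
    (∀ γ : Γ, Function.Injective (PicGraded.hhZeroToModule M γ) ∧
      Function.Exact (PicGraded.hhZeroToModule M γ) (PicGraded.innerDegree M γ) ∧
      Function.Surjective (PicGraded.innerDegree M γ)) ∧
    (∀ s : ℕ, 0 < s → Subsingleton (PicGraded.HH s M)) ∧
    (∀ s : ℕ, 0 < s → Subsingleton (PicGraded.DerivedDer M s)) := by
  obtain ⟨e, he⟩ := hA.exists_isSeparabilityIdempotent
  obtain ⟨σ⟩ := hA.exists_unitalContraction
  refine ⟨fun γ => ⟨PicGraded.hhZeroToModule_injective M γ,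
    PicGraded.exact_hhZeroToModule_innerDegree M γ,
    PicGraded.innerDegree_surjective M γ (he.inner_surjective _)⟩, fun s hs => ?_, fun s hs => ?_⟩
  · obtain ⟨s, rfl⟩ := Nat.exists_eq_succ_of_ne_zero hs.ne'
    have := he.projective_regular
    exact Abelian.Ext.subsingleton_of_projective _ _ s
  · obtain ⟨s, rfl⟩ := Nat.exists_eq_succ_of_ne_zero hs.ne'
    exact PicGraded.derivedDer_subsingleton σ he.inner_surjective M s
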